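/- Let $a>0$ and consider walks in the quadrant $\mathbb{Z}_{\ge 0}^2$ starting at $(0,0)$, with steps N, E, S, W of weight $1$ and NE of weight $a$, so that the step polynomial is $S(x,y)=x+y+\frac1x+\frac1y+axy$ and the kernel is $K(x,y)=xy\,(1-tS(x,y))$. Let $Q(0,0)=\sum_{n\ge0}q_n t^n$, where $q_n$ is the weighted number of such walks of length $n$ ending at $(0,0)$, and let $t_c$ be the smallest positive singularity of $Q(0,0)$. For $\Im\tau>0$ let $$\vartheta(z|\tau)=\sum_{n=0}^{\infty}(-1)^n e^{i\pi\tau(n+\frac12)^2}\left(e^{(2n+1)iz}-e^{-(2n+1)iz}\right),$$ and let $\vartheta'$ be its derivative in $z$. A theta parametrisation at $t$ is a triple $(c,\gamma,\tau)\in\mathbb{C}^3$ with $\gamma,\tau\in i\mathbb{R}$ and $0<\Im(2\gamma)<\Im(\pi\tau)$ such that $$ac^3=-\frac{\vartheta(4\gamma|\tau)}{\vartheta(2\gamma|\tau)},\qquad c^2=\frac{\vartheta(3\gamma|\tau)}{\vartheta(\gamma|\tau)},\qquad \frac ct=4\frac{\vartheta'(\gamma|\tau)\vartheta(2\gamma|\tau)}{\vartheta'(0|\tau)\vartheta(\gamma|\tau)}-2\frac{\vartheta'(2\gamma|\tau)}{\vartheta'(0|\tau)},$$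 and such that the functions $$X(z)=c\,\frac{\vartheta(z|\tau)\vartheta(z+\gamma|\tau)}{\vartheta(z-\gamma|\tau)\vartheta(z+2\gamma|\tau)},\qquad Y(z)=c\,\frac{\vartheta(z|\tau)\vartheta(z-\gamma|\tau)}{\vartheta(z+\gamma|\tau)\vartheta(z-2\gamma|\tau)}=X(-z)$$ satisfy $K(X(z),Y(z))=0$ wherever both are finite. Then $t_c>0$; for every $t\in(0,t_c)$ a theta parametrisation exists, and the nome $q=e^{i\pi\tau}$ is the same for all theta parametrisations at $t$. So $q=q(t)$ is a function of $t\in(0,t_c)$, and moreover: 1. $q(t)$ is real with $0<q(t)<1$ for $0<t<t_c$; 2. $q(t)$ is continuous on $(0,t_c)$; 3. $\lim_{t\to0^+}q(t)=0$; 4. $\lim_{t\to t_c^-}q(t)=1$. -/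

import Mathlib

open Set Filter Topology

noncomputable section

/-- The Jacobi theta function
`ϑ(z|τ) = ∑_{n ≥ 0} (-1)^n e^{iπτ(n+1/2)²} (e^{(2n+1)iz} - e^{-(2n+1)iz})`. -/
def jacobiTh (z τ : ℂ) : ℂ :=
  ∑' n : ℕ, (-1 : ℂ) ^ n * Complex.exp (Complex.I * Real.pi * τ * ((n : ℂ) + 1 / 2) ^ 2) *
    (Complex.exp ((2 * (n : ℂ) + 1) * Complex.I * z)
      - Complex.exp (-((2 * (n : ℂ) + 1) * Complex.I * z)))

/-- The derivative `ϑ'(z|τ)` with respect to the first variable. -/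
def jacobiThDeriv (z τ : ℂ) : ℂ := deriv (fun w : ℂ => jacobiTh w τ) z

/-- The kernel `K(x,y) = xy(1 - t S(x,y))`, as a polynomial, for the step polynomial
`S(x,y) = x + y + 1/x + 1/y + a x y`. -/
def walkKernel (a t : ℝ) (x y : ℂ) : ℂ :=
  x * y - t * (x ^ 2 * y + x * y ^ 2 + y + x + a * x ^ 2 * y ^ 2)

/-- `X(z) = c ϑ(z) ϑ(z+γ) / (ϑ(z-γ) ϑ(z+2γ))`; the second coordinate is `Y(z) = X(-z)`. -/
def thetaX (c γ τ z : ℂ) : ℂ :=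
  c * (jacobiTh z τ * jacobiTh (z + γ) τ) / (jacobiTh (z - γ) τ * jacobiTh (z + 2 * γ) τ)

/-- `Y(z) = c ϑ(z) ϑ(z-γ) / (ϑ(z+γ) ϑ(z-2γ))`. -/
def thetaY (c γ τ z : ℂ) : ℂ :=
  c * (jacobiTh z τ * jacobiTh (z - γ) τ) / (jacobiTh (z + γ) τ * jacobiTh (z - 2 * γ) τ)

/-- `(c, γ, τ)` is a theta parametrisation of the kernel curve of the walk with unit weight on
the steps N, E, S, W and weight `a` on the step NE, at the value `t`. -/
structure IsThetaParametrisation (a t : ℝ) (c γ τ : ℂ) : Prop where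
  gamma_re : γ.re = 0
  tau_re : τ.re = 0
  gamma_pos : 0 < (2 * γ).im
  gamma_lt : (2 * γ).im < ((Real.pi : ℂ) * τ).im
  eq_c3 : (a : ℂ) * c ^ 3 = -(jacobiTh (4 * γ) τ / jacobiTh (2 * γ) τ)
  eq_c2 : c ^ 2 = jacobiTh (3 * γ) τ / jacobiTh γ τ
  eq_t : c / (t : ℂ) =
    4 * (jacobiThDeriv γ τ * jacobiTh (2 * γ) τ / (jacobiThDeriv 0 τ * jacobiTh γ τ))
      - 2 * (jacobiThDeriv (2 * γ) τ / jacobiThDeriv 0 τ)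
  /-- The point `(X(z), Y(z))` lies on the kernel curve, wherever `X` and `Y` are finite. -/
  on_curve : ∀ z : ℂ, jacobiTh (z - γ) τ * jacobiTh (z + 2 * γ) τ ≠ 0 →
    jacobiTh (z + γ) τ * jacobiTh (z - 2 * γ) τ ≠ 0 →
    walkKernel a t (thetaX c γ τ z) (thetaY c γ τ z) = 0

/-- The weighted number of walks of length `n` from `(0,0)` to `(i,j)` that stay in the quadrant
`i, j ≥ 0`, with steps N, E, S, W of weight `1` and NE of weight `a`. -/
def quadrantWalks (a : ℝ) : ℕ → ℤ → ℤ → ℝ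
  | 0, i, j => if i = 0 ∧ j = 0 then 1 else 0
  | n + 1, i, j =>
    if 0 ≤ i ∧ 0 ≤ j then
      quadrantWalks a n (i - 1) j + quadrantWalks a n (i + 1) j
        + quadrantWalks a n i (j - 1) + quadrantWalks a n i (j + 1)
        + a * quadrantWalks a n (i - 1) (j - 1)
    else 0

/-- The generating function `Q(0,0;t)` of quadrant excursions (used for `t` near `0` only). -/
def excursionSeries (a t : ℝ) : ℝ := ∑' n : ℕ, quadrantWalks a n 0 0 * t ^ n

/-- The critical point `t_c`: the smallest positive singularity of `Q(0,0;t)`. There is a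
singularity in `(0, s]` exactly when the germ of the series at `0` has no analytic continuation
along `[0, s]`. -/
def criticalPoint (a : ℝ) : ℝ :=
  sInf {s : ℝ | 0 < s ∧
    ¬ ∃ g : ℝ → ℝ, AnalyticOnNhd ℝ g (Icc 0 s) ∧ g =ᶠ[𝓝 0] excursionSeries a}

end

/-! Write τ = iσ, φ = γ/τ and p = e^{-π/σ}, the nome dual to q = e^{-πσ}. Jacobi's imaginary
transformation turns the theta values in the equations into real theta functions of nome p at
multiples of the real angle φ in (0, π/2), and rescales c to a number d.

Weierstrass' three-term identity and its derivative show that the equations for c² and ac³ alone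
make S(X(z), Y(z)) constant (`step_thetaX_thetaY`); the third equation says that this constant is
1/t. Positivity of 1/t forces d > 0, hence π/4 < φ < π/3. There the two equations have exactly one
solution (φ, d) for each p, because ϑ is monotone on each half of (0, π) (`thetaAngle_spec`,
`eq_thetaScale`). Evaluating S at a point with X = Y gives the constant in closed form, `stepValue a
p`, continuous on [0, 1). So the parametrisations at t correspond to the solutions p of `stepValue a
p = 1 / t`.

It remains to see that `stepValue a` maps (0, 1) bijectively onto (1/t_c, ∞). Injectivity recovers p
from the value v: X has four real ramification points, which are the roots of a quartic depending
only on a and v. The sign of Y splits them into two pairs, and an invariant of the two pairs is an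
injective function of p (`pairInvariant_theta`, `nomeModulus_injOn`). A continuous injective
function is strictly monotone, and this one tends to infinity as p → 1 (`th3_zero_le_stepValue`). At
p = 0 the thetas are trigonometric and the value is S(x, x) at its critical point x > 0, where ax³ +
x² = 1.

That this value is 1/t_c is a statement about excursions (`criticalPoint_eq`). Weighting walks by
x^{i+j} bounds their number above by S(x, x)^n. At the critical x the weighted walk has no drift,
and a bump on a large disc shows that no smaller growth rate is possible. Pringsheim's theorem then
puts the first singularity at 1/S(x, x). Passing from p back to q reverses order, which gives the
limits 0 and 1 of q. -/

/-! ### Addition formulas for the complex theta functions -/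

/-- The theta function with half-integer exponents,
`∑_{n ∈ ℤ} exp(2πi(n+1/2)z + πi(n+1/2)²τ)`. -/
noncomputable def halfTheta (z τ : ℂ) : ℂ :=
  Complex.exp (Real.pi * Complex.I * τ / 4 + Real.pi * Complex.I * z) *
    jacobiTheta₂ (z + τ / 2) τ

lemma hasSum_halfTheta (z : ℂ) {τ : ℂ} (hτ : 0 < τ.im) :
    HasSum (fun n : ℤ => Complex.exp (2 * Real.pi * Complex.I * ((n : ℂ) + 1 / 2) * z
      + Real.pi * Complex.I * ((n : ℂ) + 1 / 2) ^ 2 * τ)) (halfTheta z τ) := by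
  have h := (hasSum_jacobiTheta₂_term (z + τ / 2) hτ).mul_left
    (Complex.exp (Real.pi * Complex.I * τ / 4 + Real.pi * Complex.I * z))
  refine h.congr_fun (fun n => ?_)
  rw [jacobiTheta₂_term, ← Complex.exp_add]
  congr 1
  ring

/-- Pairs of integers, split by the parity of their sum, in the coordinates half-sum and
half-difference. -/
noncomputable def sumDiffEquiv : (ℤ × ℤ) ⊕ (ℤ × ℤ) ≃ ℤ × ℤ :=
  Equiv.ofBijective
    (Sum.elim (fun x => (x.1 + x.2, x.1 - x.2)) (fun x => (x.1 + x.2 + 1, x.1 - x.2))) (by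
      constructor
      · rintro (⟨a, b⟩ | ⟨a, b⟩) (⟨c, d⟩ | ⟨c, d⟩) h <;>
          simp only [Sum.elim_inl, Sum.elim_inr, Prod.mk.injEq] at h
        · have h1 : a = c := by omega
          have h2 : b = d := by omega
          rw [h1, h2]
        · omega
        · omega
        · have h1 : a = c := by omega
          have h2 : b = d := by omega
          rw [h1, h2]
      · rintro ⟨m, n⟩
        rcases Int.even_or_odd' (m + n) with ⟨k, hk | hk⟩
        · refine ⟨Sum.inl (k, m - k), ?_⟩
          simp only [Sum.elim_inl, Prod.mk.injEq]
          omega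
        · refine ⟨Sum.inr (k, m - k - 1), ?_⟩
          simp only [Sum.elim_inr, Prod.mk.injEq]
          omega)

lemma sumDiffEquiv_inl (n : ℤ × ℤ) : sumDiffEquiv (Sum.inl n) = (n.1 + n.2, n.1 - n.2) := rfl

lemma sumDiffEquiv_inr (n : ℤ × ℤ) :
    sumDiffEquiv (Sum.inr n) = (n.1 + n.2 + 1, n.1 - n.2) := rfl

/-- Multiply the two series and sort the pairs (m, n) by the parity of m + n. For (k + l, k - l) the
form m² + n² becomes 2(k² + l²), which doubles τ. In the odd case the same holds with k + 1/2 and l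
+ 1/2, hence the half-integer series. -/
theorem jacobiTheta₂_add_mul_sub (x y : ℂ) {τ : ℂ} (hτ : 0 < τ.im) :
    jacobiTheta₂ (x + y) τ * jacobiTheta₂ (x - y) τ =
      jacobiTheta₂ (2 * x) (2 * τ) * jacobiTheta₂ (2 * y) (2 * τ)
        + halfTheta (2 * x) (2 * τ) * halfTheta (2 * y) (2 * τ) := by
  have hτ2 : 0 < (2 * τ).im := by
    simpa using hτ
  have prod : ∀ {f g : ℤ → ℂ} {a b : ℂ}, HasSum f a → HasSum g b →
      HasSum (fun n : ℤ × ℤ => f n.1 * g n.2) (a * b) := by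
    intro f g a b hf hg
    exact hf.mul hg (summable_mul_of_summable_norm hf.summable.norm hg.summable.norm)
  have h1 := prod (hasSum_jacobiTheta₂_term (x + y) hτ) (hasSum_jacobiTheta₂_term (x - y) hτ)
  have h2 := prod (hasSum_jacobiTheta₂_term (2 * x) hτ2) (hasSum_jacobiTheta₂_term (2 * y) hτ2)
  have h3 := prod (hasSum_halfTheta (2 * x) hτ2) (hasSum_halfTheta (2 * y) hτ2)
  rw [← sumDiffEquiv.hasSum_iff] at h1
  refine h1.unique (HasSum.sum ?_ ?_)
  · refine h2.congr_fun (fun n => ?_)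
    simp only [Function.comp_apply, sumDiffEquiv_inl,
      jacobiTheta₂_term, ← Complex.exp_add]
    congr 1
    push_cast
    ring
  · refine h3.congr_fun (fun n => ?_)
    simp only [Function.comp_apply, sumDiffEquiv_inr,
      jacobiTheta₂_term, ← Complex.exp_add]
    congr 1
    push_cast
    ring

lemma halfTheta_add_one (z τ : ℂ) : halfTheta (z + 1) τ = -halfTheta z τ := by
  have h : z + 1 + τ / 2 = z + τ / 2 + 1 := by ring
  have e : (Real.pi : ℂ) * Complex.I * τ / 4 + Real.pi * Complex.I * (z + 1)
      = (Real.pi * Complex.I * τ / 4 + Real.pi * Complex.I * z) + Real.pi * Complex.I := by ring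
  rw [halfTheta, halfTheta, h, jacobiTheta₂_add_left, e, Complex.exp_add _ (Real.pi * Complex.I),
    Complex.exp_pi_mul_I]
  ring

lemma halfTheta_add_self (z τ : ℂ) :
    halfTheta (z + τ / 2) τ =
      Complex.exp (-(Real.pi * Complex.I * τ / 4) - Real.pi * Complex.I * z)
        * jacobiTheta₂ z τ := by
  have h : z + τ / 2 + τ / 2 = z + τ := by ring
  rw [halfTheta, h, jacobiTheta₂_add_left', ← mul_assoc, ← Complex.exp_add]
  congr 2
  ring

/-- Replace x by x + τ/2 in the previous formula: 2x then moves by half of the period 2τ, which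
exchanges the two theta functions up to exponentials. -/
theorem halfTheta_add_mul_sub (x y : ℂ) {τ : ℂ} (hτ : 0 < τ.im) :
    halfTheta (x + y) τ * halfTheta (x - y) τ =
      halfTheta (2 * x) (2 * τ) * jacobiTheta₂ (2 * y) (2 * τ)
        + jacobiTheta₂ (2 * x) (2 * τ) * halfTheta (2 * y) (2 * τ) := by
  have h := jacobiTheta₂_add_mul_sub (x + τ / 2) y hτ
  have e1 : x + τ / 2 + y = x + y + τ / 2 := by ring
  have e2 : x + τ / 2 - y = x - y + τ / 2 := by ring
  have e3 : 2 * (x + τ / 2) = 2 * x + 2 * τ / 2 := by ring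
  rw [e1, e2, e3, halfTheta_add_self] at h
  have e4 : Complex.exp (Real.pi * Complex.I * τ / 4 + Real.pi * Complex.I * (x + y)) *
      Complex.exp (Real.pi * Complex.I * τ / 4 + Real.pi * Complex.I * (x - y))
      = Complex.exp (Real.pi * Complex.I * (2 * τ) / 4 + Real.pi * Complex.I * (2 * x)) := by
    rw [← Complex.exp_add]
    congr 1
    ring
  have e5 : Complex.exp (Real.pi * Complex.I * (2 * τ) / 4 + Real.pi * Complex.I * (2 * x)) *
      Complex.exp (-(Real.pi * Complex.I * (2 * τ) / 4) - Real.pi * Complex.I * (2 * x)) = 1 := by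
    rw [← Complex.exp_add, ← Complex.exp_zero]
    congr 1
    ring
  rw [halfTheta, halfTheta, halfTheta]
  linear_combination
    (Complex.exp (Real.pi * Complex.I * (2 * τ) / 4 + Real.pi * Complex.I * (2 * x))) * h
    + (jacobiTheta₂ (x + y + τ / 2) τ * jacobiTheta₂ (x - y + τ / 2) τ) * e4
    + jacobiTheta₂ (2 * x) (2 * τ) * halfTheta (2 * y) (2 * τ) * e5

/-! ### The function ϑ and its identities -/

/-- Fold the sum over ℤ by pairing n with -(n + 1). The shift by 1/2 produces the sign (-1)^n and
the factors ±i that make ϑ odd. -/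
theorem jacobiTh_eq_halfTheta (z : ℂ) {τ : ℂ} (hτ : 0 < τ.im) :
    jacobiTh z τ = -Complex.I * halfTheta (z / Real.pi + 1 / 2) τ := by
  have h := ((hasSum_halfTheta (z / Real.pi + 1 / 2) hτ).mul_left (-Complex.I)).nat_add_neg_add_one
  rw [jacobiTh, ← h.tsum_eq]
  refine tsum_congr (fun n => ?_)
  have hpi : (Real.pi : ℂ) ≠ 0 := by exact_mod_cast Real.pi_ne_zero
  have i1 : Complex.exp (Real.pi * Complex.I * (n : ℂ)) = (-1) ^ n := by
    rw [mul_comm, Complex.exp_nat_mul, Complex.exp_pi_mul_I]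
  have i1' : Complex.exp (-(Real.pi * Complex.I * (n : ℂ))) = (-1) ^ n := by
    rw [Complex.exp_neg, i1]
    rcases neg_one_pow_eq_or ℂ n with h | h <;> rw [h] <;> norm_num
  have i2 : Complex.exp (Real.pi / 2 * Complex.I) = Complex.I := Complex.exp_pi_div_two_mul_I
  have i3 : Complex.exp (-(Real.pi / 2 * Complex.I)) = -Complex.I := by
    rw [Complex.exp_neg, i2, Complex.inv_I]
  have a1 : Complex.exp (2 * Real.pi * Complex.I * (((n : ℤ) : ℂ) + 1 / 2) * (z / Real.pi + 1 / 2)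
      + Real.pi * Complex.I * (((n : ℤ) : ℂ) + 1 / 2) ^ 2 * τ)
      = (-1) ^ n * Complex.I * Complex.exp (Complex.I * Real.pi * τ * ((n : ℂ) + 1 / 2) ^ 2) *
        Complex.exp ((2 * (n : ℂ) + 1) * Complex.I * z) := by
    refine Eq.trans ?_ (congrArg₂ (fun u v => u * v * _ * _) i1 i2)
    rw [← Complex.exp_add, ← Complex.exp_add, ← Complex.exp_add]
    congr 1
    push_cast
    field_simp
    ring
  have a2 : Complex.exp (2 * Real.pi * Complex.I * (((-((n : ℤ) + 1) : ℤ) : ℂ) + 1 / 2) *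
      (z / Real.pi + 1 / 2)
      + Real.pi * Complex.I * (((-((n : ℤ) + 1) : ℤ) : ℂ) + 1 / 2) ^ 2 * τ)
      = (-1) ^ n * (-Complex.I) * Complex.exp (Complex.I * Real.pi * τ * ((n : ℂ) + 1 / 2) ^ 2) *
        Complex.exp (-((2 * (n : ℂ) + 1) * Complex.I * z)) := by
    refine Eq.trans ?_ (congrArg₂ (fun u v => u * v * _ * _) i1' i3)
    rw [← Complex.exp_add, ← Complex.exp_add, ← Complex.exp_add]
    congr 1
    push_cast
    field_simp
    ring
  rw [a1, a2]
  linear_combination (-1 : ℂ) ^ n *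
    Complex.exp (Complex.I * Real.pi * τ * ((n : ℂ) + 1 / 2) ^ 2) *
    (Complex.exp ((2 * (n : ℂ) + 1) * Complex.I * z)
      - Complex.exp (-((2 * (n : ℂ) + 1) * Complex.I * z))) * Complex.I_sq

lemma jacobiTh_neg (z τ : ℂ) : jacobiTh (-z) τ = -jacobiTh z τ := by
  rw [jacobiTh, jacobiTh, ← tsum_neg]
  refine tsum_congr (fun n => ?_)
  rw [mul_neg, neg_neg]
  ring

lemma jacobiTh_zero (τ : ℂ) : jacobiTh 0 τ = 0 := by
  simp [jacobiTh]

lemma jacobiTh_eq_jacobiTheta₂ (z : ℂ) {τ : ℂ} (hτ : 0 < τ.im) :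
    jacobiTh z τ = Complex.exp (Real.pi * Complex.I * τ / 4 + Complex.I * z) *
      jacobiTheta₂ (z / Real.pi + 1 / 2 + τ / 2) τ := by
  have hpi : (Real.pi : ℂ) ≠ 0 := by exact_mod_cast Real.pi_ne_zero
  have e : (Real.pi : ℂ) * Complex.I * τ / 4 + Real.pi * Complex.I * (z / Real.pi + 1 / 2)
      = (Real.pi * Complex.I * τ / 4 + Complex.I * z) + Real.pi / 2 * Complex.I := by
    field_simp
    ring
  rw [jacobiTh_eq_halfTheta z hτ, halfTheta, e, Complex.exp_add _ (Real.pi / 2 * Complex.I),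
    Complex.exp_pi_div_two_mul_I]
  linear_combination -(Complex.exp (Real.pi * Complex.I * τ / 4 + Complex.I * z) *
      jacobiTheta₂ (z / Real.pi + 1 / 2 + τ / 2) τ) * Complex.I_sq

/-- Shifting the argument of `ϑ` by half a period gives the even theta function without zeros on
the real line. -/
lemma jacobiTh_sub_half_period (z : ℂ) {τ : ℂ} (hτ : 0 < τ.im) :
    jacobiTh (z - Real.pi * τ / 2) τ =
      Complex.exp (-(Real.pi * Complex.I * τ / 4) + Complex.I * z) *
      jacobiTheta₂ (z / Real.pi + 1 / 2) τ := by
  have hpi : (Real.pi : ℂ) ≠ 0 := by exact_mod_cast Real.pi_ne_zero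
  rw [jacobiTh_eq_jacobiTheta₂ _ hτ]
  congr 2
  · ring
  · field_simp
    ring

lemma differentiable_jacobiTheta₂ {τ : ℂ} (hτ : 0 < τ.im) :
    Differentiable ℂ (fun z => jacobiTheta₂ z τ) :=
  fun z => differentiableAt_jacobiTheta₂_fst z hτ

lemma differentiable_halfTheta {τ : ℂ} (hτ : 0 < τ.im) :
    Differentiable ℂ (fun z => halfTheta z τ) := by
  unfold halfTheta
  refine Differentiable.mul (by fun_prop) ?_
  exact (differentiable_jacobiTheta₂ hτ).comp (by fun_prop)

lemma differentiable_jacobiTh {τ : ℂ} (hτ : 0 < τ.im) :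
    Differentiable ℂ (fun z => jacobiTh z τ) := by
  have : (fun z => jacobiTh z τ) =
      fun z => -Complex.I * halfTheta (z / Real.pi + 1 / 2) τ :=
    funext fun z => jacobiTh_eq_halfTheta z hτ
  rw [this]
  exact ((differentiable_halfTheta hτ).comp
    (by fun_prop : Differentiable ℂ fun z : ℂ => z / Real.pi + 1 / 2)).const_mul _

lemma jacobiTh_hasDerivAt {τ : ℂ} (hτ : 0 < τ.im) (z : ℂ) :
    HasDerivAt (fun z => jacobiTh z τ) (jacobiThDeriv z τ) z :=
  (differentiable_jacobiTh hτ z).hasDerivAt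

/-- The addition formula `ϑ(x+y)ϑ(x-y) = A(x)B(y) - B(x)A(y)`. -/
theorem jacobiTh_add_mul_sub {τ : ℂ} (hτ : 0 < τ.im) :
    ∃ A B : ℂ → ℂ, Differentiable ℂ A ∧ Differentiable ℂ B ∧
      ∀ x y, jacobiTh (x + y) τ * jacobiTh (x - y) τ = A x * B y - B x * A y := by
  have hτ2 : 0 < (2 * τ).im := by simpa using hτ
  refine ⟨fun x => halfTheta (2 * (x / Real.pi)) (2 * τ),
    fun x => jacobiTheta₂ (2 * (x / Real.pi)) (2 * τ), ?_, ?_, fun x y => ?_⟩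
  · exact (differentiable_halfTheta hτ2).comp
      (by fun_prop : Differentiable ℂ fun x : ℂ => 2 * (x / Real.pi))
  · exact (differentiable_jacobiTheta₂ hτ2).comp
      (by fun_prop : Differentiable ℂ fun x : ℂ => 2 * (x / Real.pi))
  · have h := halfTheta_add_mul_sub (x / Real.pi + 1 / 2) (y / Real.pi) hτ
    have e1 : (x + y) / (Real.pi : ℂ) + 1 / 2 = x / Real.pi + 1 / 2 + y / Real.pi := by ring
    have e2 : (x - y) / (Real.pi : ℂ) + 1 / 2 = x / Real.pi + 1 / 2 - y / Real.pi := by ring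
    have e3 : 2 * (x / (Real.pi : ℂ) + 1 / 2) = 2 * (x / Real.pi) + 1 := by ring
    rw [e3, halfTheta_add_one, jacobiTheta₂_add_left] at h
    rw [jacobiTh_eq_halfTheta _ hτ, jacobiTh_eq_halfTheta _ hτ, e1, e2]
    linear_combination halfTheta (x / Real.pi + 1 / 2 + y / Real.pi) τ *
      halfTheta (x / Real.pi + 1 / 2 - y / Real.pi) τ * Complex.I_sq - h

/-- Weierstrass' three-term identity. -/
theorem jacobiTh_three_term {τ : ℂ} (hτ : 0 < τ.im) (x y u v : ℂ) :
    jacobiTh (x + y) τ * jacobiTh (x - y) τ * (jacobiTh (u + v) τ * jacobiTh (u - v) τ)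
      - jacobiTh (x + u) τ * jacobiTh (x - u) τ * (jacobiTh (y + v) τ * jacobiTh (y - v) τ)
      + jacobiTh (x + v) τ * jacobiTh (x - v) τ * (jacobiTh (y + u) τ * jacobiTh (y - u) τ)
      = 0 := by
  obtain ⟨A, B, -, -, h⟩ := jacobiTh_add_mul_sub hτ
  simp only [h]
  ring

/-- The differentiated three-term identity. -/
theorem jacobiTh_deriv_identity {τ : ℂ} (hτ : 0 < τ.im) (m v : ℂ) :
    jacobiThDeriv (m - v) τ * jacobiTh (m + v) τ * jacobiTh v τ ^ 2
      - jacobiThDeriv (m + v) τ * jacobiTh (m - v) τ * jacobiTh v τ ^ 2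
      + 2 * jacobiThDeriv v τ * jacobiTh v τ * (jacobiTh (m + v) τ * jacobiTh (m - v) τ)
      = jacobiThDeriv 0 τ * jacobiTh (2 * v) τ * jacobiTh m τ ^ 2 := by
  obtain ⟨A, B, hA, hB, h⟩ := jacobiTh_add_mul_sub hτ
  have hy : ∀ x y, jacobiThDeriv (x + y) τ * jacobiTh (x - y) τ
      - jacobiTh (x + y) τ * jacobiThDeriv (x - y) τ = A x * deriv B y - B x * deriv A y := by
    intro x y
    have h1 : HasDerivAt (fun y => jacobiTh (x + y) τ * jacobiTh (x - y) τ)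
        (jacobiThDeriv (x + y) τ * jacobiTh (x - y) τ
          + jacobiTh (x + y) τ * -jacobiThDeriv (x - y) τ) y :=
      ((jacobiTh_hasDerivAt hτ (x + y)).comp_const_add x y).mul
        ((jacobiTh_hasDerivAt hτ (x - y)).comp_const_sub x y)
    have h2 : HasDerivAt (fun y => A x * B y - B x * A y)
        (A x * deriv B y - B x * deriv A y) y :=
      ((hB y).hasDerivAt.const_mul _).sub ((hA y).hasDerivAt.const_mul _)
    simp only [h] at h1
    have := h1.unique h2
    linear_combination this
  have hsq : ∀ x, jacobiTh x τ ^ 2 = A x * B 0 - B x * A 0 := by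
    intro x
    have := h x 0
    rw [add_zero, sub_zero] at this
    rw [sq, this]
  have hsq' : ∀ x, 2 * jacobiThDeriv x τ * jacobiTh x τ = deriv A x * B 0 - deriv B x * A 0 := by
    intro x
    have h1 : HasDerivAt (fun x => jacobiTh x τ ^ 2)
        (2 * jacobiTh x τ ^ 1 * jacobiThDeriv x τ) x := (jacobiTh_hasDerivAt hτ x).pow 2
    have h2 : HasDerivAt (fun x => A x * B 0 - B x * A 0)
        (deriv A x * B 0 - deriv B x * A 0) x :=
      ((hA x).hasDerivAt.mul_const _).sub ((hB x).hasDerivAt.mul_const _)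
    simp only [hsq] at h1
    have := h1.unique h2
    linear_combination this
  -- At x = y = v the term with ϑ(x - y) drops out, so the Wronskian of A and B at v is -ϑ(2v)ϑ'(0).
  -- The identity is then linear algebra in the values of A, B and their derivatives.
  have hw := hy v v
  rw [sub_self, jacobiTh_zero, ← two_mul] at hw
  have hmv := hy m v
  have hp := h m v
  have e1 := hsq v
  have e2 := hsq m
  have e3 := hsq' v
  rw [e1, e2, e3, hp]
  linear_combination -(A v * B 0 - B v * A 0) * hmv + (A m * B 0 - B m * A 0) * hw

/-- If ϑ'(0) = 0, the Wronskian of A and B vanishes identically. Then A/B is locally constant, A is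
globally a multiple of B, and ϑ(x)² = A(x)B(0) - B(x)A(0) vanishes everywhere. -/
theorem jacobiThDeriv_zero_ne_zero {τ : ℂ} (hτ : 0 < τ.im) {w : ℂ} (hw : jacobiTh w τ ≠ 0) :
    jacobiThDeriv 0 τ ≠ 0 := by
  intro h0
  obtain ⟨A, B, hA, hB, h⟩ := jacobiTh_add_mul_sub hτ
  have hwr : ∀ x, A x * deriv B x - B x * deriv A x = 0 := by
    intro x
    have h1 : HasDerivAt (fun y => jacobiTh (x + y) τ * jacobiTh (x - y) τ)
        (jacobiThDeriv (x + x) τ * jacobiTh (x - x) τ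
          + jacobiTh (x + x) τ * -jacobiThDeriv (x - x) τ) x :=
      ((jacobiTh_hasDerivAt hτ (x + x)).comp_const_add x x).mul
        ((jacobiTh_hasDerivAt hτ (x - x)).comp_const_sub x x)
    have h2 : HasDerivAt (fun y => A x * B y - B x * A y)
        (A x * deriv B x - B x * deriv A x) x :=
      ((hB x).hasDerivAt.const_mul _).sub ((hA x).hasDerivAt.const_mul _)
    simp only [h] at h1
    rw [← h1.unique h2, sub_self, jacobiTh_zero, h0]
    ring
  have hsq : ∀ x, jacobiTh x τ ^ 2 = A x * B 0 - B x * A 0 := by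
    intro x
    have := h x 0
    rw [add_zero, sub_zero] at this
    rw [sq, this]
  obtain ⟨x₀, hx₀⟩ : ∃ x, B x ≠ 0 := by
    by_contra! hB0
    have := hsq w
    rw [hB0, hB0] at this
    exact hw (pow_eq_zero_iff (two_ne_zero) |>.1 (by rw [this]; ring))
  obtain ⟨r, hr, hball⟩ := Metric.eventually_nhds_iff_ball.1
    ((hB x₀).continuousAt.eventually_ne hx₀)
  have hconst : ∀ x ∈ Metric.ball x₀ r, A x / B x = A x₀ / B x₀ := by
    intro x hx
    refine Metric.isOpen_ball.is_const_of_deriv_eq_zero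
      (convex_ball x₀ r).isPreconnected (f := fun x => A x / B x) ?_ ?_ hx
      (Metric.mem_ball_self hr)
    · exact fun y hy => ((hA y).div (hB y) (hball y hy)).differentiableWithinAt
    · intro y hy
      change deriv (fun x => A x / B x) y = 0
      have h3 := hwr y
      have h4 := (hA y).hasDerivAt.fun_div (hB y).hasDerivAt (hball y hy)
      rw [h4.deriv]
      rw [div_eq_zero_iff]
      left
      linear_combination -h3
  have hAB : A = fun x => A x₀ / B x₀ * B x := by
    refine AnalyticOnNhd.eq_of_eventuallyEq (𝕜 := ℂ) (z₀ := x₀)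
      (fun x _ => hA.analyticAt x) (fun x _ => (hB.const_mul _).analyticAt x) ?_
    filter_upwards [Metric.ball_mem_nhds x₀ hr] with x hx
    rw [← hconst x hx, div_mul_cancel₀ _ (hball x hx)]
  have := hsq w
  rw [congrFun hAB w, congrFun hAB 0] at this
  exact hw (pow_eq_zero_iff (two_ne_zero) |>.1 (by rw [this]; ring))

/-- The imaginary transformation of Jacobi. -/
theorem jacobiTh_functional_equation (z : ℂ) {τ : ℂ} (hτ : 0 < τ.im) :
    jacobiTh z τ = Complex.I / (-Complex.I * τ) ^ (1 / 2 : ℂ) *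
      Complex.exp (-(Complex.I * z ^ 2 / (Real.pi * τ))) * jacobiTh (z / τ) (-1 / τ) := by
  have hpi : (Real.pi : ℂ) ≠ 0 := by exact_mod_cast Real.pi_ne_zero
  have hτ0 : τ ≠ 0 := by
    rintro rfl
    simp at hτ
  have hτ' : 0 < (-1 / τ).im := by
    rw [neg_div, Complex.neg_im, one_div, Complex.inv_im, neg_div, neg_neg]
    exact div_pos hτ (Complex.normSq_pos.2 hτ0)
  rw [jacobiTh_eq_jacobiTheta₂ z hτ, jacobiTh_eq_jacobiTheta₂ _ hτ',
    jacobiTheta₂_functional_equation]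
  -- The transformed argument differs from the one in ϑ(z/τ | -1/τ) by one quasi-period -1/τ.
  have hq := jacobiTheta₂_add_left' ((z / Real.pi + 1 / 2 + τ / 2) / τ) (-1 / τ)
  have e1 : (z / Real.pi + 1 / 2 + τ / 2) / τ + -1 / τ = z / τ / Real.pi + 1 / 2 + -1 / τ / 2 := by
    field_simp
    ring
  rw [e1] at hq
  have e2 : Complex.exp (Real.pi / 2 * Complex.I) = Complex.I := Complex.exp_pi_div_two_mul_I
  rw [hq]
  have key : Complex.exp (Real.pi * Complex.I * τ / 4 + Complex.I * z) *
      Complex.exp (-Real.pi * Complex.I * (z / Real.pi + 1 / 2 + τ / 2) ^ 2 / τ)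
      = Complex.exp (Real.pi / 2 * Complex.I) *
        Complex.exp (-(Complex.I * z ^ 2 / (Real.pi * τ))) *
        Complex.exp (Real.pi * Complex.I * (-1 / τ) / 4 + Complex.I * (z / τ)) *
        Complex.exp (-Real.pi * Complex.I * (-1 / τ + 2 * ((z / Real.pi + 1 / 2 + τ / 2) / τ))) := by
    simp only [← Complex.exp_add]
    congr 1
    field_simp
    ring
  rw [e2] at key
  linear_combination (1 / (-Complex.I * τ) ^ (1 / 2 : ℂ)) *
    jacobiTheta₂ ((z / Real.pi + 1 / 2 + τ / 2) / τ) (-1 / τ) * key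

/-! ### The step polynomial along the theta curve -/

/-- The step polynomial evaluated along the theta parametrisation is constant. -/
theorem step_thetaX_thetaY {τ : ℂ} (hτ : 0 < τ.im) {a c γ : ℂ} (hc : c ≠ 0)
    (h1 : jacobiTh γ τ ≠ 0) (h2 : jacobiTh (2 * γ) τ ≠ 0)
    (h3 : a * c ^ 3 = -(jacobiTh (4 * γ) τ / jacobiTh (2 * γ) τ))
    (hc2 : c ^ 2 = jacobiTh (3 * γ) τ / jacobiTh γ τ) {z : ℂ}
    (hz : jacobiTh z τ ≠ 0) (hp : jacobiTh (z + γ) τ ≠ 0) (hm : jacobiTh (z - γ) τ ≠ 0)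
    (hpp : jacobiTh (z + 2 * γ) τ ≠ 0) (hmm : jacobiTh (z - 2 * γ) τ ≠ 0) :
    thetaX c γ τ z + thetaY c γ τ z + 1 / thetaX c γ τ z + 1 / thetaY c γ τ z
        + a * (thetaX c γ τ z * thetaY c γ τ z) =
      (4 * (jacobiThDeriv γ τ * jacobiTh (2 * γ) τ / (jacobiThDeriv 0 τ * jacobiTh γ τ))
      - 2 * (jacobiThDeriv (2 * γ) τ / jacobiThDeriv 0 τ)) / c := by
  have hd0 := jacobiThDeriv_zero_ne_zero hτ h1
  have W1 := jacobiTh_three_term hτ z (2 * γ) γ 0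
  have D1 := jacobiTh_deriv_identity hτ (z + γ) γ
  have D2 := jacobiTh_deriv_identity hτ (z - γ) γ
  have D3 := jacobiTh_deriv_identity hτ z (2 * γ)
  have e1 : 2 * γ + γ = 3 * γ := by ring
  have e2 : 2 * γ - γ = γ := by ring
  have e3 : z + γ - γ = z := by ring
  have e4 : z + γ + γ = z + 2 * γ := by ring
  have e5 : z - γ - γ = z - 2 * γ := by ring
  have e6 : z - γ + γ = z := by ring
  have e7 : 2 * (2 * γ) = 4 * γ := by ring
  rw [e1, e2, add_zero, add_zero, sub_zero, sub_zero, add_zero, sub_zero] at W1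
  rw [e3, e4] at D1
  rw [e5, e6] at D2
  rw [e7] at D3
  unfold thetaX thetaY
  generalize jacobiTh (z + 2 * γ) τ = tpp at *
  generalize jacobiTh (z - 2 * γ) τ = tmm at *
  generalize jacobiTh (z + γ) τ = tp at *
  generalize jacobiTh (z - γ) τ = tm at *
  generalize jacobiTh z τ = t0 at *
  generalize jacobiTh (2 * γ) τ = g2 at *
  generalize jacobiTh (3 * γ) τ = g3 at *
  generalize jacobiTh (4 * γ) τ = g4 at *
  generalize jacobiTh γ τ = g1 at *
  generalize jacobiThDeriv 0 τ = d0 at *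
  generalize jacobiThDeriv γ τ = d1 at *
  generalize jacobiThDeriv (2 * γ) τ = d2 at *
  have hc2' : c ^ 2 * g1 = g3 := by rw [hc2, div_mul_cancel₀ _ h1]
  have h3' : a * c ^ 3 * g2 = -g4 := by
    rw [h3, neg_mul, div_mul_cancel₀ _ h2]
  -- This makes X + 1/Y and Y + 1/X single quotients of thetas.
  have W : c ^ 2 * t0 ^ 2 + tpp * tmm = g2 ^ 2 / g1 ^ 2 * (tm * tp) := by
    field_simp
    rw [← hc2'] at W1
    linear_combination W1
  have X1 : c * (t0 * tp) / (tm * tpp) + 1 / (c * (t0 * tm) / (tp * tmm))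
      = g2 ^ 2 / g1 ^ 2 * tp ^ 2 / (c * t0 * tpp) := by
    have : c * (t0 * tp) / (tm * tpp) + 1 / (c * (t0 * tm) / (tp * tmm))
      = (c ^ 2 * t0 ^ 2 + tpp * tmm) * tp / (c * t0 * tm * tpp) := by
      field_simp
    rw [this, W]
    field_simp
  have X2 : c * (t0 * tm) / (tp * tmm) + 1 / (c * (t0 * tp) / (tm * tpp))
      = g2 ^ 2 / g1 ^ 2 * tm ^ 2 / (c * t0 * tmm) := by
    have : c * (t0 * tm) / (tp * tmm) + 1 / (c * (t0 * tp) / (tm * tpp))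
      = (c ^ 2 * t0 ^ 2 + tpp * tmm) * tm / (c * t0 * tp * tmm) := by
      field_simp
    rw [this, W]
    field_simp
  have X3 : a * (c * (t0 * tp) / (tm * tpp) * (c * (t0 * tm) / (tp * tmm)))
      = -(g4 * t0 ^ 2) / (c * g2 * tpp * tmm) := by
    rw [div_mul_div_comm, mul_div_assoc', div_eq_div_iff (by positivity) (by positivity)]
    linear_combination tm * tp * tpp * tmm * t0 ^ 2 * h3'
  have : c * (t0 * tp) / (tm * tpp) + c * (t0 * tm) / (tp * tmm)
      + 1 / (c * (t0 * tp) / (tm * tpp)) + 1 / (c * (t0 * tm) / (tp * tmm))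
      = g2 ^ 2 / g1 ^ 2 * tp ^ 2 / (c * t0 * tpp) + g2 ^ 2 / g1 ^ 2 * tm ^ 2 / (c * t0 * tmm) := by
    rw [← X1, ← X2]
    ring
  rw [this, X3]
  -- The derivative identities express the three remaining quotients by logarithmic derivatives of
  -- ϑ. Those at z and z ± 2γ cancel, leaving only the ones at γ and 2γ.
  have T1 := (eq_div_iff (mul_ne_zero hd0 h2)).2 ((mul_comm _ _).trans D1.symm)
  have T2 := (eq_div_iff (mul_ne_zero hd0 h2)).2 ((mul_comm _ _).trans D2.symm)
  have T3 := (eq_div_iff hd0).2 ((mul_comm _ _).trans ((mul_assoc _ _ _).symm.trans D3.symm))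
  rw [T1, T2, T3]
  field_simp
  ring

/-- As a quadratic in Y, the curve S = v has root product 1/(1 + aX), so this factorisation
determines Y² where the two roots coincide. It is the three-term identity centred at z + γ/2. -/
theorem one_add_mul_thetaX {τ : ℂ} (hτ : 0 < τ.im) {a c γ : ℂ} (hc : c ≠ 0)
    (h1 : jacobiTh γ τ ≠ 0) (h2 : jacobiTh (2 * γ) τ ≠ 0)
    (h3 : a * c ^ 3 = -(jacobiTh (4 * γ) τ / jacobiTh (2 * γ) τ))
    (hc2 : c ^ 2 = jacobiTh (3 * γ) τ / jacobiTh γ τ) {z : ℂ}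
    (hm : jacobiTh (z - γ) τ ≠ 0) (hpp : jacobiTh (z + 2 * γ) τ ≠ 0) :
    1 + a * thetaX c γ τ z = jacobiTh (z - 2 * γ) τ * jacobiTh (z + 3 * γ) τ /
      (c ^ 2 * (jacobiTh (z - γ) τ * jacobiTh (z + 2 * γ) τ)) := by
  have W := jacobiTh_three_term hτ (z + γ / 2) (3 * γ / 2) (5 * γ / 2) (γ / 2)
  have e1 : z + γ / 2 + 3 * γ / 2 = z + 2 * γ := by ring
  have e2 : z + γ / 2 - 3 * γ / 2 = z - γ := by ring
  have e3 : 5 * γ / 2 + γ / 2 = 3 * γ := by ring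
  have e4 : 5 * γ / 2 - γ / 2 = 2 * γ := by ring
  have e5 : z + γ / 2 + 5 * γ / 2 = z + 3 * γ := by ring
  have e6 : z + γ / 2 - 5 * γ / 2 = z - 2 * γ := by ring
  have e7 : 3 * γ / 2 + γ / 2 = 2 * γ := by ring
  have e8 : 3 * γ / 2 - γ / 2 = γ := by ring
  have e9 : z + γ / 2 + γ / 2 = z + γ := by ring
  have e10 : z + γ / 2 - γ / 2 = z := by ring
  have e11 : 3 * γ / 2 + 5 * γ / 2 = 4 * γ := by ring
  have e12 : 3 * γ / 2 - 5 * γ / 2 = -γ := by ring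
  rw [e1, e2, e3, e4, e5, e6, e7, e8, e9, e10, e11, e12, jacobiTh_neg] at W
  have hc2' : c ^ 2 * jacobiTh γ τ = jacobiTh (3 * γ) τ := by rw [hc2, div_mul_cancel₀ _ h1]
  have h3' : a * c ^ 3 * jacobiTh (2 * γ) τ = -jacobiTh (4 * γ) τ := by
    rw [h3, neg_mul, div_mul_cancel₀ _ h2]
  rw [thetaX, eq_div_iff (by positivity), mul_div_assoc', add_mul, mul_comm (_ / _ : ℂ),
    mul_assoc (c ^ 2), mul_div_cancel₀ _ (mul_ne_zero hm hpp), one_mul]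
  refine mul_right_cancel₀ (mul_ne_zero h1 h2) ?_
  linear_combination W + jacobiTh (z - γ) τ * jacobiTh (z + 2 * γ) τ * jacobiTh (2 * γ) τ * hc2'
    + jacobiTh γ τ * jacobiTh z τ * jacobiTh (z + γ) τ * h3'

/-- The arguments of numerator and denominator have equal sums, while their sums of squares differ
by 4γ². The Gaussian factors of the imaginary transformation therefore leave only a constant
independent of z. -/
lemma thetaX_scale {τ : ℂ} (hτ : 0 < τ.im) (c γ z : ℂ) :
    thetaX c γ τ z =
      thetaX (c * Complex.exp (4 * (Complex.I * γ ^ 2 / (Real.pi * τ)))) (γ / τ) (-1 / τ)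
        (z / τ) := by
  have hpi : (Real.pi : ℂ) ≠ 0 := by exact_mod_cast Real.pi_ne_zero
  have hτ0 : τ ≠ 0 := by
    rintro rfl
    simp at hτ
  have hK : Complex.I / (-Complex.I * τ) ^ (1 / 2 : ℂ) ≠ 0 := by
    refine div_ne_zero Complex.I_ne_zero ?_
    rw [Complex.cpow_ne_zero_iff]
    left
    simp [hτ0]
  have e1 : z / τ + γ / τ = (z + γ) / τ := by ring
  have e2 : z / τ - γ / τ = (z - γ) / τ := by ring
  have e3 : z / τ + 2 * (γ / τ) = (z + 2 * γ) / τ := by ring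
  rw [thetaX, thetaX, e1, e2, e3, jacobiTh_functional_equation z hτ,
    jacobiTh_functional_equation (z + γ) hτ, jacobiTh_functional_equation (z - γ) hτ,
    jacobiTh_functional_equation (z + 2 * γ) hτ]
  generalize Complex.I / (-Complex.I * τ) ^ (1 / 2 : ℂ) = K at *
  have key : Complex.exp (-(Complex.I * z ^ 2 / (Real.pi * τ))) *
      Complex.exp (-(Complex.I * (z + γ) ^ 2 / (Real.pi * τ))) =
      Complex.exp (4 * (Complex.I * γ ^ 2 / (Real.pi * τ))) *
      (Complex.exp (-(Complex.I * (z - γ) ^ 2 / (Real.pi * τ))) *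
      Complex.exp (-(Complex.I * (z + 2 * γ) ^ 2 / (Real.pi * τ)))) := by
    simp only [← Complex.exp_add]
    congr 1
    field_simp
    ring
  have r : ∀ a b u v A B C D : ℂ, c * (K * a * A * (K * b * B)) / (K * u * C * (K * v * D))
      = c * ((K * K * (a * b)) * (A * B)) / ((K * K * (u * v)) * (C * D)) := by
    intros; ring_nf
  rw [r, key]
  have hne : K * K * (Complex.exp (-(Complex.I * (z - γ) ^ 2 / (Real.pi * τ))) *
      Complex.exp (-(Complex.I * (z + 2 * γ) ^ 2 / (Real.pi * τ)))) ≠ 0 :=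
    mul_ne_zero (mul_ne_zero hK hK) (mul_ne_zero (Complex.exp_ne_zero _) (Complex.exp_ne_zero _))
  rw [← mul_div_mul_left (c * _ * (_ * _)) _ hne]
  congr 1
  ring

lemma thetaY_eq_thetaX_neg (c γ τ z : ℂ) : thetaY c γ τ z = thetaX c γ τ (-z) := by
  have e1 : -z + γ = -(z - γ) := by ring
  have e2 : -z - γ = -(z + γ) := by ring
  have e3 : -z + 2 * γ = -(z - 2 * γ) := by ring
  rw [thetaX, thetaY, e1, e2, e3]
  simp only [jacobiTh_neg]
  ring_nf

/-! ### Theta functions of a real nome -/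

/-- The theta function `2 ∑ (-1)^n p^{n(n+1)} sin((2n+1)x)` of a real nome. -/
noncomputable def th1 (p x : ℝ) : ℝ :=
  ∑' n : ℕ, 2 * ((-1) ^ n * p ^ (n * (n + 1)) * Real.sin ((2 * n + 1) * x))

/-- The theta function `1 + 2 ∑ p^{n²} cos(2nx)` of a real nome. -/
noncomputable def th3 (p x : ℝ) : ℝ :=
  1 + ∑' n : ℕ, 2 * (p ^ ((n + 1) ^ 2) * Real.cos (2 * (n + 1) * x))

/-- The shift of `th1` by a quarter period. -/
noncomputable def th2 (p x : ℝ) : ℝ := th1 p (x + Real.pi / 2)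

/-- The shift of `th3` by a quarter period. -/
noncomputable def th4 (p x : ℝ) : ℝ := th3 p (x + Real.pi / 2)

lemma norm_th1_term_le {p r : ℝ} (hp : 0 ≤ p) (hpr : p ≤ r) (hr : r < 1) (x : ℝ) (n : ℕ) :
    ‖2 * ((-1) ^ n * p ^ (n * (n + 1)) * Real.sin ((2 * n + 1) * x))‖ ≤ 2 * r ^ n := by
  rw [norm_mul, norm_mul, norm_mul, norm_pow, norm_pow, norm_neg, norm_one, one_pow, one_mul,
    Real.norm_of_nonneg hp, Real.norm_of_nonneg (by norm_num : (0 : ℝ) ≤ 2)]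
  have h1 : p ^ (n * (n + 1)) ≤ r ^ n :=
    (pow_le_pow_of_le_one hp (hpr.trans hr.le) (Nat.le_mul_of_pos_right n n.succ_pos)).trans
      (pow_le_pow_left₀ hp hpr n)
  have h2 : ‖Real.sin ((2 * n + 1) * x)‖ ≤ 1 := Real.abs_sin_le_one _
  have h3 : 0 ≤ p ^ (n * (n + 1)) := by positivity
  nlinarith [norm_nonneg (Real.sin ((2 * n + 1) * x))]

lemma norm_th3_term_le {p r : ℝ} (hp : 0 ≤ p) (hpr : p ≤ r) (hr : r < 1) (x : ℝ) (n : ℕ) :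
    ‖2 * (p ^ ((n + 1) ^ 2) * Real.cos (2 * (n + 1) * x))‖ ≤ 2 * r ^ n := by
  rw [norm_mul, norm_mul, norm_pow,
    Real.norm_of_nonneg hp, Real.norm_of_nonneg (by norm_num : (0 : ℝ) ≤ 2)]
  have h1 : p ^ ((n + 1) ^ 2) ≤ r ^ n :=
    (pow_le_pow_of_le_one hp (hpr.trans hr.le) (by nlinarith)).trans
      (pow_le_pow_left₀ hp hpr n)
  have h2 : ‖Real.cos (2 * (n + 1) * x)‖ ≤ 1 := Real.abs_cos_le_one _
  have h3 : 0 ≤ p ^ ((n + 1) ^ 2) := by positivity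
  nlinarith [norm_nonneg (Real.cos (2 * (n + 1) * x))]

lemma summable_two_mul_geometric {r : ℝ} (h0 : 0 ≤ r) (h1 : r < 1) :
    Summable fun n : ℕ => 2 * r ^ n :=
  (summable_geometric_of_lt_one h0 h1).mul_left 2

lemma hasSum_th1 {p : ℝ} (hp : p ∈ Ico (0 : ℝ) 1) (x : ℝ) :
    HasSum (fun n : ℕ => 2 * ((-1) ^ n * p ^ (n * (n + 1)) * Real.sin ((2 * n + 1) * x)))
      (th1 p x) :=
  (Summable.of_norm_bounded (summable_two_mul_geometric hp.1 hp.2)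
    (norm_th1_term_le hp.1 le_rfl hp.2 x)).hasSum

lemma hasSum_th3 {p : ℝ} (hp : p ∈ Ico (0 : ℝ) 1) (x : ℝ) :
    HasSum (fun n : ℕ => 2 * (p ^ ((n + 1) ^ 2) * Real.cos (2 * (n + 1) * x)))
      (th3 p x - 1) := by
  rw [th3, add_sub_cancel_left]
  exact (Summable.of_norm_bounded (summable_two_mul_geometric hp.1 hp.2)
    (norm_th3_term_le hp.1 le_rfl hp.2 x)).hasSum

/-- The geometric majorants are uniform only for p ≤ r < 1; continuity is local, so such strips
suffice. -/
lemma continuousOn_Ico_prod {f : ℝ × ℝ → ℝ}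
    (h : ∀ r : ℝ, 0 < r → r < 1 → ContinuousOn f (Icc 0 r ×ˢ univ)) :
    ContinuousOn f (Ico 0 1 ×ˢ univ) := by
  rintro ⟨p, x⟩ ⟨⟨hp0, hp1⟩, -⟩
  dsimp only at hp0 hp1
  have hr := h ((p + 1) / 2) (by linarith) (by linarith) (p, x)
    ⟨⟨hp0, by dsimp only; linarith⟩, mem_univ _⟩
  refine hr.mono_of_mem_nhdsWithin ?_
  have : Iio ((p + 1) / 2) ×ˢ (univ : Set ℝ) ∈ 𝓝 (p, x) :=
    (isOpen_Iio.prod isOpen_univ).mem_nhds ⟨by simp only [mem_Iio]; linarith, mem_univ _⟩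
  filter_upwards [mem_nhdsWithin_of_mem_nhds this, self_mem_nhdsWithin] with y hy hy'
  exact ⟨⟨hy'.1.1, (mem_Iio.1 hy.1).le⟩, mem_univ _⟩

lemma continuousOn_th1 : ContinuousOn (fun y : ℝ × ℝ => th1 y.1 y.2) (Ico 0 1 ×ˢ univ) := by
  refine continuousOn_Ico_prod (fun r hr0 hr1 => ?_)
  refine continuousOn_tsum (fun n => ?_) (summable_two_mul_geometric hr0.le hr1)
    (fun n y hy => norm_th1_term_le hy.1.1 hy.1.2 hr1 y.2 n)
  exact Continuous.continuousOn (by fun_prop)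

lemma continuousOn_th3 : ContinuousOn (fun y : ℝ × ℝ => th3 y.1 y.2) (Ico 0 1 ×ˢ univ) := by
  refine continuousOn_Ico_prod (fun r hr0 hr1 => ?_)
  refine continuousOn_const.add (continuousOn_tsum (fun n => ?_)
    (summable_two_mul_geometric hr0.le hr1)
    (fun n y hy => norm_th3_term_le hy.1.1 hy.1.2 hr1 y.2 n))
  exact Continuous.continuousOn (by fun_prop)

lemma continuous_th1 {p : ℝ} (hp : p ∈ Ico (0 : ℝ) 1) : Continuous (th1 p) := by
  have h := continuousOn_th1.comp (f := fun x : ℝ => (p, x)) (s := univ) (by fun_prop)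
    (fun x _ => ⟨hp, mem_univ _⟩)
  exact continuousOn_univ.1 h

lemma continuous_th3 {p : ℝ} (hp : p ∈ Ico (0 : ℝ) 1) : Continuous (th3 p) := by
  have h := continuousOn_th3.comp (f := fun x : ℝ => (p, x)) (s := univ) (by fun_prop)
    (fun x _ => ⟨hp, mem_univ _⟩)
  exact continuousOn_univ.1 h

lemma th1_neg (p x : ℝ) : th1 p (-x) = -th1 p x := by
  rw [th1, th1, ← tsum_neg]
  refine tsum_congr (fun n => ?_)
  rw [mul_neg, Real.sin_neg]
  ring

lemma th1_add_pi (p x : ℝ) : th1 p (x + Real.pi) = -th1 p x := by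
  rw [th1, th1, ← tsum_neg]
  refine tsum_congr (fun n => ?_)
  have : (2 * (n : ℝ) + 1) * (x + Real.pi)
      = ((2 * n + 1) * x + Real.pi) + (n : ℕ) * (2 * Real.pi) := by ring
  rw [this, Real.sin_add_nat_mul_two_pi, Real.sin_add_pi]
  ring

lemma th1_zero (p : ℝ) : th1 p 0 = 0 := by simp [th1]

lemma th1_pi_sub (p x : ℝ) : th1 p (Real.pi - x) = th1 p x := by
  rw [show Real.pi - x = -x + Real.pi by ring, th1_add_pi, th1_neg, neg_neg]

lemma th1_sub_pi (p x : ℝ) : th1 p (x - Real.pi) = -th1 p x := by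
  rw [← neg_eq_iff_eq_neg, ← th1_add_pi, sub_add_cancel]

lemma th3_neg (p x : ℝ) : th3 p (-x) = th3 p x := by
  rw [th3, th3]
  congr 1
  refine tsum_congr (fun n => ?_)
  rw [mul_neg, Real.cos_neg]

lemma th3_add_pi (p x : ℝ) : th3 p (x + Real.pi) = th3 p x := by
  rw [th3, th3]
  congr 1
  refine tsum_congr (fun n => ?_)
  have : 2 * ((n : ℝ) + 1) * (x + Real.pi)
      = 2 * (n + 1) * x + (n + 1 : ℕ) * (2 * Real.pi) := by push_cast; ring
  rw [this, Real.cos_add_nat_mul_two_pi]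

lemma th2_neg (p x : ℝ) : th2 p (-x) = th2 p x := by
  rw [th2, th2, ← th1_pi_sub]
  congr 1
  ring

lemma th2_add_pi (p x : ℝ) : th2 p (x + Real.pi) = -th2 p x := by
  rw [th2, th2, ← th1_add_pi]
  congr 1
  ring

lemma th4_neg (p x : ℝ) : th4 p (-x) = th4 p x := by
  rw [th4, th4, ← th3_neg, ← th3_add_pi]
  congr 1
  ring

lemma th2_add_pi_div_two (p x : ℝ) : th2 p (x + Real.pi / 2) = -th1 p x := by
  rw [th2, ← th1_add_pi]
  congr 1
  ring

lemma th4_add_pi_div_two (p x : ℝ) : th4 p (x + Real.pi / 2) = th3 p x := by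
  rw [th4, ← th3_add_pi p x]
  congr 1
  ring

lemma th4_add_pi (p x : ℝ) : th4 p (x + Real.pi) = th4 p x := by
  rw [th4, th4, ← th3_add_pi p (x + _)]
  congr 1
  ring

lemma th1_nome_zero (x : ℝ) : th1 0 x = 2 * Real.sin x := by
  rw [th1, tsum_eq_single 0]
  · simp
  · intro n hn
    have : n * (n + 1) ≠ 0 := by positivity
    simp [this]

lemma th2_nome_zero (x : ℝ) : th2 0 x = 2 * Real.cos x := by
  rw [th2, th1_nome_zero, Real.sin_add_pi_div_two]

lemma th3_nome_zero (x : ℝ) : th3 0 x = 1 := by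
  rw [th3]
  simp

lemma th4_nome_zero (x : ℝ) : th4 0 x = 1 := th3_nome_zero _

/-- The nome `e^{iπτ}` of a purely imaginary `τ`. -/
lemma exp_mul_sq_eq (σ : ℝ) (n : ℕ) :
    Complex.exp (Complex.I * Real.pi * (Complex.I * σ) * ((n : ℂ) + 1 / 2) ^ 2) =
      ((Real.exp (-(Real.pi * σ / 4)) * Real.exp (-(Real.pi * σ)) ^ (n * (n + 1)) : ℝ) : ℂ) := by
  rw [← Real.exp_nat_mul, ← Real.exp_add, Complex.ofReal_exp]
  congr 1
  push_cast
  linear_combination (Real.pi * σ * ((n : ℂ) + 1 / 2) ^ 2) * Complex.I_sq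

lemma exp_neg_pi_mul_mem {σ : ℝ} (hσ : 0 < σ) : Real.exp (-(Real.pi * σ)) ∈ Ico (0 : ℝ) 1 :=
  ⟨(Real.exp_pos _).le, by
    rw [← Real.exp_zero]
    exact Real.exp_lt_exp.2 (by have := Real.pi_pos; nlinarith [mul_pos this hσ])⟩

lemma jacobiTh_ofReal (σ : ℝ) (x : ℝ) :
    jacobiTh x (Complex.I * σ) = Complex.I *
      ((Real.exp (-(Real.pi * σ / 4)) * th1 (Real.exp (-(Real.pi * σ))) x : ℝ) : ℂ) := by
  rw [jacobiTh, th1, ← tsum_mul_left, Complex.ofReal_tsum, ← tsum_mul_left]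
  refine tsum_congr (fun n => ?_)
  rw [exp_mul_sq_eq]
  have h : Complex.exp ((2 * (n : ℂ) + 1) * Complex.I * x)
      - Complex.exp (-((2 * (n : ℂ) + 1) * Complex.I * x))
      = 2 * Complex.I * ((Real.sin ((2 * n + 1) * x) : ℝ) : ℂ) := by
    rw [Complex.ofReal_sin, Complex.sin]
    push_cast
    have e1 : (2 * (n : ℂ) + 1) * Complex.I * x = (2 * n + 1) * x * Complex.I := by ring
    have e2 : -((2 * (n : ℂ) + 1) * x * Complex.I) = -((2 * n + 1) * x) * Complex.I := by ring
    rw [e1, e2]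
    linear_combination (Complex.exp ((2 * (n : ℂ) + 1) * x * Complex.I) -
      Complex.exp (-((2 * (n : ℂ) + 1) * x) * Complex.I)) * Complex.I_sq
  rw [h]
  push_cast
  ring

lemma jacobiTheta₂_ofReal {σ : ℝ} (hσ : 0 < σ) (x : ℝ) :
    jacobiTheta₂ (x / Real.pi) (Complex.I * σ) =
      ((th3 (Real.exp (-(Real.pi * σ))) x : ℝ) : ℂ) := by
  have hτ : 0 < (Complex.I * (σ : ℂ)).im := by simpa using hσ
  have hpi : (Real.pi : ℂ) ≠ 0 := by exact_mod_cast Real.pi_ne_zero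
  have h := (hasSum_jacobiTheta₂_term ((x : ℂ) / Real.pi) hτ).nat_add_neg
  rw [← hasSum_nat_add_iff' 1] at h
  have h' := ((Complex.hasSum_ofReal).2 (hasSum_th3 (exp_neg_pi_mul_mem hσ) x)).unique
    (h.congr_fun (fun n => ?_))
  · simp [jacobiTheta₂_term] at h'
    linear_combination -h'
  · simp only [jacobiTheta₂_term]
    rw [← Real.exp_nat_mul]
    push_cast
    rw [Complex.cos]
    have hx : (Real.pi : ℂ) * (x / Real.pi) = x := mul_div_cancel₀ _ hpi
    have e1 : 2 * (Real.pi : ℂ) * Complex.I * (n + 1) * (x / Real.pi)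
        + Real.pi * Complex.I * (n + 1) ^ 2 * (Complex.I * σ)
        = (n + 1) ^ 2 * -(Real.pi * σ) + 2 * (n + 1) * x * Complex.I := by
      linear_combination (σ * ((n : ℂ) + 1) ^ 2 * Real.pi) * Complex.I_sq
        + 2 * Complex.I * (n + 1) * hx
    have e2 : 2 * (Real.pi : ℂ) * Complex.I * (-1 + -n) * (x / Real.pi)
        + Real.pi * Complex.I * (-1 + -n) ^ 2 * (Complex.I * σ)
        = (n + 1) ^ 2 * -(Real.pi * σ) + -(2 * (n + 1) * x) * Complex.I := by
      linear_combination (σ * ((n : ℂ) + 1) ^ 2 * Real.pi) * Complex.I_sq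
        - 2 * Complex.I * (n + 1) * hx
    simp only [neg_add_rev]
    rw [e1, e2, Complex.exp_add, Complex.exp_add]
    ring

lemma halfTheta_ofReal {σ : ℝ} (hσ : 0 < σ) (x : ℝ) :
    halfTheta (x / Real.pi) (Complex.I * σ) =
      ((Real.exp (-(Real.pi * σ / 4)) * th2 (Real.exp (-(Real.pi * σ))) x : ℝ) : ℂ) := by
  have hτ : 0 < (Complex.I * (σ : ℂ)).im := by simpa using hσ
  have hpi : (Real.pi : ℂ) ≠ 0 := by exact_mod_cast Real.pi_ne_zero
  have h := jacobiTh_eq_halfTheta ((x - Real.pi / 2 : ℝ) : ℂ) hτ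
  have e : ((x - Real.pi / 2 : ℝ) : ℂ) / Real.pi + 1 / 2 = x / Real.pi := by
    push_cast
    field_simp
    ring
  have e2 : x - Real.pi / 2 = x + Real.pi / 2 - Real.pi := by ring
  rw [jacobiTh_ofReal, e, e2, th1_sub_pi, ← th2] at h
  push_cast at h ⊢
  linear_combination -Complex.I * h + (halfTheta (x / Real.pi) (Complex.I * σ)
    - Complex.exp (-(Real.pi * σ / 4)) * th2 (Real.exp (-(Real.pi * σ))) x) * Complex.I_sq

lemma exists_eq_exp_neg_pi_mul {p : ℝ} (hp : p ∈ Ioo (0 : ℝ) 1) :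
    ∃ σ : ℝ, 0 < σ ∧ Real.exp (-(Real.pi * σ)) = p := by
  refine ⟨-Real.log p / Real.pi, div_pos (neg_pos.2 (Real.log_neg hp.1 hp.2)) Real.pi_pos, ?_⟩
  rw [mul_div_cancel₀ _ Real.pi_ne_zero, neg_neg, Real.exp_log hp.1]

lemma sq_mem_Ico {p : ℝ} (hp : p ∈ Ico (0 : ℝ) 1) : p ^ 2 ∈ Ico (0 : ℝ) 1 :=
  ⟨sq_nonneg p, pow_lt_one₀ hp.1 hp.2 two_ne_zero⟩

/-! ### Addition and Landen formulas for a real nome -/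

theorem th2_add_mul_sub {p : ℝ} (hp : p ∈ Ico (0 : ℝ) 1) (x y : ℝ) :
    th2 p (x + y) * th2 p (x - y) =
      th2 (p ^ 2) (2 * x) * th3 (p ^ 2) (2 * y) + th3 (p ^ 2) (2 * x) * th2 (p ^ 2) (2 * y) := by
  rcases hp.1.eq_or_lt with rfl | hp0
  · rw [zero_pow two_ne_zero]
    simp only [th2_nome_zero, th3_nome_zero]
    rw [Real.cos_add, Real.cos_sub, Real.cos_two_mul, Real.cos_two_mul]
    linear_combination -4 * Real.sin y ^ 2 * Real.sin_sq_add_cos_sq x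
      - 4 * (1 - Real.cos x ^ 2) * Real.sin_sq_add_cos_sq y
  obtain ⟨σ, hσ, rfl⟩ := exists_eq_exp_neg_pi_mul ⟨hp0, hp.2⟩
  have hτ : 0 < (Complex.I * (σ : ℂ)).im := by simpa using hσ
  have h := halfTheta_add_mul_sub ((x : ℂ) / Real.pi) (y / Real.pi) hτ
  have e1 : (x : ℂ) / Real.pi + y / Real.pi = ((x + y : ℝ) : ℂ) / Real.pi := by push_cast; ring
  have e2 : (x : ℂ) / Real.pi - y / Real.pi = ((x - y : ℝ) : ℂ) / Real.pi := by push_cast; ring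
  have e3 : 2 * ((x : ℂ) / Real.pi) = ((2 * x : ℝ) : ℂ) / Real.pi := by push_cast; ring
  have e4 : 2 * ((y : ℂ) / Real.pi) = ((2 * y : ℝ) : ℂ) / Real.pi := by push_cast; ring
  have e5 : 2 * (Complex.I * (σ : ℂ)) = Complex.I * ((2 * σ : ℝ) : ℂ) := by push_cast; ring
  have h2σ : 0 < 2 * σ := by linarith
  rw [e1, e2, e3, e4, e5, halfTheta_ofReal hσ, halfTheta_ofReal hσ, halfTheta_ofReal h2σ,
    halfTheta_ofReal h2σ, jacobiTheta₂_ofReal h2σ, jacobiTheta₂_ofReal h2σ] at h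
  simp only [← Complex.ofReal_mul, ← Complex.ofReal_add] at h
  have h' := Complex.ofReal_injective h
  have e6 : Real.exp (-(Real.pi * σ)) ^ 2 = Real.exp (-(Real.pi * (2 * σ))) := by
    rw [← Real.exp_nat_mul]
    congr 1
    push_cast
    ring
  have e7 : Real.exp (-(Real.pi * (2 * σ) / 4))
      = Real.exp (-(Real.pi * σ / 4)) * Real.exp (-(Real.pi * σ / 4)) := by
    rw [← Real.exp_add]
    congr 1
    ring
  rw [e7] at h'
  rw [e6]
  have hne := (Real.exp_pos (-(Real.pi * σ / 4))).ne'
  refine mul_left_cancel₀ (mul_ne_zero hne hne) ?_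
  linear_combination h'

/-- The extra factor p appears because `th2` omits the usual fourth root of its nome, which keeps it
nonzero at nome 0. -/
theorem th3_add_mul_sub {p : ℝ} (hp : p ∈ Ico (0 : ℝ) 1) (x y : ℝ) :
    th3 p (x + y) * th3 p (x - y) =
      th3 (p ^ 2) (2 * x) * th3 (p ^ 2) (2 * y)
        + p * (th2 (p ^ 2) (2 * x) * th2 (p ^ 2) (2 * y)) := by
  rcases hp.1.eq_or_lt with rfl | hp0
  · rw [zero_pow two_ne_zero]
    simp only [th2_nome_zero, th3_nome_zero]
    ring
  obtain ⟨σ, hσ, rfl⟩ := exists_eq_exp_neg_pi_mul ⟨hp0, hp.2⟩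
  have hτ : 0 < (Complex.I * (σ : ℂ)).im := by simpa using hσ
  have h := jacobiTheta₂_add_mul_sub ((x : ℂ) / Real.pi) (y / Real.pi) hτ
  have e1 : (x : ℂ) / Real.pi + y / Real.pi = ((x + y : ℝ) : ℂ) / Real.pi := by push_cast; ring
  have e2 : (x : ℂ) / Real.pi - y / Real.pi = ((x - y : ℝ) : ℂ) / Real.pi := by push_cast; ring
  have e3 : 2 * ((x : ℂ) / Real.pi) = ((2 * x : ℝ) : ℂ) / Real.pi := by push_cast; ring
  have e4 : 2 * ((y : ℂ) / Real.pi) = ((2 * y : ℝ) : ℂ) / Real.pi := by push_cast; ring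
  have e5 : 2 * (Complex.I * (σ : ℂ)) = Complex.I * ((2 * σ : ℝ) : ℂ) := by push_cast; ring
  have h2σ : 0 < 2 * σ := by linarith
  rw [e1, e2, e3, e4, e5, jacobiTheta₂_ofReal hσ, jacobiTheta₂_ofReal hσ, halfTheta_ofReal h2σ,
    halfTheta_ofReal h2σ, jacobiTheta₂_ofReal h2σ, jacobiTheta₂_ofReal h2σ] at h
  simp only [← Complex.ofReal_mul, ← Complex.ofReal_add] at h
  have h' := Complex.ofReal_injective h
  have e6 : Real.exp (-(Real.pi * σ)) ^ 2 = Real.exp (-(Real.pi * (2 * σ))) := by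
    rw [← Real.exp_nat_mul]
    congr 1
    push_cast
    ring
  have e7 : Real.exp (-(Real.pi * (2 * σ) / 4)) * Real.exp (-(Real.pi * (2 * σ) / 4))
      = Real.exp (-(Real.pi * σ)) := by
    rw [← Real.exp_add]
    congr 1
    ring
  rw [e6, h', ← e7]
  ring

theorem th1_add_mul_sub {p : ℝ} (hp : p ∈ Ico (0 : ℝ) 1) (x y : ℝ) :
    th1 p (x + y) * th1 p (x - y) =
      th3 (p ^ 2) (2 * x) * th2 (p ^ 2) (2 * y) - th2 (p ^ 2) (2 * x) * th3 (p ^ 2) (2 * y) := by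
  have h := th2_add_mul_sub hp (x + Real.pi / 2) y
  have e1 : x + Real.pi / 2 + y = x + y + Real.pi / 2 := by ring
  have e2 : x + Real.pi / 2 - y = x - y + Real.pi / 2 := by ring
  have e3 : 2 * (x + Real.pi / 2) = 2 * x + Real.pi := by ring
  rw [e1, e2, e3, th2_add_pi_div_two, th2_add_pi_div_two, th2_add_pi, th3_add_pi] at h
  linear_combination h

theorem th4_add_mul_sub {p : ℝ} (hp : p ∈ Ico (0 : ℝ) 1) (x y : ℝ) :
    th4 p (x + y) * th4 p (x - y) =
      th3 (p ^ 2) (2 * x) * th3 (p ^ 2) (2 * y)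
        - p * (th2 (p ^ 2) (2 * x) * th2 (p ^ 2) (2 * y)) := by
  have h := th3_add_mul_sub hp (x + Real.pi / 2) y
  have e1 : x + Real.pi / 2 + y = x + y + Real.pi / 2 := by ring
  have e2 : x + Real.pi / 2 - y = x - y + Real.pi / 2 := by ring
  have e3 : 2 * (x + Real.pi / 2) = 2 * x + Real.pi := by ring
  rw [e1, e2, e3, ← th4, ← th4, th2_add_pi, th3_add_pi] at h
  linear_combination h

/-- The addition formula is centred at x + π/4, so that the two arguments are x and x + π/2; one of
its terms contains `th2` at π/2, which is zero. The passage from p to p² lets sign information move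
from small nomes to large ones. -/
theorem th1_mul_th2 {p : ℝ} (hp : p ∈ Ico (0 : ℝ) 1) (x : ℝ) :
    th1 p x * th2 p x = th1 (p ^ 2) (2 * x) * th4 (p ^ 2) 0 := by
  have h := th1_add_mul_sub hp (x + Real.pi / 4) (-(Real.pi / 4))
  have e1 : x + Real.pi / 4 + -(Real.pi / 4) = x := by ring
  have e2 : x + Real.pi / 4 - -(Real.pi / 4) = x + Real.pi / 2 := by ring
  have e3 : 2 * (x + Real.pi / 4) = 2 * x + Real.pi / 2 := by ring
  have e4 : 2 * -(Real.pi / 4) = -(Real.pi / 2) := by ring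
  have e5 : th2 (p ^ 2) (Real.pi / 2) = 0 := by
    rw [← zero_add (Real.pi / 2), th2_add_pi_div_two, th1_zero, neg_zero]
  rw [e1, e2, e3, e4, th2_neg, th3_neg, e5, th2_add_pi_div_two, ← th2] at h
  rw [h, th4, zero_add]
  ring

theorem th3_mul_th4 {p : ℝ} (hp : p ∈ Ico (0 : ℝ) 1) (x : ℝ) :
    th3 p x * th4 p x = th4 (p ^ 2) (2 * x) * th4 (p ^ 2) 0 := by
  have h := th3_add_mul_sub hp (x + Real.pi / 4) (-(Real.pi / 4))
  have e1 : x + Real.pi / 4 + -(Real.pi / 4) = x := by ring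
  have e2 : x + Real.pi / 4 - -(Real.pi / 4) = x + Real.pi / 2 := by ring
  have e3 : 2 * (x + Real.pi / 4) = 2 * x + Real.pi / 2 := by ring
  have e4 : 2 * -(Real.pi / 4) = -(Real.pi / 2) := by ring
  have e5 : th2 (p ^ 2) (Real.pi / 2) = 0 := by
    rw [← zero_add (Real.pi / 2), th2_add_pi_div_two, th1_zero, neg_zero]
  rw [e1, e2, e3, e4, th2_neg, th3_neg, e5, ← th4, ← th4] at h
  rw [h, show th4 (p ^ 2) 0 = th3 (p ^ 2) (0 + Real.pi / 2) from rfl, zero_add]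
  ring

/-! ### Positivity and monotonicity of the real thetas -/

lemma abs_sin_odd_mul_le (n : ℕ) (x : ℝ) :
    |Real.sin ((2 * n + 1) * x)| ≤ (2 * n + 1) * |Real.sin x| := by
  have key : ∀ m : ℕ, |Real.sin (m * x)| ≤ m * |Real.sin x| := by
    intro m
    induction m with
    | zero => simp
    | succ m ih =>
      have e : ((m + 1 : ℕ) : ℝ) * x = m * x + x := by push_cast; ring
      rw [e, Real.sin_add]
      calc |Real.sin (m * x) * Real.cos x + Real.cos (m * x) * Real.sin x|
          ≤ |Real.sin (m * x)| * |Real.cos x| + |Real.cos (m * x)| * |Real.sin x| := by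
            rw [← abs_mul, ← abs_mul]
            exact abs_add_le _ _
        _ ≤ |Real.sin (m * x)| * 1 + 1 * |Real.sin x| := by
            gcongr
            · exact Real.abs_cos_le_one _
            · exact Real.abs_cos_le_one _
        _ ≤ ((m + 1 : ℕ) : ℝ) * |Real.sin x| := by
            push_cast
            linarith
  have := key (2 * n + 1)
  push_cast at this
  exact this

/-- A property of nomes that holds for small nomes and passes from `p²` to `p` holds for all. -/
theorem nome_induction {P : ℝ → Prop} (hsmall : ∀ p, 0 ≤ p → p ≤ 1 / 4 → P p)
    (hstep : ∀ p ∈ Ico (0 : ℝ) 1, P (p ^ 2) → P p) {p : ℝ} (hp : p ∈ Ico (0 : ℝ) 1) : P p := by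
  have key : ∀ n : ℕ, ∀ p ∈ Ico (0 : ℝ) 1, p ^ (2 ^ n) ≤ 1 / 4 → P p := by
    intro n
    induction n with
    | zero => intro p hp h; exact hsmall p hp.1 (by simpa using h)
    | succ n ih =>
      intro p hp h
      refine hstep p hp (ih _ (sq_mem_Ico hp) ?_)
      rw [← pow_mul, mul_comm, ← pow_succ]
      exact h
  obtain ⟨n, hn⟩ := exists_pow_lt_of_lt_one (by norm_num : (0 : ℝ) < 1 / 4) hp.2
  refine key n p hp ((pow_le_pow_of_le_one hp.1 hp.2.le ?_).trans hn.le)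
  exact Nat.lt_two_pow_self.le

lemma th3_pos_of_le {p : ℝ} (h0 : 0 ≤ p) (h1 : p ≤ 1 / 4) (x : ℝ) : 0 < th3 p x := by
  have hp : p ∈ Ico (0 : ℝ) 1 := ⟨h0, by linarith⟩
  have hb : ∀ n : ℕ, -(1 / 2 * (1 / 4) ^ n) ≤
      2 * (p ^ ((n + 1) ^ 2) * Real.cos (2 * (n + 1) * x)) := by
    intro n
    have e1 : p ^ ((n + 1) ^ 2) ≤ (1 / 4) ^ (n + 1) :=
      (pow_le_pow_of_le_one h0 (by linarith) (by nlinarith)).trans (pow_le_pow_left₀ h0 h1 _)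
    have e2 := Real.neg_one_le_cos (2 * (n + 1) * x)
    have e3 : 0 ≤ p ^ ((n + 1) ^ 2) := by positivity
    have e4 : p ^ ((n + 1) ^ 2) ≤ (1 / 4) ^ n * (1 / 4) := e1.trans_eq (pow_succ _ _)
    nlinarith
  have hg := ((hasSum_geometric_of_lt_one (by norm_num : (0 : ℝ) ≤ 1 / 4)
    (by norm_num)).mul_left (1 / 2)).neg
  have := hasSum_le hb hg (hasSum_th3 hp x)
  norm_num at this
  linarith

/-- Positivity at p² makes the product of `th3` and `th4` at p positive, so `th3 p` has no zero; it
is positive at 0 and continuous. -/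
theorem th3_pos {p : ℝ} (hp : p ∈ Ico (0 : ℝ) 1) (x : ℝ) : 0 < th3 p x := by
  refine nome_induction (P := fun p => ∀ x, 0 < th3 p x) (fun p h0 h1 => th3_pos_of_le h0 h1)
    (fun p hp ih => ?_) hp x
  have hne : ∀ x, th3 p x ≠ 0 := by
    intro x h
    have := th3_mul_th4 hp x
    rw [h, zero_mul] at this
    exact (mul_pos (ih (2 * x + Real.pi / 2)) (ih (0 + Real.pi / 2))).ne this
  have h0 : 0 < th3 p 0 := by
    have h := HasSum.nonneg (fun n : ℕ => ?_) (hasSum_th3 hp 0)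
    · linarith
    · have := hp.1
      rw [mul_zero, Real.cos_zero]
      positivity
  intro x
  by_contra! hx
  obtain ⟨y, -, hy⟩ := isPreconnected_univ.intermediate_value (mem_univ x) (mem_univ 0)
    (continuous_th3 hp).continuousOn ⟨hx, h0.le⟩
  exact hne y hy

theorem th4_pos {p : ℝ} (hp : p ∈ Ico (0 : ℝ) 1) (x : ℝ) : 0 < th4 p x := th3_pos hp _

lemma th1_pos_of_le {p : ℝ} (h0 : 0 ≤ p) (h1 : p ≤ 1 / 4) {x : ℝ} (hx : x ∈ Ioo 0 Real.pi) :
    0 < th1 p x := by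
  have hp : p ∈ Ico (0 : ℝ) 1 := ⟨h0, by linarith⟩
  have hs := Real.sin_pos_of_mem_Ioo hx
  have hd := (hasSum_nat_add_iff' 1).2 (hasSum_th1 hp x)
  -- The tail is compared with the leading term 2 sin x: sin((2n+3)x) costs a factor at most
  -- 4^(n+1), against powers of p at most 16^-(n+1). The tail is at most a third of the leading
  -- term.
  have hb : ∀ n : ℕ, -(2 * Real.sin x * ((1 / 4) * (1 / 4) ^ n)) ≤
      2 * ((-1) ^ (n + 1) * p ^ ((n + 1) * (n + 1 + 1)) *
        Real.sin ((2 * (n + 1 : ℕ) + 1) * x)) := by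
    intro n
    have e0 : p ^ ((n + 1) * (n + 1 + 1)) ≤ (1 / 16) ^ (n + 1) := by
      calc p ^ ((n + 1) * (n + 1 + 1)) ≤ p ^ (2 * (n + 1)) :=
            pow_le_pow_of_le_one h0 (by linarith) (by nlinarith)
        _ = (p ^ 2) ^ (n + 1) := by rw [pow_mul]
        _ ≤ (1 / 16) ^ (n + 1) := pow_le_pow_left₀ (sq_nonneg p) (by nlinarith) _
    have e1 := abs_sin_odd_mul_le (n + 1) x
    rw [abs_of_pos hs] at e1
    have e2 : ((2 * (n + 1 : ℕ) + 1 : ℝ)) ≤ 4 ^ (n + 1) := by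
      have : ∀ n : ℕ, 2 * (n + 1) + 1 ≤ 4 ^ (n + 1) := by
        intro n
        induction n with
        | zero => norm_num
        | succ n ih => rw [pow_succ]; omega
      exact_mod_cast this n
    have e3 : |(-1) ^ (n + 1) * p ^ ((n + 1) * (n + 1 + 1)) *
        Real.sin ((2 * (n + 1 : ℕ) + 1) * x)| ≤ Real.sin x * ((1 / 4) * (1 / 4) ^ n) := by
      rw [abs_mul, abs_mul, abs_pow, abs_neg, abs_one, one_pow, one_mul, abs_of_nonneg
        (by positivity : 0 ≤ p ^ ((n + 1) * (n + 1 + 1)))]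
      calc p ^ ((n + 1) * (n + 1 + 1)) * |Real.sin ((2 * (n + 1 : ℕ) + 1) * x)|
          ≤ (1 / 16) ^ (n + 1) * (4 ^ (n + 1) * Real.sin x) := by
            gcongr
            exact e1.trans (by gcongr)
        _ = Real.sin x * ((1 / 4) * (1 / 4) ^ n) := by
            rw [← mul_assoc, ← mul_pow, pow_succ]
            norm_num
            ring
    have e4 := neg_abs_le ((-1) ^ (n + 1) * p ^ ((n + 1) * (n + 1 + 1)) *
        Real.sin ((2 * (n + 1 : ℕ) + 1) * x))
    linarith
  have hg := (((hasSum_geometric_of_lt_one (by norm_num : (0 : ℝ) ≤ 1 / 4)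
    (by norm_num)).mul_left (1 / 4)).mul_left (2 * Real.sin x)).neg
  have := hasSum_le hb hg hd
  norm_num at this
  linarith

theorem th1_pi_div_two_pos {p : ℝ} (hp : p ∈ Ico (0 : ℝ) 1) : 0 < th1 p (Real.pi / 2) := by
  have hterm : ∀ n : ℕ, 2 * ((-1) ^ n * p ^ (n * (n + 1)) *
      Real.sin ((2 * n + 1) * (Real.pi / 2))) = 2 * p ^ (n * (n + 1)) := by
    intro n
    have e : (2 * (n : ℝ) + 1) * (Real.pi / 2) = n * Real.pi + Real.pi / 2 := by ring
    rw [e, Real.sin_add_pi_div_two, Real.cos_nat_mul_pi]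
    have : ((-1 : ℝ) ^ n) * (-1) ^ n = 1 := by rw [← mul_pow]; norm_num
    linear_combination 2 * p ^ (n * (n + 1)) * this
  have h := hasSum_th1 hp (Real.pi / 2)
  simp only [hterm] at h
  have := le_hasSum h 0 (fun n _ => by have := hp.1; positivity)
  norm_num at this
  linarith

theorem th1_pos {p : ℝ} (hp : p ∈ Ico (0 : ℝ) 1) {x : ℝ} (hx : x ∈ Ioo 0 Real.pi) :
    0 < th1 p x := by
  refine nome_induction (P := fun p => ∀ x ∈ Ioo 0 Real.pi, 0 < th1 p x)
    (fun p h0 h1 x hx => th1_pos_of_le h0 h1 hx) (fun p hp ih => ?_) hp x hx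
  have hlow : ∀ x ∈ Ioc 0 (Real.pi / 2), 0 < th1 p x := by
    intro x hx
    by_contra! hneg
    obtain ⟨y, hy, hy0⟩ := intermediate_value_Icc hx.2 (continuous_th1 hp).continuousOn
      ⟨hneg, (th1_pi_div_two_pos hp).le⟩
    rcases hy.2.eq_or_lt with rfl | hlt
    · exact (th1_pi_div_two_pos hp).ne' hy0
    · have h := th1_mul_th2 hp y
      rw [hy0, zero_mul] at h
      refine (mul_pos (ih (2 * y) ⟨by linarith [hx.1, hy.1], by linarith⟩)
        (th4_pos (sq_mem_Ico hp) 0)).ne h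
  intro x hx
  rcases le_total x (Real.pi / 2) with h | h
  · exact hlow x ⟨hx.1, h⟩
  · rw [← th1_pi_sub]
    exact hlow _ ⟨by linarith [hx.2], by linarith⟩

theorem th2_pos {p : ℝ} (hp : p ∈ Ico (0 : ℝ) 1) {x : ℝ}
    (hx : x ∈ Ioo (-(Real.pi / 2)) (Real.pi / 2)) : 0 < th2 p x :=
  th1_pos hp ⟨by linarith [hx.1], by linarith [hx.2]⟩

lemma th3_abs_le {p : ℝ} (hp : p ∈ Ico (0 : ℝ) 1) (x : ℝ) : th3 p x ≤ th3 p 0 := by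
  have := hasSum_le (fun n : ℕ => ?_) (hasSum_th3 hp x) (hasSum_th3 hp 0)
  · linarith
  · rw [mul_zero, Real.cos_zero]
    have h0 : 0 ≤ p ^ ((n + 1) ^ 2) := pow_nonneg hp.1 _
    have := mul_le_mul_of_nonneg_left (Real.cos_le_one (2 * (n + 1) * x)) h0
    linarith

lemma th1_sq {p : ℝ} (hp : p ∈ Ico (0 : ℝ) 1) (x : ℝ) : th1 p x ^ 2 =
    th3 (p ^ 2) (2 * x) * th2 (p ^ 2) 0 - th2 (p ^ 2) (2 * x) * th3 (p ^ 2) 0 := by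
  have := th1_add_mul_sub hp x 0
  rw [add_zero, sub_zero, mul_zero] at this
  rw [sq, this]

lemma th2_sq {p : ℝ} (hp : p ∈ Ico (0 : ℝ) 1) (x : ℝ) : th2 p x ^ 2 =
    th3 (p ^ 2) (2 * x) * th2 (p ^ 2) 0 + th2 (p ^ 2) (2 * x) * th3 (p ^ 2) 0 := by
  have := th2_add_mul_sub hp x 0
  rw [add_zero, sub_zero, mul_zero] at this
  rw [sq, this]
  ring

lemma th3_sq {p : ℝ} (hp : p ∈ Ico (0 : ℝ) 1) (x : ℝ) : th3 p x ^ 2 =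
    th3 (p ^ 2) (2 * x) * th3 (p ^ 2) 0 + p * (th2 (p ^ 2) (2 * x) * th2 (p ^ 2) 0) := by
  have := th3_add_mul_sub hp x 0
  rw [add_zero, sub_zero, mul_zero] at this
  rw [sq, this]

lemma th4_sq {p : ℝ} (hp : p ∈ Ico (0 : ℝ) 1) (x : ℝ) : th4 p x ^ 2 =
    th3 (p ^ 2) (2 * x) * th3 (p ^ 2) 0 - p * (th2 (p ^ 2) (2 * x) * th2 (p ^ 2) 0) := by
  have := th4_add_mul_sub hp x 0
  rw [add_zero, sub_zero, mul_zero] at this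
  rw [sq, this]

/-- The addition formula for ϑ₁, written with squares of ϑ₁ and ϑ₃ alone, together with the fact
that ϑ₃ is largest at 0. -/
theorem th1_log_concave {p : ℝ} (hp : p ∈ Ico (0 : ℝ) 1) {x y : ℝ} (hy : th1 p y ≠ 0) :
    th1 p (x + y) * th1 p (x - y) < th1 p x ^ 2 := by
  have key : th1 p (x + y) * th1 p (x - y) * th3 p 0 ^ 2
      = th1 p x ^ 2 * th3 p y ^ 2 - th3 p x ^ 2 * th1 p y ^ 2 := by
    rw [th1_add_mul_sub hp, th1_sq hp, th1_sq hp, th3_sq hp, th3_sq hp, th3_sq hp, mul_zero]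
    ring
  have h3 := th3_pos hp x
  have h4 := th3_pos hp y
  have h5 := th3_abs_le hp y
  have h6 : th3 p y ^ 2 ≤ th3 p 0 ^ 2 := pow_le_pow_left₀ h4.le h5 2
  have h7 : 0 < th3 p x ^ 2 * th1 p y ^ 2 := by positivity
  have h8 : 0 < th3 p 0 ^ 2 := by have := th3_pos hp 0; positivity
  refine lt_of_mul_lt_mul_right ?_ h8.le
  nlinarith [mul_le_mul_of_nonneg_left h6 (sq_nonneg (th1 p x))]

theorem th1_lt_of_mem {p : ℝ} (hp : p ∈ Ico (0 : ℝ) 1) {x₁ x : ℝ} (h0 : 0 ≤ x₁)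
    (hx : x ∈ Ioo x₁ (Real.pi - x₁)) : th1 p x₁ < th1 p x := by
  rcases h0.eq_or_lt with rfl | h0
  · rw [th1_zero]
    exact th1_pos hp ⟨hx.1, by linarith [hx.2]⟩
  have hle : x₁ ≤ Real.pi - x₁ := (hx.1.trans hx.2).le
  obtain ⟨m, hm, hmin⟩ := isCompact_Icc.exists_isMinOn (nonempty_Icc.2 hle)
    (continuous_th1 hp).continuousOn
  -- Strict log-concavity excludes a minimum over the closed interval at an interior point, so the
  -- minimum sits at the endpoints, where the values agree.
  have hnot : ∀ w ∈ Ioo x₁ (Real.pi - x₁), ∃ w' ∈ Icc x₁ (Real.pi - x₁),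
      th1 p w' < th1 p w := by
    intro w hw
    by_contra! hw'
    obtain ⟨d, hd0, hd⟩ : ∃ d, 0 < d ∧ d ≤ w - x₁ ∧ d ≤ Real.pi - x₁ - w ∧ d < Real.pi := by
      refine ⟨min (w - x₁) (Real.pi - x₁ - w), lt_min (by linarith [hw.1]) (by linarith [hw.2]),
        min_le_left _ _, min_le_right _ _, ?_⟩
      exact (min_le_left _ _).trans_lt (by linarith [hw.2])
    have hpos : 0 < th1 p w := th1_pos hp ⟨by linarith [hw.1], by linarith [hw.2]⟩
    have h1 := hw' (w + d) ⟨by linarith, by linarith⟩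
    have h2 := hw' (w - d) ⟨by linarith, by linarith⟩
    have h3 := th1_log_concave hp (x := w) (th1_pos hp ⟨hd0, hd.2.2⟩).ne'
    nlinarith
  have hm' : th1 p m = th1 p x₁ := by
    rcases hm.1.eq_or_lt with h | h
    · rw [h]
    rcases hm.2.eq_or_lt with h' | h'
    · rw [h', th1_pi_sub]
    obtain ⟨w', hw', hlt⟩ := hnot m ⟨h, h'⟩
    exact absurd (hmin hw') (not_le.2 hlt)
  obtain ⟨w', hw', hlt⟩ := hnot x hx
  have : th1 p m ≤ th1 p w' := hmin hw'
  linarith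

theorem th1_strictMonoOn {p : ℝ} (hp : p ∈ Ico (0 : ℝ) 1) :
    StrictMonoOn (th1 p) (Icc 0 (Real.pi / 2)) := by
  intro x hx y hy hxy
  exact th1_lt_of_mem hp hx.1 ⟨hxy, by linarith [hx.2, hy.2]⟩

theorem th1_strictAntiOn {p : ℝ} (hp : p ∈ Ico (0 : ℝ) 1) :
    StrictAntiOn (th1 p) (Icc (Real.pi / 2) Real.pi) := by
  intro x hx y hy hxy
  rw [← th1_pi_sub p x, ← th1_pi_sub p y]
  exact th1_strictMonoOn hp ⟨by linarith [hy.2], by linarith [hy.1]⟩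
    ⟨by linarith [hx.2], by linarith [hx.1]⟩ (by linarith)

/-! ### Angle, prefactor and step value as functions of the dual nome -/

/-- The function of the angle `φ = γ/τ` whose zero in `(π/4, π/3)` corresponds to the weight `a`. -/
noncomputable def weightEq (a p φ : ℝ) : ℝ :=
  th1 p (4 * φ - Real.pi) ^ 2 * th1 p φ ^ 3 - a ^ 2 * (th1 p (2 * φ) ^ 2 * th1 p (3 * φ) ^ 3)

lemma continuousOn_weightEq (a : ℝ) :
    ContinuousOn (fun y : ℝ × ℝ => weightEq a y.1 y.2) (Ico 0 1 ×ˢ univ) := by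
  have h : ∀ g : ℝ → ℝ, Continuous g →
      ContinuousOn (fun y : ℝ × ℝ => th1 y.1 (g y.2)) (Ico 0 1 ×ˢ univ) := by
    intro g hg
    exact continuousOn_th1.comp (f := fun y : ℝ × ℝ => (y.1, g y.2)) (by fun_prop)
      (fun y hy => ⟨hy.1, mem_univ _⟩)
  exact (((h (fun φ => 4 * φ - Real.pi) (by fun_prop)).pow 2).mul ((h id continuous_id).pow 3)).sub
    (continuousOn_const.mul (((h (fun φ => 2 * φ) (by fun_prop)).pow 2).mul
      ((h (fun φ => 3 * φ) (by fun_prop)).pow 3)))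

/-- On this range 4φ - π and φ lie in the increasing half of (0, π), up to endpoints, and 2φ and 3φ
in the decreasing half. Every factor moves in the helpful direction. -/
lemma weightEq_lt {a p : ℝ} (ha : 0 < a) (hp : p ∈ Ico (0 : ℝ) 1) {φ ψ : ℝ}
    (h1 : Real.pi / 4 ≤ φ) (h2 : φ < ψ) (h3 : ψ ≤ Real.pi / 3) :
    weightEq a p φ < weightEq a p ψ := by
  have hpi := Real.pi_pos
  have a1 : th1 p (4 * φ - Real.pi) < th1 p (4 * ψ - Real.pi) :=
    th1_strictMonoOn hp ⟨by linarith, by linarith⟩ ⟨by linarith, by linarith⟩ (by linarith)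
  have a2 : th1 p φ < th1 p ψ :=
    th1_strictMonoOn hp ⟨by linarith, by linarith⟩ ⟨by linarith, by linarith⟩ (by linarith)
  have a3 : th1 p (2 * ψ) < th1 p (2 * φ) :=
    th1_strictAntiOn hp ⟨by linarith, by linarith⟩ ⟨by linarith, by linarith⟩ (by linarith)
  have a4 : th1 p (3 * ψ) < th1 p (3 * φ) :=
    th1_strictAntiOn hp ⟨by linarith, by linarith⟩ ⟨by linarith, by linarith⟩ (by linarith)
  have b1 : 0 ≤ th1 p (4 * φ - Real.pi) := by
    rw [← th1_zero p]
    exact (th1_strictMonoOn hp).monotoneOn ⟨le_rfl, by linarith⟩ ⟨by linarith, by linarith⟩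
      (by linarith)
  have b2 : 0 < th1 p φ := th1_pos hp ⟨by linarith, by linarith⟩
  have b3 : 0 < th1 p (2 * ψ) := th1_pos hp ⟨by linarith, by linarith⟩
  have b4 : 0 ≤ th1 p (3 * ψ) := by
    rcases h3.eq_or_lt with h | h
    · have : 3 * ψ = 0 + Real.pi := by rw [h]; ring
      rw [this, th1_add_pi, th1_zero, neg_zero]
    · exact (th1_pos hp ⟨by linarith, by linarith⟩).le
  have c1 : th1 p (4 * φ - Real.pi) ^ 2 * th1 p φ ^ 3
      < th1 p (4 * ψ - Real.pi) ^ 2 * th1 p ψ ^ 3 := by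
    have := pow_lt_pow_left₀ a1 b1 two_ne_zero
    have := pow_le_pow_left₀ b2.le a2.le 3
    exact mul_lt_mul'' ‹_› (pow_lt_pow_left₀ a2 b2.le three_ne_zero) (by positivity) (by positivity)
  have c2 : th1 p (2 * ψ) ^ 2 * th1 p (3 * ψ) ^ 3 < th1 p (2 * φ) ^ 2 * th1 p (3 * φ) ^ 3 :=
    mul_lt_mul'' (pow_lt_pow_left₀ a3 b3.le two_ne_zero) (pow_lt_pow_left₀ a4 b4 three_ne_zero)
      (by positivity) (by positivity)
  have := mul_lt_mul_of_pos_left c2 (pow_pos ha 2)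
  rw [weightEq, weightEq]
  linarith

lemma exists_weightEq_eq_zero {a p : ℝ} (ha : 0 < a) (hp : p ∈ Ico (0 : ℝ) 1) :
    ∃ φ ∈ Ioo (Real.pi / 4) (Real.pi / 3), weightEq a p φ = 0 := by
  have hpi := Real.pi_pos
  have hc : ContinuousOn (weightEq a p) (Icc (Real.pi / 4) (Real.pi / 3)) :=
    (continuousOn_weightEq a).comp (f := fun φ : ℝ => (p, φ)) (by fun_prop)
      (fun _ _ => ⟨hp, mem_univ _⟩)
  have h1 : weightEq a p (Real.pi / 4) < 0 := by
    have e : 4 * (Real.pi / 4) - Real.pi = 0 := by ring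
    rw [weightEq, e, th1_zero]
    have b1 : 0 < th1 p (2 * (Real.pi / 4)) := th1_pos hp ⟨by linarith, by linarith⟩
    have b2 : 0 < th1 p (3 * (Real.pi / 4)) := th1_pos hp ⟨by linarith, by linarith⟩
    have : 0 < a ^ 2 * (th1 p (2 * (Real.pi / 4)) ^ 2 * th1 p (3 * (Real.pi / 4)) ^ 3) := by
      positivity
    linarith
  have h2 : 0 < weightEq a p (Real.pi / 3) := by
    have e : 3 * (Real.pi / 3) = 0 + Real.pi := by ring
    rw [weightEq, e, th1_add_pi, th1_zero]
    have b1 : 0 < th1 p (4 * (Real.pi / 3) - Real.pi) := th1_pos hp ⟨by linarith, by linarith⟩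
    have b2 : 0 < th1 p (Real.pi / 3) := th1_pos hp ⟨by linarith, by linarith⟩
    have : 0 < th1 p (4 * (Real.pi / 3) - Real.pi) ^ 2 * th1 p (Real.pi / 3) ^ 3 := by
      positivity
    linarith
  exact intermediate_value_Ioo (by linarith) hc ⟨h1, h2⟩

open Classical in
/-- The angle `φ = γ/τ` of the theta parametrisation with dual nome `p`. -/
noncomputable def thetaAngle (a p : ℝ) : ℝ :=
  if h : ∃ φ ∈ Ioo (Real.pi / 4) (Real.pi / 3), weightEq a p φ = 0 then h.choose else 0

lemma thetaAngle_spec {a p : ℝ} (ha : 0 < a) (hp : p ∈ Ico (0 : ℝ) 1) :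
    thetaAngle a p ∈ Ioo (Real.pi / 4) (Real.pi / 3) ∧ weightEq a p (thetaAngle a p) = 0 := by
  have h := exists_weightEq_eq_zero ha hp
  rw [thetaAngle, dif_pos h]
  exact h.choose_spec

lemma eq_thetaAngle {a p φ : ℝ} (ha : 0 < a) (hp : p ∈ Ico (0 : ℝ) 1)
    (h1 : φ ∈ Ioo (Real.pi / 4) (Real.pi / 3)) (h2 : weightEq a p φ = 0) :
    φ = thetaAngle a p := by
  obtain ⟨h3, h4⟩ := thetaAngle_spec ha hp
  rcases lt_trichotomy φ (thetaAngle a p) with h | h | h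
  · have := weightEq_lt ha hp h1.1.le h h3.2.le
    linarith
  · exact h
  · have := weightEq_lt ha hp h3.1.le h h1.2.le
    linarith

lemma continuousOn_thetaAngle {a : ℝ} (ha : 0 < a) : ContinuousOn (thetaAngle a) (Ico 0 1) := by
  intro p₀ hp₀
  obtain ⟨h1, h2⟩ := thetaAngle_spec ha hp₀
  have hcont : ∀ φ, ContinuousWithinAt (fun p => weightEq a p φ) (Ico 0 1) p₀ := fun φ =>
    ((continuousOn_weightEq a).comp (f := fun p : ℝ => (p, φ)) (by fun_prop)
      (fun p hp => ⟨hp, mem_univ _⟩)) p₀ hp₀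
  refine tendsto_order.2 ⟨fun l hl => ?_, fun u hu => ?_⟩
  -- A test point left of the root but right of π/4. The sign of `weightEq` there persists for
  -- nearby p and traps the root by monotonicity.
  · obtain ⟨l', hl', hl''⟩ := exists_between (max_lt hl h1.1)
    have hneg : weightEq a p₀ l' < 0 := by
      rw [← h2]
      exact weightEq_lt ha hp₀ ((le_max_right _ _).trans hl'.le) hl'' h1.2.le
    filter_upwards [(hcont l').eventually_lt_const hneg, self_mem_nhdsWithin] with p hp hpm
    obtain ⟨h3, h4⟩ := thetaAngle_spec ha hpm
    refine ((le_max_left _ _).trans_lt hl').trans ?_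
    by_contra! hle
    rcases hle.eq_or_lt with h | h
    · rw [← h, h4] at hp
      exact lt_irrefl _ hp
    · have := weightEq_lt ha hpm h3.1.le h (hl''.le.trans h1.2.le)
      linarith
  · obtain ⟨u', hu', hu''⟩ := exists_between (lt_min hu h1.2)
    have hpos : 0 < weightEq a p₀ u' := by
      rw [← h2]
      exact weightEq_lt ha hp₀ h1.1.le hu' (hu''.le.trans (min_le_right _ _))
    filter_upwards [(hcont u').eventually_const_lt hpos, self_mem_nhdsWithin] with p hp hpm
    obtain ⟨h3, h4⟩ := thetaAngle_spec ha hpm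
    refine lt_trans ?_ (hu''.trans_le (min_le_left _ _))
    by_contra! hle
    rcases hle.eq_or_lt with h | h
    · rw [h, h4] at hp
      exact lt_irrefl _ hp
    · have := weightEq_lt ha hpm (h1.1.le.trans hu'.le) h h3.2.le
      linarith

/-- The prefactor of the dual theta parametrisation with nome `p`. -/
noncomputable def thetaScale (a p : ℝ) : ℝ :=
  Real.sqrt (th1 p (3 * thetaAngle a p) / th1 p (thetaAngle a p))

/-- The value of both coordinates at the symmetric point of the kernel curve. -/
noncomputable def symmPoint (a p : ℝ) : ℝ :=
  thetaScale a p * th4 p 0 / th4 p (2 * thetaAngle a p)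

/-- The value `1/t` at which the kernel curve has dual nome `p`. -/
noncomputable def stepValue (a p : ℝ) : ℝ :=
  2 * symmPoint a p + 2 / symmPoint a p + a * symmPoint a p ^ 2

lemma th1_thetaAngle_pos {a p : ℝ} (ha : 0 < a) (hp : p ∈ Ico (0 : ℝ) 1) :
    0 < th1 p (thetaAngle a p) ∧ 0 < th1 p (2 * thetaAngle a p) ∧
    0 < th1 p (3 * thetaAngle a p) ∧ th1 p (4 * thetaAngle a p) < 0 := by
  have hpi := Real.pi_pos
  obtain ⟨⟨h1, h2⟩, -⟩ := thetaAngle_spec ha hp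
  refine ⟨th1_pos hp ⟨by linarith, by linarith⟩, th1_pos hp ⟨by linarith, by linarith⟩,
    th1_pos hp ⟨by linarith, by linarith⟩, ?_⟩
  rw [← neg_pos, ← th1_sub_pi]
  exact th1_pos hp ⟨by linarith, by linarith⟩

lemma thetaScale_pos {a p : ℝ} (ha : 0 < a) (hp : p ∈ Ico (0 : ℝ) 1) :
    0 < thetaScale a p := by
  obtain ⟨h1, -, h3, -⟩ := th1_thetaAngle_pos ha hp
  exact Real.sqrt_pos.2 (div_pos h3 h1)

lemma thetaScale_sq {a p : ℝ} (ha : 0 < a) (hp : p ∈ Ico (0 : ℝ) 1) :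
    thetaScale a p ^ 2
    = th1 p (3 * thetaAngle a p) / th1 p (thetaAngle a p) := by
  obtain ⟨h1, -, h3, -⟩ := th1_thetaAngle_pos ha hp
  exact Real.sq_sqrt (div_pos h3 h1).le

/-- `weightEq` only encodes the square of this equation, c having been eliminated through c⁶. The
sign is recovered from ϑ₁(4φ) < 0. -/
lemma thetaScale_cube {a p : ℝ} (ha : 0 < a) (hp : p ∈ Ico (0 : ℝ) 1) :
    a * thetaScale a p ^ 3
    = -(th1 p (4 * thetaAngle a p) / th1 p (2 * thetaAngle a p)) := by
  obtain ⟨h1, h2, h3, h4⟩ := th1_thetaAngle_pos ha hp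
  have hs := thetaScale_sq ha hp
  have hs0 := thetaScale_pos ha hp
  obtain ⟨-, he⟩ := thetaAngle_spec ha hp
  rw [weightEq, th1_sub_pi] at he
  refine (pow_left_inj₀ (by positivity) ?_ two_ne_zero).1 ?_
  · rw [← neg_div]
    exact (div_pos (neg_pos.2 h4) h2).le
  · have : (a * thetaScale a p ^ 3) ^ 2 = a ^ 2 * (thetaScale a p ^ 2) ^ 3 := by ring
    rw [this, hs, ← neg_div, div_pow, div_pow, mul_div_assoc',
      div_eq_div_iff (by positivity) (by positivity)]
    linear_combination -he

lemma symmPoint_pos {a p : ℝ} (ha : 0 < a) (hp : p ∈ Ico (0 : ℝ) 1) :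
    0 < symmPoint a p :=
  div_pos (mul_pos (thetaScale_pos ha hp) (th4_pos hp _)) (th4_pos hp _)

lemma stepValue_pos {a p : ℝ} (ha : 0 < a) (hp : p ∈ Ico (0 : ℝ) 1) :
    0 < stepValue a p := by
  have := symmPoint_pos ha hp
  unfold stepValue
  positivity

lemma thetaScale_le_one {a p : ℝ} (ha : 0 < a) (hp : p ∈ Ico (0 : ℝ) 1) :
    thetaScale a p ≤ 1 := by
  have hpi := Real.pi_pos
  obtain ⟨h1, -, h3, -⟩ := th1_thetaAngle_pos ha hp
  obtain ⟨⟨g1, g2⟩, -⟩ := thetaAngle_spec ha hp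
  rw [thetaScale, Real.sqrt_le_one, div_le_one h1, ← th1_pi_sub p (3 * _)]
  exact (th1_strictMonoOn hp).monotoneOn ⟨by linarith, by linarith⟩ ⟨by linarith, by linarith⟩
    (by linarith)

lemma eq_thetaScale {a p φ c : ℝ} (ha : 0 < a) (hp : p ∈ Ico (0 : ℝ) 1)
    (hφ : φ ∈ Ioo (Real.pi / 4) (Real.pi / 3)) (hc : 0 < c)
    (h2 : c ^ 2 = th1 p (3 * φ) / th1 p φ)
    (h3 : a * c ^ 3 = -(th1 p (4 * φ) / th1 p (2 * φ))) :
    φ = thetaAngle a p ∧ c = thetaScale a p := by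
  have hpi := Real.pi_pos
  have p1 : 0 < th1 p φ := th1_pos hp ⟨by linarith [hφ.1], by linarith [hφ.2]⟩
  have p2 : 0 < th1 p (2 * φ) := th1_pos hp ⟨by linarith [hφ.1], by linarith [hφ.2]⟩
  have h : φ = thetaAngle a p := by
    refine eq_thetaAngle ha hp hφ ?_
    rw [weightEq, th1_sub_pi]
    have e1 : c ^ 2 * th1 p φ = th1 p (3 * φ) := by rw [h2, div_mul_cancel₀ _ p1.ne']
    have e2 : a * c ^ 3 * th1 p (2 * φ) = -th1 p (4 * φ) := by
      rw [h3, neg_mul, div_mul_cancel₀ _ p2.ne']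
    rw [← e1, ← e2]
    ring
  refine ⟨h, ?_⟩
  rw [thetaScale, ← h, ← h2, Real.sqrt_sq hc.le]

lemma continuousOn_th_comp {f : ℝ → ℝ → ℝ}
    (hf : ContinuousOn (fun y : ℝ × ℝ => f y.1 y.2) (Ico 0 1 ×ˢ univ)) {g : ℝ → ℝ}
    (hg : ContinuousOn g (Ico 0 1)) : ContinuousOn (fun p => f p (g p)) (Ico 0 1) :=
  hf.comp (f := fun p : ℝ => (p, g p)) (continuousOn_id.prodMk hg) (fun _ hp => ⟨hp, mem_univ _⟩)

lemma continuousOn_stepValue {a : ℝ} (ha : 0 < a) : ContinuousOn (stepValue a) (Ico 0 1) := by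
  have hA := continuousOn_thetaAngle ha
  have hs : ContinuousOn (symmPoint a) (Ico 0 1) := by
    refine ContinuousOn.div (ContinuousOn.mul (ContinuousOn.sqrt (ContinuousOn.div
      (continuousOn_th_comp continuousOn_th1 (hA.const_mul 3))
      (continuousOn_th_comp continuousOn_th1 hA)
      (fun p hp => (th1_thetaAngle_pos ha hp).1.ne')))
      (continuousOn_th_comp continuousOn_th3 continuousOn_const))
      (continuousOn_th_comp continuousOn_th3 ((hA.const_mul 2).add continuousOn_const))
      (fun p hp => (th4_pos hp _).ne')
  exact ((hs.const_mul 2).add (continuousOn_const.div hs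
    (fun p hp => (symmPoint_pos ha hp).ne'))).add ((hs.pow 2).const_mul a)

/-- At nome 0 the equations read c² = 3 - 4 sin²φ and ac³ = -2 cos 2φ = 4 sin²φ - 2. The equation
for c says that the derivative of S(x, x) vanishes there, which is what links p = 0 to t_c. -/
lemma symmPoint_zero {a : ℝ} (ha : 0 < a) : a * symmPoint a 0 ^ 3 + symmPoint a 0 ^ 2 = 1 := by
  have h0 : (0 : ℝ) ∈ Ico (0 : ℝ) 1 := ⟨le_rfl, one_pos⟩
  have h : symmPoint a 0 = thetaScale a 0 := by
    rw [symmPoint, th4_nome_zero, th4_nome_zero, mul_one, div_one]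
  obtain ⟨h1, h2, -, -⟩ := th1_thetaAngle_pos ha h0
  rw [h, thetaScale_cube ha h0, thetaScale_sq ha h0]
  simp only [th1_nome_zero] at h1 h2 ⊢
  generalize thetaAngle a 0 = φ at *
  have e4 : 4 * φ = 2 * (2 * φ) := by ring
  rw [e4, Real.sin_two_mul (2 * φ), Real.sin_three_mul]
  have hs1 : Real.sin φ ≠ 0 := by
    intro h; rw [h] at h1; simp at h1
  have hs2 : Real.sin (2 * φ) ≠ 0 := by
    intro h; rw [h] at h2; simp at h2
  have hcos : Real.cos (2 * φ) = 1 - 2 * Real.sin φ ^ 2 := by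
    rw [Real.cos_two_mul, Real.cos_sq']; ring
  rw [hcos]
  field_simp
  ring

/-! ### Growth of the step value as the dual nome tends to 1 -/

lemma th4_zero_le {p : ℝ} (hp : p ∈ Ico (0 : ℝ) 1) (x : ℝ) : th4 p 0 ≤ th4 p x := by
  have hcont : Continuous (th4 p) := (continuous_th3 hp).comp (by fun_prop)
  have hper : Function.Periodic (th4 p) Real.pi := th4_add_pi p
  obtain ⟨m, -, hm⟩ := isCompact_Icc.exists_isMinOn (nonempty_Icc.2 Real.pi_pos.le)
    hcont.continuousOn
  have hmin : ∀ y, th4 p m ≤ th4 p y := by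
    intro y
    obtain ⟨z, hz, hyz⟩ := hper.exists_mem_Ico₀ Real.pi_pos y
    rw [hyz]
    exact hm ⟨hz.1, hz.2.le⟩
  -- The duplication formula ϑ₄(2m)ϑ₄(0)³ = ϑ₄(m)⁴ - ϑ₁(m)⁴. At a minimum m the factor ϑ₄(2m) is at
  -- least ϑ₄(m), whence ϑ₄(0) ≤ ϑ₄(m).
  have hdup : th4 p (2 * m) * th4 p 0 ^ 3 ≤ th4 p m ^ 4 := by
    have e1 := th4_add_mul_sub hp m m
    rw [sub_self, ← two_mul] at e1
    have e2 := th4_sq hp m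
    have e3 := th4_sq hp 0
    rw [mul_zero] at e3
    have : th4 p m ^ 4 - th4 p (2 * m) * th4 p 0 ^ 3
        = p * (th3 (p ^ 2) (2 * m) * th2 (p ^ 2) 0 - th2 (p ^ 2) (2 * m) * th3 (p ^ 2) 0) ^ 2 := by
      have : th4 p m ^ 4 - th4 p (2 * m) * th4 p 0 ^ 3
        = (th4 p m ^ 2) ^ 2 - th4 p (2 * m) * th4 p 0 * th4 p 0 ^ 2 := by ring
      rw [this, e1, e2, e3]
      ring
    have h2 := mul_nonneg hp.1
      (sq_nonneg (th3 (p ^ 2) (2 * m) * th2 (p ^ 2) 0 - th2 (p ^ 2) (2 * m) * th3 (p ^ 2) 0))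
    linarith
  have h0 := th4_pos hp 0
  have hmpos := th4_pos hp m
  have h1 : th4 p 0 ^ 3 ≤ th4 p m ^ 3 := by
    have := (mul_le_mul_of_nonneg_right (hmin (2 * m)) (pow_pos h0 3).le).trans hdup
    have e : th4 p m ^ 4 = th4 p m * th4 p m ^ 3 := by ring
    rw [e] at this
    exact le_of_mul_le_mul_left this hmpos
  exact ((pow_le_pow_iff_left₀ h0.le hmpos.le three_ne_zero).1 h1).trans (hmin x)

lemma th4_zero_mul_th3_le {p : ℝ} (hp : p ∈ Ico (0 : ℝ) 1) (x : ℝ) :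
    th4 p 0 * th3 p 0 ≤ th4 p x * th3 p x := by
  have h1 := th3_mul_th4 hp x
  have h2 := th3_mul_th4 hp 0
  rw [mul_comm (th4 p 0), mul_comm (th4 p x), h1, h2, mul_zero]
  exact mul_le_mul_of_nonneg_right (th4_zero_le (sq_mem_Ico hp) _) (th4_pos (sq_mem_Ico hp) _).le

/-- Multiplying by sin x makes the cosines differences of consecutive sines; summation by parts
against the decreasing p^{n²} gives a bound uniform in p. -/
lemma sin_mul_th3_le {p : ℝ} (hp : p ∈ Ico (0 : ℝ) 1) (x : ℝ) : Real.sin x * th3 p x ≤ 1 := by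
  have h := (hasSum_th3 hp x).mul_left (Real.sin x)
  have hterm : ∀ n : ℕ, Real.sin x * (2 * (p ^ ((n + 1) ^ 2) * Real.cos (2 * (n + 1) * x)))
      = p ^ ((n + 1) ^ 2) * (Real.sin ((2 * n + 3) * x) - Real.sin ((2 * n + 1) * x)) := by
    intro n
    have e1 : (2 * (n : ℝ) + 3) * x = 2 * (n + 1) * x + x := by ring
    have e2 : (2 * (n : ℝ) + 1) * x = 2 * (n + 1) * x - x := by ring
    rw [e1, e2, Real.sin_add, Real.sin_sub]
    ring
  simp only [hterm] at h
  have hpart : ∀ N : ℕ, Real.sin x + ∑ n ∈ Finset.range N,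
      p ^ ((n + 1) ^ 2) * (Real.sin ((2 * n + 3) * x) - Real.sin ((2 * n + 1) * x))
      ≤ 1 - p ^ (N ^ 2) + p ^ (N ^ 2) * Real.sin ((2 * N + 1) * x) := by
    intro N
    induction N with
    | zero => simp
    | succ N ih =>
      rw [Finset.sum_range_succ, ← add_assoc]
      have h1 : p ^ ((N + 1) ^ 2) ≤ p ^ (N ^ 2) :=
        pow_le_pow_of_le_one hp.1 hp.2.le (Nat.pow_le_pow_left N.le_succ 2)
      have h2 := Real.sin_le_one ((2 * N + 1) * x)
      have e : (2 * ((N + 1 : ℕ) : ℝ) + 1) * x = (2 * N + 3) * x := by push_cast; ring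
      rw [e]
      nlinarith
  have hpart' : ∀ N : ℕ, ∑ n ∈ Finset.range N,
      p ^ ((n + 1) ^ 2) * (Real.sin ((2 * n + 3) * x) - Real.sin ((2 * n + 1) * x))
      ≤ 1 - Real.sin x := by
    intro N
    have h1 := hpart N
    have h2 := mul_le_mul_of_nonneg_left (Real.sin_le_one ((2 * N + 1) * x))
      (pow_nonneg hp.1 (N ^ 2))
    linarith
  have := le_of_tendsto' h.tendsto_sum_nat hpart'
  linarith

/-- The angle 2φ stays in (π/2, 2π/3), so ϑ₃(2φ) is bounded as p → 1. Since ϑ₃ϑ₄ is smallest at 0,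
the symmetric point is at most 2/ϑ₃(0), and its reciprocal dominates. -/
lemma th3_zero_le_stepValue {a p : ℝ} (ha : 0 < a) (hp : p ∈ Ico (0 : ℝ) 1) :
    th3 p 0 ≤ stepValue a p := by
  have hpi := Real.pi_pos
  obtain ⟨⟨g1, g2⟩, -⟩ := thetaAngle_spec ha hp
  have hx := symmPoint_pos ha hp
  have h3 := th3_pos hp 0
  set φ := thetaAngle a p with hφ
  have h4 := th4_pos hp (2 * φ)
  have hsin : 1 / 2 ≤ Real.sin (2 * φ) := by
    rw [← Real.sin_pi_sub, ← Real.sin_pi_div_six]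
    exact Real.sin_le_sin_of_le_of_le_pi_div_two (by linarith) (by linarith) (by linarith)
  have h5 : th3 p (2 * φ) ≤ 2 := by
    have := sin_mul_th3_le hp (2 * φ)
    have := th3_pos hp (2 * φ)
    nlinarith
  have h6 : symmPoint a p * th3 p 0 ≤ 2 := by
    rw [symmPoint, ← hφ, div_mul_eq_mul_div, div_le_iff₀ h4]
    have e1 := th4_zero_mul_th3_le hp (2 * φ)
    have e2 := thetaScale_le_one ha hp
    have e3 : 0 < th4 p 0 * th3 p 0 := mul_pos (th4_pos hp 0) h3
    nlinarith
  have h7 : th3 p 0 ≤ 2 / symmPoint a p := by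
    rw [le_div_iff₀ hx]
    linarith
  have : 0 < 2 * symmPoint a p + a * symmPoint a p ^ 2 := by positivity
  rw [stepValue]
  linarith

lemma tendsto_th3_zero : Tendsto (fun p => th3 p 0) (𝓝[<] 1) atTop := by
  refine tendsto_atTop.2 (fun b => ?_)
  obtain ⟨N, hN⟩ := exists_nat_gt b
  have hc : Tendsto (fun p : ℝ => ∑ n ∈ Finset.range N, 2 * p ^ ((n + 1) ^ 2)) (𝓝[<] 1)
      (𝓝 (∑ n ∈ Finset.range N, 2 * (1 : ℝ) ^ ((n + 1) ^ 2))) :=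
    tendsto_nhdsWithin_of_tendsto_nhds
      (Continuous.tendsto (by fun_prop) _)
  have hlt : b < ∑ n ∈ Finset.range N, 2 * (1 : ℝ) ^ ((n + 1) ^ 2) + 1 := by
    simp
    linarith [(Nat.cast_nonneg N : (0 : ℝ) ≤ N)]
  filter_upwards [(hc.add_const 1).eventually_const_lt hlt,
    Ioo_mem_nhdsLT (zero_lt_one : (0 : ℝ) < 1)] with p hp hpm
  have h := hasSum_th3 (p := p) ⟨hpm.1.le, hpm.2⟩ 0
  have := sum_le_hasSum (Finset.range N) (fun n _ => ?_) h
  · simp only [mul_zero, Real.cos_zero, mul_one] at this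
    linarith
  · have := hpm.1
    rw [mul_zero, Real.cos_zero]
    positivity

lemma tendsto_stepValue {a : ℝ} (ha : 0 < a) : Tendsto (stepValue a) (𝓝[<] 1) atTop := by
  refine tendsto_atTop_mono' _ ?_ tendsto_th3_zero
  filter_upwards [Ioo_mem_nhdsLT (zero_lt_one : (0 : ℝ) < 1)] with p hp
  exact th3_zero_le_stepValue ha ⟨hp.1.le, hp.2⟩

/-! ### Real step curves and their ramification points -/

/-- The real counterpart of `thetaX` for a function `f`. -/
noncomputable def ratioX (f : ℝ → ℝ) (c φ u : ℝ) : ℝ :=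
  c * (f u * f (u + φ) / (f (u - φ) * f (u + 2 * φ)))

/-- The real counterpart of `thetaY` for a function `f`. -/
noncomputable def ratioY (f : ℝ → ℝ) (c φ u : ℝ) : ℝ :=
  c * (f u * f (u - φ) / (f (u + φ) * f (u - 2 * φ)))

/-- The points `(ratioX, ratioY)` lie on the curve where the step polynomial takes the value `v`,
and the two solutions `Y` over `X` have the product `1/(1 + aX)`. -/
structure IsStepCurve (f : ℝ → ℝ) (a c φ v : ℝ) : Prop where
  step : ∀ u, f u ≠ 0 → f (u + φ) ≠ 0 → f (u - φ) ≠ 0 → f (u + 2 * φ) ≠ 0 → f (u - 2 * φ) ≠ 0 →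
    ratioX f c φ u + ratioY f c φ u + 1 / ratioX f c φ u + 1 / ratioY f c φ u
      + a * (ratioX f c φ u * ratioY f c φ u) = v
  prod : ∀ u, f (u - φ) ≠ 0 → f (u + 2 * φ) ≠ 0 →
    1 + a * ratioX f c φ u =
      f (u - 2 * φ) * f (u + 3 * φ) / (c ^ 2 * (f (u - φ) * f (u + 2 * φ)))

/-- Shifts by π/2 carry the statement from `th1` to `th2` and from `th4` to `th3`, so all four
half-periods are covered. -/
lemma IsStepCurve.shift {f : ℝ → ℝ} {a c φ v : ℝ} (h : IsStepCurve f a c φ v) (s : ℝ) :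
    IsStepCurve (fun u => f (u + s)) a c φ v := by
  have e : ∀ u w : ℝ, u + w + s = u + s + w := fun u w => by ring
  have e' : ∀ u w : ℝ, u - w + s = u + s - w := fun u w => by ring
  constructor
  · intro u
    simp only [ratioX, ratioY, e, e']
    exact h.step (u + s)
  · intro u
    simp only [ratioX, e, e']
    exact h.prod (u + s)

/-- The ramification points of `X`. -/
theorem IsStepCurve.branch {f : ℝ → ℝ} {a c φ v ε : ℝ} (h : IsStepCurve f a c φ v)
    (hc : c ≠ 0) (hε : ε ^ 2 = 1) (hf : ∀ x, f (-x) = ε * f x)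
    (h1 : f (φ / 2) ≠ 0) (h3 : f (3 * φ / 2) ≠ 0) (h5 : f (5 * φ / 2) ≠ 0) :
    v = c * (f (φ / 2) ^ 2 / f (3 * φ / 2) ^ 2) + 1 / (c * (f (φ / 2) ^ 2 / f (3 * φ / 2) ^ 2))
        + 2 / (ε * c * (f (3 * φ / 2) / f (5 * φ / 2))) ∧
      (1 + a * (c * (f (φ / 2) ^ 2 / f (3 * φ / 2) ^ 2))) *
        (ε * c * (f (3 * φ / 2) / f (5 * φ / 2))) ^ 2 = 1 := by
  have hε0 : ε ≠ 0 := by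
    rintro rfl
    norm_num at hε
  have e1 : -(φ / 2) + φ = φ / 2 := by ring
  have e2 : -(φ / 2) - φ = -(3 * φ / 2) := by ring
  have e3 : -(φ / 2) + 2 * φ = 3 * φ / 2 := by ring
  have e4 : -(φ / 2) - 2 * φ = -(5 * φ / 2) := by ring
  have e5 : -(φ / 2) + 3 * φ = 5 * φ / 2 := by ring
  -- X is invariant under u ↦ -φ - u, whose fixed point is -φ/2. There the two values of Y over X
  -- coincide, so Y² = 1/(1 + aX).
  have hs := h.step (-(φ / 2))
  have hp := h.prod (-(φ / 2))
  simp only [ratioX, ratioY, e1, e2, e3, e4, e5, hf] at hs hp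
  have hs := hs (mul_ne_zero hε0 h1) h1 (mul_ne_zero hε0 h3) h3 (mul_ne_zero hε0 h5)
  have hp := hp (mul_ne_zero hε0 h3) h3
  generalize f (φ / 2) = f1 at *
  generalize f (3 * φ / 2) = f3 at *
  generalize f (5 * φ / 2) = f5 at *
  have x1 : ε * f1 * f1 / (ε * f3 * f3) = f1 ^ 2 / f3 ^ 2 := by
    field_simp
  have x2 : c * (ε * f1 * (ε * f3) / (f1 * (ε * f5))) = ε * c * (f3 / f5) := by
    field_simp
  have x3 : ε * f5 * f5 / (c ^ 2 * (ε * f3 * f3)) = f5 ^ 2 / (c ^ 2 * f3 ^ 2) := by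
    field_simp
  rw [x1, x2] at hs
  rw [x1, x3] at hp
  have hprod : (1 + a * (c * (f1 ^ 2 / f3 ^ 2))) * (ε * c * (f3 / f5)) ^ 2 = 1 := by
    rw [hp, mul_pow, mul_pow, hε]
    field_simp
  refine ⟨?_, hprod⟩
  have hY : ε * c * (f3 / f5) ≠ 0 := by positivity
  generalize ε * c * (f3 / f5) = Y at *
  generalize c * (f1 ^ 2 / f3 ^ 2) = X at *
  have : a * (X * Y) = 1 / Y - Y := by
    field_simp
    linear_combination hprod
  rw [this] at hs
  rw [← hs]
  ring

lemma jacobiTh_ratio_th1 (σ c u₁ u₂ u₃ u₄ : ℝ) :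
    (c : ℂ) * (jacobiTh (u₁ : ℂ) (Complex.I * σ) * jacobiTh (u₂ : ℂ) (Complex.I * σ)) /
      (jacobiTh (u₃ : ℂ) (Complex.I * σ) * jacobiTh (u₄ : ℂ) (Complex.I * σ)) =
    ((c * (th1 (Real.exp (-(Real.pi * σ))) u₁ * th1 (Real.exp (-(Real.pi * σ))) u₂ /
      (th1 (Real.exp (-(Real.pi * σ))) u₃ * th1 (Real.exp (-(Real.pi * σ))) u₄)) : ℝ) : ℂ) := by
  simp only [jacobiTh_ofReal, Complex.ofReal_mul, Complex.ofReal_div]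
  have hK : Complex.I * (Real.exp (-(Real.pi * σ / 4)) : ℂ) ≠ 0 :=
    mul_ne_zero Complex.I_ne_zero (by exact_mod_cast (Real.exp_pos _).ne')
  generalize ((Real.exp (-(Real.pi * σ / 4)) : ℝ) : ℂ) = K at *
  simp only [← mul_assoc]
  rw [show ∀ A B : ℂ, (c : ℂ) * Complex.I * K * A * Complex.I * K * B
    = ((Complex.I * K) * (Complex.I * K)) * (c * (A * B)) by intros; ring,
    show ∀ A B : ℂ, Complex.I * K * A * Complex.I * K * B
    = ((Complex.I * K) * (Complex.I * K)) * (A * B) by intros; ring,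
    mul_div_mul_left _ _ (mul_ne_zero hK hK), mul_div_assoc]

lemma jacobiTh_sub_half_period_ofReal {σ : ℝ} (hσ : 0 < σ) (u : ℝ) :
    jacobiTh (u - Real.pi * (Complex.I * σ) / 2) (Complex.I * σ) =
      Complex.exp (-(Real.pi * Complex.I * (Complex.I * σ) / 4) + Complex.I * u) *
        ((th4 (Real.exp (-(Real.pi * σ))) u : ℝ) : ℂ) := by
  have hτ : 0 < (Complex.I * (σ : ℂ)).im := by simpa using hσ
  have hpi : (Real.pi : ℂ) ≠ 0 := by exact_mod_cast Real.pi_ne_zero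
  have e : (u : ℂ) / Real.pi + 1 / 2 = ((u + Real.pi / 2 : ℝ) : ℂ) / Real.pi := by
    push_cast
    field_simp
  rw [jacobiTh_sub_half_period _ hτ, e, jacobiTheta₂_ofReal hσ, th4]

lemma jacobiTh_ratio_th4 {σ : ℝ} (hσ : 0 < σ) (c : ℝ) {u₁ u₂ u₃ u₄ : ℝ} (h : u₁ + u₂ = u₃ + u₄) :
    (c : ℂ) * (jacobiTh (u₁ - Real.pi * (Complex.I * σ) / 2) (Complex.I * σ) *
        jacobiTh (u₂ - Real.pi * (Complex.I * σ) / 2) (Complex.I * σ)) /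
      (jacobiTh (u₃ - Real.pi * (Complex.I * σ) / 2) (Complex.I * σ) *
        jacobiTh (u₄ - Real.pi * (Complex.I * σ) / 2) (Complex.I * σ)) =
    ((c * (th4 (Real.exp (-(Real.pi * σ))) u₁ * th4 (Real.exp (-(Real.pi * σ))) u₂ /
      (th4 (Real.exp (-(Real.pi * σ))) u₃ * th4 (Real.exp (-(Real.pi * σ))) u₄)) : ℝ) : ℂ) := by
  simp only [jacobiTh_sub_half_period_ofReal hσ, Complex.ofReal_mul, Complex.ofReal_div]
  have hE : ∀ a b : ℝ, Complex.exp (-(Real.pi * Complex.I * (Complex.I * σ) / 4) + Complex.I * a) *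
      Complex.exp (-(Real.pi * Complex.I * (Complex.I * σ) / 4) + Complex.I * b)
      = Complex.exp (-(Real.pi * Complex.I * (Complex.I * σ) / 2) + Complex.I * (a + b : ℝ)) := by
    intro a b
    rw [← Complex.exp_add]
    congr 1
    push_cast
    ring
  rw [mul_mul_mul_comm, hE, mul_mul_mul_comm (Complex.exp (_ + Complex.I * u₃)), hE, h,
    mul_left_comm, mul_div_mul_left _ _ (Complex.exp_ne_zero _), mul_div_assoc]

lemma jacobiTh_ofReal_ne_zero {σ x : ℝ} (h : th1 (Real.exp (-(Real.pi * σ))) x ≠ 0) :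
    jacobiTh x (Complex.I * σ) ≠ 0 := by
  rw [jacobiTh_ofReal]
  refine mul_ne_zero Complex.I_ne_zero ?_
  exact_mod_cast mul_ne_zero (Real.exp_pos _).ne' h

lemma jacobiTh_sub_half_period_ne_zero {σ : ℝ} (hσ : 0 < σ) (u : ℝ) :
    jacobiTh (u - Real.pi * (Complex.I * σ) / 2) (Complex.I * σ) ≠ 0 := by
  rw [jacobiTh_sub_half_period_ofReal hσ]
  refine mul_ne_zero (Complex.exp_ne_zero _) ?_
  exact_mod_cast (th4_pos (exp_neg_pi_mul_mem hσ) u).ne'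

/-- The complex step identity on the dual side restricts to the real thetas. -/
theorem isStepCurve_of_complex {σ a c φ : ℝ} {V : ℂ} (hσ : 0 < σ) (hc : c ≠ 0)
    (h1 : th1 (Real.exp (-(Real.pi * σ))) φ ≠ 0)
    (h2 : th1 (Real.exp (-(Real.pi * σ))) (2 * φ) ≠ 0)
    (hc2 : c ^ 2 = th1 (Real.exp (-(Real.pi * σ))) (3 * φ) / th1 (Real.exp (-(Real.pi * σ))) φ)
    (hc3 : a * c ^ 3 = -(th1 (Real.exp (-(Real.pi * σ))) (4 * φ) /
      th1 (Real.exp (-(Real.pi * σ))) (2 * φ)))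
    (H : ∀ w : ℂ, jacobiTh w (Complex.I * σ) ≠ 0 → jacobiTh (w + φ) (Complex.I * σ) ≠ 0 →
      jacobiTh (w - φ) (Complex.I * σ) ≠ 0 → jacobiTh (w + 2 * φ) (Complex.I * σ) ≠ 0 →
      jacobiTh (w - 2 * φ) (Complex.I * σ) ≠ 0 →
      thetaX c φ (Complex.I * σ) w + thetaY c φ (Complex.I * σ) w
        + 1 / thetaX c φ (Complex.I * σ) w + 1 / thetaY c φ (Complex.I * σ) w
        + a * (thetaX c φ (Complex.I * σ) w * thetaY c φ (Complex.I * σ) w) = V) :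
    ∃ v : ℝ, V = v ∧ IsStepCurve (th1 (Real.exp (-(Real.pi * σ)))) a c φ v ∧
      IsStepCurve (th4 (Real.exp (-(Real.pi * σ)))) a c φ v := by
  have hτ : 0 < (Complex.I * (σ : ℂ)).im := by simpa using hσ
  have hcC : (c : ℂ) ≠ 0 := by exact_mod_cast hc
  have hr : ∀ m n : ℝ, jacobiTh (m * φ : ℝ) (Complex.I * σ) / jacobiTh (n * φ : ℝ) (Complex.I * σ)
      = ((th1 (Real.exp (-(Real.pi * σ))) (m * φ) / th1 (Real.exp (-(Real.pi * σ))) (n * φ) : ℝ)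
        : ℂ) := by
    intro m n
    rw [jacobiTh_ofReal, jacobiTh_ofReal, mul_div_mul_left _ _ Complex.I_ne_zero, ← Complex.ofReal_div,
      mul_div_mul_left _ _ (Real.exp_pos _).ne']
  have hc2' : (c : ℂ) ^ 2 = jacobiTh (3 * φ) (Complex.I * σ) / jacobiTh φ (Complex.I * σ) := by
    have := hr 3 1
    rw [one_mul, ← hc2] at this
    push_cast at this
    exact this.symm
  have hc3' : (a : ℂ) * (c : ℂ) ^ 3
      = -(jacobiTh (4 * φ) (Complex.I * σ) / jacobiTh (2 * φ) (Complex.I * σ)) := by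
    have := congrArg (fun z => -z) (hr 4 2)
    simp only [← Complex.ofReal_neg] at this
    rw [← hc3] at this
    push_cast at this
    exact this.symm
  have hj1 := jacobiTh_ofReal_ne_zero h1
  have hj2 := jacobiTh_ofReal_ne_zero h2
  push_cast at hj2
  have P := fun z => one_add_mul_thetaX hτ hcC hj1 hj2 hc3' hc2' (z := z)
  have cp : ∀ u w : ℝ, (u : ℂ) + w = ((u + w : ℝ) : ℂ) := fun u w => by push_cast; rfl
  have cm : ∀ u w : ℝ, (u : ℂ) - w = ((u - w : ℝ) : ℂ) := fun u w => by push_cast; rfl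
  have c2 : (2 : ℂ) * φ = ((2 * φ : ℝ) : ℂ) := by push_cast; rfl
  have c3 : (3 : ℂ) * φ = ((3 * φ : ℝ) : ℂ) := by push_cast; rfl
  have sp : ∀ u w : ℝ, (u : ℂ) - Real.pi * (Complex.I * σ) / 2 + w
      = ((u + w : ℝ) : ℂ) - Real.pi * (Complex.I * σ) / 2 := fun u w => by push_cast; ring
  have sm : ∀ u w : ℝ, (u : ℂ) - Real.pi * (Complex.I * σ) / 2 - w
      = ((u - w : ℝ) : ℂ) - Real.pi * (Complex.I * σ) / 2 := fun u w => by push_cast; ring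
  have hdiv : ∀ A B : ℂ, A / ((c : ℂ) ^ 2 * B) = ((c⁻¹ ^ 2 : ℝ) : ℂ) * A / B := by
    intro A B
    push_cast
    rw [mul_comm ((c : ℂ) ^ 2), ← div_div, inv_pow]
    ring
  have hdiv' : ∀ A B : ℝ, c⁻¹ ^ 2 * (A / B) = A / (c ^ 2 * B) := by
    intro A B
    rw [mul_comm (c ^ 2), ← div_div, inv_pow]
    ring
  -- The constant is real because on the line shifted by half a period X and Y are real and `th4`
  -- has no zeros; one point of that line suffices.
  obtain ⟨v, rfl⟩ : ∃ v : ℝ, V = v := by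
    have := H ((0 : ℝ) - Real.pi * (Complex.I * σ) / 2)
    simp only [thetaX, thetaY, c2, sp, sm] at this
    rw [jacobiTh_ratio_th4 hσ c (by ring), jacobiTh_ratio_th4 hσ c (by ring)] at this
    have := this (jacobiTh_sub_half_period_ne_zero hσ _) (jacobiTh_sub_half_period_ne_zero hσ _)
      (jacobiTh_sub_half_period_ne_zero hσ _) (jacobiTh_sub_half_period_ne_zero hσ _)
      (jacobiTh_sub_half_period_ne_zero hσ _)
    have hV : ∀ X Y : ℝ, ∃ v : ℝ, (X : ℂ) + Y + 1 / X + 1 / Y + a * (X * Y) = v := fun X Y =>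
      ⟨X + Y + 1 / X + 1 / Y + a * (X * Y), by push_cast; rfl⟩
    rw [← this]
    exact hV _ _
  refine ⟨v, rfl, ⟨fun u g0 g1 g2 g3 g4 => ?_, fun u g2 g3 => ?_⟩,
    ⟨fun u g0 g1 g2 g3 g4 => ?_, fun u g2 g3 => ?_⟩⟩
  · have := H u
    simp only [thetaX, thetaY, c2, cp, cm] at this
    simp only [jacobiTh_ratio_th1] at this
    have := this (jacobiTh_ofReal_ne_zero g0) (jacobiTh_ofReal_ne_zero g1)
      (jacobiTh_ofReal_ne_zero g2) (jacobiTh_ofReal_ne_zero g3) (jacobiTh_ofReal_ne_zero g4)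
    exact_mod_cast this
  · have := P u
    simp only [thetaX, c2, c3, cp, cm] at this
    simp only [hdiv] at this
    simp only [jacobiTh_ratio_th1] at this
    have := this (jacobiTh_ofReal_ne_zero g2) (jacobiTh_ofReal_ne_zero g3)
    rw [hdiv'] at this
    exact_mod_cast this
  · have := H (u - Real.pi * (Complex.I * σ) / 2)
    simp only [thetaX, thetaY, c2, sp, sm] at this
    rw [jacobiTh_ratio_th4 hσ c (by ring), jacobiTh_ratio_th4 hσ c (by ring)] at this
    have := this (jacobiTh_sub_half_period_ne_zero hσ _) (jacobiTh_sub_half_period_ne_zero hσ _)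
      (jacobiTh_sub_half_period_ne_zero hσ _) (jacobiTh_sub_half_period_ne_zero hσ _)
      (jacobiTh_sub_half_period_ne_zero hσ _)
    exact_mod_cast this
  · have := P (u - Real.pi * (Complex.I * σ) / 2)
    simp only [thetaX, c2, c3, sp, sm] at this
    simp only [hdiv] at this
    rw [jacobiTh_ratio_th4 hσ c (by ring), jacobiTh_ratio_th4 hσ _ (by ring)] at this
    have := this (jacobiTh_sub_half_period_ne_zero hσ _) (jacobiTh_sub_half_period_ne_zero hσ _)
    rw [hdiv'] at this
    exact_mod_cast this

/-- At the symmetric point both coordinates agree, which gives the value of the step polynomial. -/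
lemma step_value_eq {p a c φ v : ℝ} (hp : p ∈ Ico (0 : ℝ) 1)
    (h : IsStepCurve (th4 p) a c φ v) :
    v = 2 * (c * th4 p 0 / th4 p (2 * φ)) + 2 / (c * th4 p 0 / th4 p (2 * φ))
      + a * (c * th4 p 0 / th4 p (2 * φ)) ^ 2 := by
  have hne := fun u => (th4_pos hp u).ne'
  have hs := h.step 0 (hne _) (hne _) (hne _) (hne _) (hne _)
  simp only [ratioX, ratioY, zero_add, zero_sub, th4_neg] at hs
  have e : c * (th4 p 0 * th4 p φ / (th4 p φ * th4 p (2 * φ))) = c * th4 p 0 / th4 p (2 * φ) := by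
    have := hne φ
    have := hne (2 * φ)
    field_simp
  rw [e] at hs
  rw [← hs]
  ring

/-- The prefactor is positive where the step polynomial takes a positive value. -/
lemma scale_pos_of_value_pos {p a c φ v : ℝ} (hp : p ∈ Ico (0 : ℝ) 1)
    (h : IsStepCurve (th4 p) a c φ v) (hc : c ≠ 0) (hv : 0 < v) : 0 < c := by
  have hne := fun u => (th4_pos hp u)
  obtain ⟨h1, -⟩ := h.branch hc (one_pow 2) (fun x => by rw [one_mul, th4_neg])
    (hne _).ne' (hne _).ne' (hne _).ne'
  by_contra! hle
  have hneg : c < 0 := lt_of_le_of_ne hle hc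
  have p1 : 0 < th4 p (φ / 2) ^ 2 / th4 p (3 * φ / 2) ^ 2 := by
    have := hne (φ / 2)
    have := hne (3 * φ / 2)
    positivity
  have p2 : 0 < th4 p (3 * φ / 2) / th4 p (5 * φ / 2) := div_pos (hne _) (hne _)
  have q1 : c * (th4 p (φ / 2) ^ 2 / th4 p (3 * φ / 2) ^ 2) < 0 := mul_neg_of_neg_of_pos hneg p1
  have q2 : 1 * c * (th4 p (3 * φ / 2) / th4 p (5 * φ / 2)) < 0 := by
    rw [one_mul]
    exact mul_neg_of_neg_of_pos hneg p2
  have q3 := one_div_neg.2 q1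
  have q4 := div_neg_of_pos_of_neg (two_pos : (0 : ℝ) < 2) q2
  linarith

/-- A ramification point on the sheet on which `Y` has the sign of `s`. -/
def IsBranch (a v s e : ℝ) : Prop :=
  (v - e - 1 / e) ^ 2 = 4 * (1 + a * e) ∧ 0 < s * (v - e - 1 / e) ∧ 0 < e

lemma isBranch_of_eq {a v s E Y : ℝ} (h1 : v = E + 1 / E + 2 / Y) (h2 : (1 + a * E) * Y ^ 2 = 1)
    (hE : 0 < E) (hY : 0 < s * Y) : IsBranch a v s E := by
  have hY0 : Y ≠ 0 := by
    rintro rfl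
    simp at hY
  have h3 : v - E - 1 / E = 2 / Y := by rw [h1]; ring
  refine ⟨?_, ?_, hE⟩
  · rw [h3, div_pow, div_eq_iff (by positivity)]
    linear_combination -4 * h2
  · rw [h3]
    have : s * (2 / Y) = 2 * (s * Y) / Y ^ 2 := by
      field_simp
    rw [this]
    positivity

/-- The discriminant has at most four roots. -/
lemma branch_mem_four {a v e₁ e₂ e₃ e₄ e : ℝ}
    (h : ∀ x ∈ ({e₁, e₂, e₃, e₄, e} : Finset ℝ), x ≠ 0 ∧ (v - x - 1 / x) ^ 2 = 4 * (1 + a * x))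
    (h12 : e₁ ≠ e₂) (h13 : e₁ ≠ e₃) (h14 : e₁ ≠ e₄) (h23 : e₂ ≠ e₃) (h24 : e₂ ≠ e₄)
    (h34 : e₃ ≠ e₄) : e = e₁ ∨ e = e₂ ∨ e = e₃ ∨ e = e₄ := by
  by_contra! hne
  obtain ⟨n1, n2, n3, n4⟩ := hne
  open Polynomial in
  -- This is x²((v - x - 1/x)² - 4(1 + ax)) expanded.
  let P : ℝ[X] := X ^ 4 - C (2 * v + 4 * a) * X ^ 3 + C (v ^ 2 - 2) * X ^ 2 - C (2 * v) * X + C 1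
  have hdeg : P.natDegree = 4 := by
    simp only [P]
    compute_degree!
  have hP0 : P ≠ 0 := by
    intro h0
    rw [h0] at hdeg
    simp at hdeg
  have hroots : ({e₁, e₂, e₃, e₄, e} : Finset ℝ) ⊆ P.roots.toFinset := by
    intro x hx
    obtain ⟨hx0, hx1⟩ := h x hx
    rw [Multiset.mem_toFinset, Polynomial.mem_roots hP0, Polynomial.IsRoot]
    simp only [P, Polynomial.eval_add, Polynomial.eval_sub, Polynomial.eval_mul,
      Polynomial.eval_pow, Polynomial.eval_X, Polynomial.eval_C]
    have : (v - x - 1 / x) * x = v * x - x ^ 2 - 1 := by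
      field_simp
    have h2 : (v * x - x ^ 2 - 1) ^ 2 = 4 * (1 + a * x) * x ^ 2 := by
      rw [← this, mul_pow, hx1]
    linear_combination h2
  have hcard : ({e₁, e₂, e₃, e₄, e} : Finset ℝ).card = 5 := by
    rw [Finset.card_insert_of_notMem, Finset.card_insert_of_notMem, Finset.card_insert_of_notMem,
      Finset.card_insert_of_notMem, Finset.card_singleton]
    · simpa using n4.symm
    · simp only [Finset.mem_insert, Finset.mem_singleton, not_or]
      exact ⟨h34, n3.symm⟩
    · simp only [Finset.mem_insert, Finset.mem_singleton, not_or]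
      exact ⟨h23, h24, n2.symm⟩
    · simp only [Finset.mem_insert, Finset.mem_singleton, not_or]
      exact ⟨h12, h13, h14, n1.symm⟩
  have h1 := Finset.card_le_card hroots
  have h2 := Multiset.toFinset_card_le P.roots
  have h3 := P.card_roots'
  omega

lemma IsBranch.ne {a v e e' : ℝ} (h : IsBranch a v (-1) e) (h' : IsBranch a v 1 e') : e ≠ e' := by
  rintro rfl
  have := h.2.1
  have := h'.2.1
  linarith

/-! ### Recovering the dual nome from the step value -/

/-- The invariant of two unordered pairs of points on the projective line. -/
noncomputable def pairInvariant (e₁ e₂ e₃ e₄ : ℝ) : ℝ :=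
  (e₁ - e₂) ^ 2 * (e₃ - e₄) ^ 2 / ((e₁ - e₃) * (e₁ - e₄) * (e₂ - e₃) * (e₂ - e₄))

/-- The quartic determines the four points and the sign of Y the two pairs, but not the order within
a pair; the invariant is symmetric under those swaps. -/
lemma pairInvariant_eq {a v e₁ e₂ e₃ e₄ f₁ f₂ f₃ f₄ : ℝ}
    (h1 : IsBranch a v (-1) e₁) (h2 : IsBranch a v (-1) e₂) (h3 : IsBranch a v 1 e₃)
    (h4 : IsBranch a v 1 e₄) (h12 : e₁ ≠ e₂) (h34 : e₃ ≠ e₄)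
    (g1 : IsBranch a v (-1) f₁) (g2 : IsBranch a v (-1) f₂) (g3 : IsBranch a v 1 f₃)
    (g4 : IsBranch a v 1 f₄) (g12 : f₁ ≠ f₂) (g34 : f₃ ≠ f₄) :
    pairInvariant e₁ e₂ e₃ e₄ = pairInvariant f₁ f₂ f₃ f₄ := by
  have key : ∀ f s, IsBranch a v s f → f = e₁ ∨ f = e₂ ∨ f = e₃ ∨ f = e₄ := by
    intro f s hf
    refine branch_mem_four (a := a) (v := v) ?_ h12 (h1.ne h3) (h1.ne h4) (h2.ne h3) (h2.ne h4) h34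
    intro x hx
    simp only [Finset.mem_insert, Finset.mem_singleton] at hx
    rcases hx with rfl | rfl | rfl | rfl | rfl
    · exact ⟨h1.2.2.ne', h1.1⟩
    · exact ⟨h2.2.2.ne', h2.1⟩
    · exact ⟨h3.2.2.ne', h3.1⟩
    · exact ⟨h4.2.2.ne', h4.1⟩
    · exact ⟨hf.2.2.ne', hf.1⟩
  have kneg : ∀ f, IsBranch a v (-1) f → f = e₁ ∨ f = e₂ := by
    intro f hf
    rcases key f _ hf with h | h | h | h
    · exact Or.inl h
    · exact Or.inr h
    · exact absurd h (hf.ne h3)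
    · exact absurd h (hf.ne h4)
  have kpos : ∀ f, IsBranch a v 1 f → f = e₃ ∨ f = e₄ := by
    intro f hf
    rcases key f _ hf with h | h | h | h
    · exact absurd h.symm (h1.ne hf)
    · exact absurd h.symm (h2.ne hf)
    · exact Or.inl h
    · exact Or.inr h
  rcases kneg _ g1 with rfl | rfl <;> rcases kneg _ g2 with rfl | rfl <;>
    rcases kpos _ g3 with rfl | rfl <;> rcases kpos _ g4 with rfl | rfl <;>
    first | exact absurd rfl g12 | exact absurd rfl g34 | rfl | (simp only [pairInvariant]; ring)

/-- The modulus of the four ramification points, as a function of the dual nome. -/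
noncomputable def nomeModulus (p : ℝ) : ℝ :=
  p * th2 (p ^ 2) 0 ^ 2 / th3 (p ^ 2) 0 ^ 2

lemma nomeModulus_mem {p : ℝ} (hp : p ∈ Ioo (0 : ℝ) 1) : nomeModulus p ∈ Ioo (0 : ℝ) 1 := by
  have hp' : p ∈ Ico (0 : ℝ) 1 := ⟨hp.1.le, hp.2⟩
  have hpi := Real.pi_pos
  have h3 := th3_pos (sq_mem_Ico hp') 0
  have h2 := th2_pos (sq_mem_Ico hp') (x := 0) ⟨by linarith, by linarith⟩
  have h4 := th4_sq hp' 0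
  have h4' := th4_pos hp' 0
  have := hp.1
  rw [mul_zero] at h4
  refine ⟨by unfold nomeModulus; positivity, ?_⟩
  rw [nomeModulus, div_lt_one (by positivity)]
  nlinarith [pow_pos h4' 2]

lemma mul_div_sub_mul_div {c x y r s : ℝ} (hr : r ≠ 0) (hs : s ≠ 0) :
    c * (x / r) - c * (y / s) = c * (x * s - r * y) / (r * s) := by
  rw [← mul_sub, div_sub_div _ _ hr hs, mul_div_assoc]

/-- By the square formulas, numerators and denominators are linear in thetas of nome p² at φ and 3φ.
Every difference of two points contains the same determinant D = AB' - BA', so D, c and the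
denominators cancel and only theta constants remain. D is nonzero because it equals -ϑ₁(2φ)ϑ₁(φ). -/
lemma pairInvariant_theta {p c : ℝ} (hp : p ∈ Ioo (0 : ℝ) 1) (hc : c ≠ 0) {φ : ℝ}
    (h1 : th1 p (3 * φ / 2) ≠ 0) (h2 : th2 p (3 * φ / 2) ≠ 0) (h3 : th1 p φ ≠ 0)
    (h4 : th1 p (2 * φ) ≠ 0) :
    pairInvariant (c * (th1 p (φ / 2) ^ 2 / th1 p (3 * φ / 2) ^ 2))
        (c * (th2 p (φ / 2) ^ 2 / th2 p (3 * φ / 2) ^ 2))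
        (c * (th4 p (φ / 2) ^ 2 / th4 p (3 * φ / 2) ^ 2))
        (c * (th3 p (φ / 2) ^ 2 / th3 p (3 * φ / 2) ^ 2)) =
      (4 * nomeModulus p / (1 - nomeModulus p ^ 2)) ^ 2 ∧
    c * (th1 p (φ / 2) ^ 2 / th1 p (3 * φ / 2) ^ 2)
      ≠ c * (th2 p (φ / 2) ^ 2 / th2 p (3 * φ / 2) ^ 2) ∧
    c * (th4 p (φ / 2) ^ 2 / th4 p (3 * φ / 2) ^ 2)
      ≠ c * (th3 p (φ / 2) ^ 2 / th3 p (3 * φ / 2) ^ 2) := by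
  have hp' : p ∈ Ico (0 : ℝ) 1 := ⟨hp.1.le, hp.2⟩
  have hpi := Real.pi_pos
  have h5 := (th3_pos hp' (3 * φ / 2)).ne'
  have h6 := (th4_pos hp' (3 * φ / 2)).ne'
  have a0 := (th3_pos (sq_mem_Ico hp') 0)
  have b0 := (th2_pos (sq_mem_Ico hp') (x := 0) ⟨by linarith, by linarith⟩)
  have hd : th1 p (2 * φ) * -th1 p φ = th3 (p ^ 2) φ * th2 (p ^ 2) (3 * φ)
      - th2 (p ^ 2) φ * th3 (p ^ 2) (3 * φ) := by
    have := th1_add_mul_sub hp' (φ / 2) (3 * φ / 2)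
    rw [show φ / 2 + 3 * φ / 2 = 2 * φ by ring, show φ / 2 - 3 * φ / 2 = -φ by ring, th1_neg,
      show 2 * (φ / 2) = φ by ring, show 2 * (3 * φ / 2) = 3 * φ by ring] at this
    exact this
  have hd0 : th3 (p ^ 2) φ * th2 (p ^ 2) (3 * φ) - th2 (p ^ 2) φ * th3 (p ^ 2) (3 * φ) ≠ 0 := by
    rw [← hd]
    exact mul_ne_zero h4 (neg_ne_zero.2 h3)
  have hm := nomeModulus_mem hp
  have hm1 : p * th2 (p ^ 2) 0 ^ 2 = nomeModulus p * th3 (p ^ 2) 0 ^ 2 := by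
    rw [nomeModulus, div_mul_cancel₀ _ (pow_pos a0 2).ne']
  have q1 := pow_ne_zero 2 h1
  have q2 := pow_ne_zero 2 h2
  have q3 := pow_ne_zero 2 h5
  have q4 := pow_ne_zero 2 h6
  rw [th1_sq hp', show 2 * (3 * φ / 2) = 3 * φ by ring] at q1
  rw [th2_sq hp', show 2 * (3 * φ / 2) = 3 * φ by ring] at q2
  rw [th3_sq hp', show 2 * (3 * φ / 2) = 3 * φ by ring] at q3
  rw [th4_sq hp', show 2 * (3 * φ / 2) = 3 * φ by ring] at q4
  simp only [th1_sq hp', th2_sq hp', th3_sq hp', th4_sq hp', show 2 * (φ / 2) = φ by ring,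
    show 2 * (3 * φ / 2) = 3 * φ by ring]
  have hp0 := hp.1
  generalize th3 (p ^ 2) φ = A at *
  generalize th2 (p ^ 2) φ = B at *
  generalize th3 (p ^ 2) (3 * φ) = A' at *
  generalize th2 (p ^ 2) (3 * φ) = B' at *
  generalize th3 (p ^ 2) 0 = α at *
  generalize th2 (p ^ 2) 0 = β at *
  generalize nomeModulus p = m at *
  have d12 : c * ((A * β - B * α) / (A' * β - B' * α)) - c * ((A * β + B * α) / (A' * β + B' * α))
      = c * (2 * α * β * (A * B' - B * A')) / ((A' * β - B' * α) * (A' * β + B' * α)) := by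
    rw [mul_div_sub_mul_div q1 q2]
    congr 1
    ring
  have d34 : c * ((A * α - p * (B * β)) / (A' * α - p * (B' * β)))
      - c * ((A * α + p * (B * β)) / (A' * α + p * (B' * β)))
      = c * (2 * p * α * β * (A * B' - B * A')) /
        ((A' * α - p * (B' * β)) * (A' * α + p * (B' * β))) := by
    rw [mul_div_sub_mul_div q4 q3]
    congr 1
    ring
  have d13 : c * ((A * β - B * α) / (A' * β - B' * α))
      - c * ((A * α - p * (B * β)) / (A' * α - p * (B' * β)))
      = c * ((1 - m) * α ^ 2 * (A * B' - B * A')) /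
        ((A' * β - B' * α) * (A' * α - p * (B' * β))) := by
    have : (1 - m) * α ^ 2 = α ^ 2 - p * β ^ 2 := by rw [hm1]; ring
    rw [this]
    rw [mul_div_sub_mul_div q1 q4]
    congr 1
    ring
  have d14 : c * ((A * β - B * α) / (A' * β - B' * α))
      - c * ((A * α + p * (B * β)) / (A' * α + p * (B' * β)))
      = c * ((1 + m) * α ^ 2 * (A * B' - B * A')) /
        ((A' * β - B' * α) * (A' * α + p * (B' * β))) := by
    have : (1 + m) * α ^ 2 = α ^ 2 + p * β ^ 2 := by rw [hm1]; ring
    rw [this]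
    rw [mul_div_sub_mul_div q1 q3]
    congr 1
    ring
  have d23 : c * ((A * β + B * α) / (A' * β + B' * α))
      - c * ((A * α - p * (B * β)) / (A' * α - p * (B' * β)))
      = -(c * ((1 + m) * α ^ 2 * (A * B' - B * A'))) /
        ((A' * β + B' * α) * (A' * α - p * (B' * β))) := by
    have : (1 + m) * α ^ 2 = α ^ 2 + p * β ^ 2 := by rw [hm1]; ring
    rw [this]
    rw [mul_div_sub_mul_div q2 q4]
    congr 1
    ring
  have d24 : c * ((A * β + B * α) / (A' * β + B' * α))
      - c * ((A * α + p * (B * β)) / (A' * α + p * (B' * β)))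
      = -(c * ((1 - m) * α ^ 2 * (A * B' - B * A'))) /
        ((A' * β + B' * α) * (A' * α + p * (B' * β))) := by
    have : (1 - m) * α ^ 2 = α ^ 2 - p * β ^ 2 := by rw [hm1]; ring
    rw [this]
    rw [mul_div_sub_mul_div q2 q3]
    congr 1
    ring
  have hm1' : 1 - m ≠ 0 := by linarith [hm.2]
  have hm2' : 1 + m ≠ 0 := by linarith [hm.1]
  refine ⟨?_, ?_, ?_⟩
  · rw [pairInvariant, d12, d34, d13, d14, d23, d24,
      show 1 - m ^ 2 = (1 - m) * (1 + m) by ring]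
    generalize A * B' - B * A' = D at *
    generalize A' * β - B' * α = r1 at *
    generalize A' * β + B' * α = r2 at *
    generalize A' * α - p * (B' * β) = r3 at *
    generalize A' * α + p * (B' * β) = r4 at *
    have hpm : p = m * α ^ 2 / β ^ 2 := by
      rw [← hm1, mul_div_cancel_right₀ _ (pow_pos b0 2).ne']
    rw [hpm]
    have := a0.ne'
    have := b0.ne'
    field_simp
    ring
  · rw [← sub_ne_zero, d12]
    have := a0.ne'
    have := b0.ne'
    positivity
  · rw [← sub_ne_zero, d34]
    have := a0.ne'
    have := b0.ne'
    have := hp0.ne'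
    positivity

/-- Landen's transformation of the modulus, from the square formulas at argument 0. -/
lemma nomeModulus_sq {p : ℝ} (hp : p ∈ Ioo (0 : ℝ) 1) :
    nomeModulus p ^ 2 * (1 + nomeModulus (p ^ 2)) ^ 2 = 4 * nomeModulus (p ^ 2) := by
  have hp' : p ∈ Ico (0 : ℝ) 1 := ⟨hp.1.le, hp.2⟩
  have hq := sq_mem_Ico hp'
  have h2 := th2_sq hq 0
  have h3 := th3_sq hq 0
  rw [mul_zero] at h2 h3
  have a0 := th3_pos (sq_mem_Ico hq) 0
  have a1 := th3_pos hq 0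
  have hb : 0 < th3 ((p ^ 2) ^ 2) 0 * th3 ((p ^ 2) ^ 2) 0
      + p ^ 2 * (th2 ((p ^ 2) ^ 2) 0 * th2 ((p ^ 2) ^ 2) 0) := by
    rw [← h3]
    positivity
  unfold nomeModulus
  rw [div_pow, mul_pow, h2, h3]
  generalize th3 ((p ^ 2) ^ 2) 0 = A at *
  generalize th2 ((p ^ 2) ^ 2) 0 = B at *
  have hb' : 1 + p ^ 2 * B ^ 2 / A ^ 2 = (A * A + p ^ 2 * (B * B)) / A ^ 2 := by
    have := a0.ne'
    field_simp
  rw [hb', div_pow, div_mul_div_comm, ← mul_div_assoc, div_eq_div_iff (by positivity) (by positivity)]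
  ring

lemma tendsto_nomeModulus_div {u : ℕ → ℝ} (hu : Tendsto u atTop (𝓝 0))
    (hu0 : ∀ n, u n ∈ Ioo (0 : ℝ) 1) :
    Tendsto (fun n => nomeModulus (u n) / u n) atTop (𝓝 4) := by
  have h0 : (0 : ℝ) ∈ Ico (0 : ℝ) 1 := ⟨le_rfl, one_pos⟩
  have hu' : Tendsto (fun n => u n ^ 2) atTop (𝓝[Ico 0 1] 0) := by
    refine tendsto_nhdsWithin_iff.2 ⟨?_, Eventually.of_forall fun n =>
      sq_mem_Ico ⟨(hu0 n).1.le, (hu0 n).2⟩⟩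
    have := hu.pow 2
    rwa [zero_pow two_ne_zero] at this
  have c2 : Tendsto (fun n => th2 (u n ^ 2) 0) atTop (𝓝 (th2 0 0)) :=
    ((continuousOn_th_comp continuousOn_th1 continuousOn_const) 0 h0).tendsto.comp hu'
  have c3 : Tendsto (fun n => th3 (u n ^ 2) 0) atTop (𝓝 (th3 0 0)) :=
    ((continuousOn_th_comp continuousOn_th3 continuousOn_const) 0 h0).tendsto.comp hu'
  have := (c2.pow 2).div (c3.pow 2) (by rw [th3_nome_zero]; norm_num)
  rw [th2_nome_zero, th3_nome_zero, Real.cos_zero] at this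
  norm_num at this
  refine this.congr (fun n => ?_)
  have := (hu0 n).1.ne'
  rw [nomeModulus, Pi.div_apply, mul_div_assoc, mul_div_cancel_left₀ _ this]

/-- Equal moduli at p and r stay equal at p² and r², because x/(1 + x)² is injective on (0, 1), and
so at all p^(2^n) and r^(2^n). As the modulus is asymptotic to 4 times the nome near 0, (p/r)^(2^n)
would have to tend to 1, whereas it tends to 0 for p < r. -/
theorem nomeModulus_injOn : InjOn nomeModulus (Ioo 0 1) := by
  have key : ∀ p ∈ Ioo (0 : ℝ) 1, ∀ r ∈ Ioo (0 : ℝ) 1, p < r → nomeModulus p ≠ nomeModulus r := by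
    intro p hp r hr hpr heq
    have hsqm : ∀ x ∈ Ioo (0 : ℝ) 1, x ^ 2 ∈ Ioo (0 : ℝ) 1 := fun x hx =>
      ⟨pow_pos hx.1 2, pow_lt_one₀ hx.1.le hx.2 two_ne_zero⟩
    have step : ∀ p ∈ Ioo (0 : ℝ) 1, ∀ r ∈ Ioo (0 : ℝ) 1, nomeModulus p = nomeModulus r →
        nomeModulus (p ^ 2) = nomeModulus (r ^ 2) := by
      intro p hp r hr h
      have h1 := nomeModulus_sq hp
      have h2 := nomeModulus_sq hr
      have m1 := nomeModulus_mem (hsqm p hp)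
      have m2 := nomeModulus_mem (hsqm r hr)
      rw [h] at h1
      set x := nomeModulus (p ^ 2)
      set y := nomeModulus (r ^ 2)
      have hm := nomeModulus_mem hr
      have : nomeModulus r ^ 2 * ((x - y) * (1 - x * y)) = 0 := by
        linear_combination x * h2 - y * h1
      have hxy : 1 - x * y ≠ 0 := by
        have : x * y < 1 := mul_lt_one_of_nonneg_of_lt_one_left m1.1.le m1.2 m2.2.le
        linarith
      have hr0 : nomeModulus r ^ 2 ≠ 0 := (pow_pos hm.1 2).ne'
      have := (mul_eq_zero.1 ((mul_eq_zero.1 this).resolve_left hr0)).resolve_right hxy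
      linarith
    have hmem : ∀ x ∈ Ioo (0 : ℝ) 1, ∀ n : ℕ, x ^ (2 ^ n) ∈ Ioo (0 : ℝ) 1 := fun x hx n =>
      ⟨pow_pos hx.1 _, pow_lt_one₀ hx.1.le hx.2 (by positivity)⟩
    have hall : ∀ n : ℕ, nomeModulus (p ^ (2 ^ n)) = nomeModulus (r ^ (2 ^ n)) := by
      intro n
      induction n with
      | zero => simpa using heq
      | succ n ih =>
        have := step _ (hmem p hp n) _ (hmem r hr n) ih
        rwa [← pow_mul, ← pow_mul, ← pow_succ] at this
    have h2n : Tendsto (fun n : ℕ => (2 : ℕ) ^ n) atTop atTop :=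
      tendsto_pow_atTop_atTop_of_one_lt one_lt_two
    have hlim : ∀ x : ℝ, 0 < x → x < 1 → Tendsto (fun n : ℕ => x ^ (2 ^ n)) atTop (𝓝 0) :=
      fun x h0 h1 => (tendsto_pow_atTop_nhds_zero_of_lt_one h0.le h1).comp h2n
    have t1 := tendsto_nomeModulus_div (hlim p hp.1 hp.2) (hmem p hp)
    have t2 := tendsto_nomeModulus_div (hlim r hr.1 hr.2) (hmem r hr)
    have t3 := hlim (p / r) (div_pos hp.1 hr.1) ((div_lt_one hr.1).2 hpr)
    have t4 := t1.mul t3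
    rw [mul_zero] at t4
    have : (fun n : ℕ => nomeModulus (p ^ (2 ^ n)) / p ^ (2 ^ n) * (p / r) ^ (2 ^ n))
        = fun n : ℕ => nomeModulus (r ^ (2 ^ n)) / r ^ (2 ^ n) := by
      funext n
      have := (hmem p hp n).1.ne'
      rw [hall n, div_pow, div_mul_div_cancel₀ this]
    rw [this] at t4
    have := tendsto_nhds_unique t2 t4
    norm_num at this
  intro p hp r hr h
  rcases lt_trichotomy p r with hlt | heq | hgt
  · exact absurd h (key p hp r hr hlt)
  · exact heq
  · exact absurd h.symm (key r hr p hp hgt)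

lemma theta_branches {a p v : ℝ} (ha : 0 < a) (hp : p ∈ Ioo (0 : ℝ) 1)
    (h1 : IsStepCurve (th1 p) a (thetaScale a p) (thetaAngle a p) v)
    (h4 : IsStepCurve (th4 p) a (thetaScale a p) (thetaAngle a p) v) :
    ∃ e₁ e₂ e₃ e₄, IsBranch a v (-1) e₁ ∧ IsBranch a v (-1) e₂ ∧ IsBranch a v 1 e₃ ∧
      IsBranch a v 1 e₄ ∧ e₁ ≠ e₂ ∧ e₃ ≠ e₄ ∧
      pairInvariant e₁ e₂ e₃ e₄ = (4 * nomeModulus p / (1 - nomeModulus p ^ 2)) ^ 2 := by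
  have hp' : p ∈ Ico (0 : ℝ) 1 := ⟨hp.1.le, hp.2⟩
  have hpi := Real.pi_pos
  obtain ⟨⟨g1, g2⟩, -⟩ := thetaAngle_spec ha hp'
  obtain ⟨b1, b2, -, -⟩ := th1_thetaAngle_pos ha hp'
  have hc := thetaScale_pos ha hp'
  have h2 : IsStepCurve (th2 p) a (thetaScale a p) (thetaAngle a p) v := h1.shift _
  have h3 : IsStepCurve (th3 p) a (thetaScale a p) (thetaAngle a p) v := by
    have := h4.shift (Real.pi / 2)
    simp only [th4_add_pi_div_two] at this
    exact this
  set φ := thetaAngle a p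
  set c := thetaScale a p
  have t11 : 0 < th1 p (φ / 2) := th1_pos hp' ⟨by linarith, by linarith⟩
  have t13 : 0 < th1 p (3 * φ / 2) := th1_pos hp' ⟨by linarith, by linarith⟩
  have t15 : 0 < th1 p (5 * φ / 2) := th1_pos hp' ⟨by linarith, by linarith⟩
  have t21 : 0 < th2 p (φ / 2) := th2_pos hp' ⟨by linarith, by linarith⟩
  have t23 : 0 < th2 p (3 * φ / 2) := th2_pos hp' ⟨by linarith, by linarith⟩
  have t25 : th2 p (5 * φ / 2) < 0 := by
    rw [← neg_pos, ← th2_neg, ← th2_add_pi]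
    exact th2_pos hp' ⟨by linarith, by linarith⟩
  have t3 := fun x => th3_pos hp' x
  have t4 := fun x => th4_pos hp' x
  obtain ⟨i1, i2, i3⟩ := pairInvariant_theta hp hc.ne' t13.ne' t23.ne' b1.ne' b2.ne'
  obtain ⟨k1, k1'⟩ := h1.branch hc.ne' (by norm_num : (-1 : ℝ) ^ 2 = 1)
    (fun x => by rw [th1_neg]; ring) t11.ne' t13.ne' t15.ne'
  obtain ⟨k2, k2'⟩ := h2.branch hc.ne' (by norm_num : (1 : ℝ) ^ 2 = 1)
    (fun x => by rw [th2_neg]; ring) t21.ne' t23.ne' t25.ne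
  obtain ⟨k3, k3'⟩ := h3.branch hc.ne' (by norm_num : (1 : ℝ) ^ 2 = 1)
    (fun x => by rw [th3_neg]; ring) (t3 _).ne' (t3 _).ne' (t3 _).ne'
  obtain ⟨k4, k4'⟩ := h4.branch hc.ne' (by norm_num : (1 : ℝ) ^ 2 = 1)
    (fun x => by rw [th4_neg]; ring) (t4 _).ne' (t4 _).ne' (t4 _).ne'
  refine ⟨_, _, _, _, isBranch_of_eq k1 k1' ?_ ?_, isBranch_of_eq k2 k2' ?_ ?_,
    isBranch_of_eq k4 k4' ?_ ?_, isBranch_of_eq k3 k3' ?_ ?_, i2, i3, i1⟩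
  · positivity
  · have := mul_pos hc (div_pos t13 t15)
    linarith
  · positivity
  · have := mul_pos hc (div_pos t23 (neg_pos.2 t25))
    rw [div_neg] at this
    linarith
  · have := t4 (φ / 2)
    have := t4 (3 * φ / 2)
    positivity
  · have := mul_pos hc (div_pos (t4 (3 * φ / 2)) (t4 (5 * φ / 2)))
    linarith
  · have := t3 (φ / 2)
    have := t3 (3 * φ / 2)
    positivity
  · have := mul_pos hc (div_pos (t3 (3 * φ / 2)) (t3 (5 * φ / 2)))
    linarith

theorem nome_unique {a p r v : ℝ} (ha : 0 < a) (hp : p ∈ Ioo (0 : ℝ) 1) (hr : r ∈ Ioo (0 : ℝ) 1)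
    (h1 : IsStepCurve (th1 p) a (thetaScale a p) (thetaAngle a p) v)
    (h4 : IsStepCurve (th4 p) a (thetaScale a p) (thetaAngle a p) v)
    (g1 : IsStepCurve (th1 r) a (thetaScale a r) (thetaAngle a r) v)
    (g4 : IsStepCurve (th4 r) a (thetaScale a r) (thetaAngle a r) v) : p = r := by
  obtain ⟨e₁, e₂, e₃, e₄, b1, b2, b3, b4, b12, b34, hb⟩ := theta_branches ha hp h1 h4
  obtain ⟨f₁, f₂, f₃, f₄, d1, d2, d3, d4, d12, d34, hd⟩ := theta_branches ha hr g1 g4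
  have h := pairInvariant_eq b1 b2 b3 b4 b12 b34 d1 d2 d3 d4 d12 d34
  rw [hb, hd] at h
  have m1 := nomeModulus_mem hp
  have m2 := nomeModulus_mem hr
  refine nomeModulus_injOn hp hr ?_
  set x := nomeModulus p
  set y := nomeModulus r
  have hx : 0 < 1 - x ^ 2 := by nlinarith [m1.1, m1.2]
  have hy : 0 < 1 - y ^ 2 := by nlinarith [m2.1, m2.2]
  have h' := (pow_left_inj₀ (div_nonneg (by linarith [m1.1]) hx.le)
    (div_nonneg (by linarith [m2.1]) hy.le) two_ne_zero).1 h
  rw [div_eq_div_iff hx.ne' hy.ne'] at h'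
  -- Injectivity of m ↦ m/(1 - m²) on (0, 1).
  have : (x - y) * (1 + x * y) = 0 := by linear_combination h' / 4
  have h0 : 1 + x * y ≠ 0 := by
    have := mul_pos m1.1 m2.1
    linarith
  have := (mul_eq_zero.1 this).resolve_right h0
  linarith

/-! ### Exponential growth of excursions -/

/-- The transfer operator of the walk, tilted by `x ^ (i + j)`. -/
noncomputable def tiltedStep (a x : ℝ) (f : ℤ → ℤ → ℝ) (i j : ℤ) : ℝ :=
  x * f (i - 1) j + x⁻¹ * f (i + 1) j + x * f i (j - 1) + x⁻¹ * f i (j + 1)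
    + a * x ^ 2 * f (i - 1) (j - 1)

/-- The number of walks, tilted by `x ^ (i + j)`. -/
noncomputable def tiltedWalks (a x : ℝ) (n : ℕ) (i j : ℤ) : ℝ :=
  quadrantWalks a n i j * x ^ (i + j)

lemma tiltedStep_mono {a x : ℝ} (ha : 0 < a) (hx : 0 < x) {f g : ℤ → ℤ → ℝ}
    (h : ∀ i j, f i j ≤ g i j) (i j : ℤ) : tiltedStep a x f i j ≤ tiltedStep a x g i j := by
  unfold tiltedStep
  gcongr <;> apply h

lemma tiltedWalks_succ {a x : ℝ} (hx : 0 < x) (n : ℕ) {i j : ℤ} (hi : 0 ≤ i) (hj : 0 ≤ j) :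
    tiltedWalks a x (n + 1) i j = tiltedStep a x (tiltedWalks a x n) i j := by
  have h0 := hx.ne'
  have e1 : x ^ (i - 1 + j) = x ^ (i + j) * x⁻¹ := by
    rw [← zpow_sub_one₀ h0]; congr 1; ring
  have e2 : x ^ (i + 1 + j) = x ^ (i + j) * x := by
    rw [← zpow_add_one₀ h0]; congr 1; ring
  have e3 : x ^ (i + (j - 1)) = x ^ (i + j) * x⁻¹ := by
    rw [← zpow_sub_one₀ h0]; congr 1; ring
  have e4 : x ^ (i + (j + 1)) = x ^ (i + j) * x := by
    rw [← zpow_add_one₀ h0]; congr 1; ring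
  have e5 : x ^ (i - 1 + (j - 1)) = x ^ (i + j) * x⁻¹ * x⁻¹ := by
    rw [← zpow_sub_one₀ h0, ← zpow_sub_one₀ h0]; congr 1; ring
  simp only [tiltedStep, tiltedWalks, e1, e2, e3, e4, e5]
  rw [quadrantWalks, if_pos ⟨hi, hj⟩]
  field_simp

lemma quadrantWalks_succ (a : ℝ) (n : ℕ) {i j : ℤ} (hi : 0 ≤ i) (hj : 0 ≤ j) :
    quadrantWalks a (n + 1) i j = quadrantWalks a n (i - 1) j + quadrantWalks a n (i + 1) j
      + quadrantWalks a n i (j - 1) + quadrantWalks a n i (j + 1)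
      + a * quadrantWalks a n (i - 1) (j - 1) := by
  rw [quadrantWalks, if_pos ⟨hi, hj⟩]

lemma quadrantWalks_nonneg {a : ℝ} (ha : 0 < a) (n : ℕ) (i j : ℤ) :
    0 ≤ quadrantWalks a n i j := by
  induction n generalizing i j with
  | zero =>
    rw [quadrantWalks]
    split_ifs <;> norm_num
  | succ n ih =>
    rw [quadrantWalks]
    split_ifs
    · have := ih (i - 1) j
      have := ih (i + 1) j
      have := ih i (j - 1)
      have := ih i (j + 1)
      have := ih (i - 1) (j - 1)
      positivity
    · exact le_rfl

lemma tiltedWalks_nonneg {a x : ℝ} (ha : 0 < a) (hx : 0 < x) (n : ℕ) (i j : ℤ) :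
    0 ≤ tiltedWalks a x n i j :=
  mul_nonneg (quadrantWalks_nonneg ha n i j) (zpow_pos hx _).le

/-- The tilted operator multiplies constants by S(x, x). -/
lemma tiltedWalks_le {a x : ℝ} (ha : 0 < a) (hx : 0 < x) (n : ℕ) (i j : ℤ) :
    tiltedWalks a x n i j ≤ (2 * x + 2 / x + a * x ^ 2) ^ n := by
  have hv : 0 < 2 * x + 2 / x + a * x ^ 2 := by positivity
  induction n generalizing i j with
  | zero =>
    rw [tiltedWalks, quadrantWalks]
    split_ifs with h
    · rw [h.1, h.2]; simp
    · simp
  | succ n ih =>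
    by_cases h : 0 ≤ i ∧ 0 ≤ j
    · rw [tiltedWalks_succ hx n h.1 h.2]
      refine (tiltedStep_mono ha hx (g := fun _ _ => _) ih i j).trans (le_of_eq ?_)
      rw [tiltedStep, pow_succ, div_eq_mul_inv]
      ring
    · rw [tiltedWalks, quadrantWalks, if_neg h, zero_mul]
      positivity

lemma quadrantWalks_zero_le {a x : ℝ} (ha : 0 < a) (hx : 0 < x) (n : ℕ) :
    quadrantWalks a n 0 0 ≤ (2 * x + 2 / x + a * x ^ 2) ^ n := by
  have := tiltedWalks_le ha hx n 0 0
  simpa [tiltedWalks] using this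

lemma quadrantWalks_succ_left {a : ℝ} (ha : 0 < a) (n : ℕ) {i j : ℤ} (hi : 0 ≤ i) (hj : 0 ≤ j) :
    quadrantWalks a n (i + 1) j ≤ quadrantWalks a (n + 1) i j := by
  have h := fun k l => quadrantWalks_nonneg ha n k l
  rw [quadrantWalks_succ a n hi hj]
  have := mul_nonneg ha.le (h (i - 1) (j - 1))
  linarith [h (i - 1) j, h i (j - 1), h i (j + 1)]

lemma quadrantWalks_succ_down {a : ℝ} (ha : 0 < a) (n : ℕ) {i j : ℤ} (hi : 0 ≤ i) (hj : 0 ≤ j) :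
    quadrantWalks a n i (j + 1) ≤ quadrantWalks a (n + 1) i j := by
  have h := fun k l => quadrantWalks_nonneg ha n k l
  rw [quadrantWalks_succ a n hi hj]
  have := mul_nonneg ha.le (h (i - 1) (j - 1))
  linarith [h (i - 1) j, h i (j - 1), h (i + 1) j]

lemma quadrantWalks_le_return {a : ℝ} (ha : 0 < a) (n i j : ℕ) :
    quadrantWalks a n i j ≤ quadrantWalks a (n + i + j) 0 0 := by
  have h1 : ∀ i : ℕ, ∀ n : ℕ, quadrantWalks a n i j ≤ quadrantWalks a (n + i) 0 j := by
    intro i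
    induction i with
    | zero => intro n; simp
    | succ i ih =>
      intro n
      have := (quadrantWalks_succ_left ha n (i := i) (j := j) (by positivity) (by positivity)).trans
        (ih (n + 1))
      rw [show n + 1 + i = n + (i + 1) by ring] at this
      exact_mod_cast this
  have h2 : ∀ j : ℕ, ∀ n : ℕ, quadrantWalks a n 0 j ≤ quadrantWalks a (n + j) 0 0 := by
    intro j
    induction j with
    | zero => intro n; simp
    | succ j ih =>
      intro n
      have := (quadrantWalks_succ_down ha n (i := 0) (j := j) le_rfl (by positivity)).trans
        (ih (n + 1))
      rw [show n + 1 + j = n + (j + 1) by ring] at this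
      exact_mod_cast this
  exact (h1 i n).trans (h2 j _)

lemma one_le_quadrantWalks {a : ℝ} (ha : 0 < a) (i j : ℕ) :
    1 ≤ quadrantWalks a (i + j) i j := by
  induction i with
  | zero =>
    induction j with
    | zero => simp [quadrantWalks]
    | succ j ih =>
      refine ih.trans ?_
      have h := fun k l => quadrantWalks_nonneg ha (0 + j) k l
      rw [← add_assoc, quadrantWalks_succ a (0 + j) (by positivity) (by positivity)]
      have e : ((j + 1 : ℕ) : ℤ) - 1 = j := by push_cast; ring
      simp only [e]
      have := mul_nonneg ha.le (h (((0 : ℕ) : ℤ) - 1) j)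
      linarith [h (((0 : ℕ) : ℤ) - 1) (j + 1 : ℕ), h (((0 : ℕ) : ℤ) + 1) (j + 1 : ℕ),
        h ((0 : ℕ) : ℤ) (((j + 1 : ℕ) : ℤ) + 1)]
  | succ i ih =>
    refine ih.trans ?_
    have h := fun k l => quadrantWalks_nonneg ha (i + j) k l
    rw [show i + 1 + j = i + j + 1 by ring, quadrantWalks_succ a (i + j) (by positivity) (by positivity)]
    have e : ((i + 1 : ℕ) : ℤ) - 1 = i := by push_cast; ring
    simp only [e]
    have := mul_nonneg ha.le (h (i : ℤ) ((j : ℤ) - 1))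
    linarith [h (((i + 1 : ℕ) : ℤ) + 1) j, h ((i + 1 : ℕ) : ℤ) ((j : ℤ) - 1),
      h ((i + 1 : ℕ) : ℤ) ((j : ℤ) + 1)]

/-- A concave bump supported in a disc that touches the boundary of the quadrant. -/
noncomputable def discBump (R : ℕ) (i j : ℤ) : ℝ :=
  max ((R : ℝ) ^ 2 - ((i : ℝ) - R) ^ 2 - ((j : ℝ) - R) ^ 2) 0

lemma discBump_nonneg (R : ℕ) (i j : ℤ) : 0 ≤ discBump R i j := le_max_right _ _

/-- For large discs the bump is an approximate eigenfunction from below of the driftless tilted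
step operator. -/
lemma exists_discBump_le {a x l : ℝ} (ha : 0 < a) (hx : 0 < x) (h0 : a * x ^ 3 + x ^ 2 = 1)
    (hl0 : 0 < l) (hl : l < 2 * x + 2 / x + a * x ^ 2) :
    ∃ R : ℕ, 0 < R ∧ ∀ i j, 0 < discBump R i j →
      l * discBump R i j ≤ tiltedStep a x (discBump R) i j := by
  set v := 2 * x + 2 / x + a * x ^ 2 with hv
  set K := 2 * x + 2 / x + 2 * a * x ^ 2 with hK
  have hK0 : 0 < K := by positivity
  -- Without drift, the step operator sends the quadratic G to vG - K, where K is the weighted sum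
  -- of squared step lengths. This is at least lG exactly when G ≥ B.
  set B := K / (v - l) with hB
  have hB0 : 0 < B := div_pos hK0 (by linarith)
  have hx1 : x ≤ x⁻¹ := by
    rw [le_inv_comm₀ hx hx, ← one_div, le_div_iff₀ hx]
    nlinarith [pow_pos hx 3]
  obtain ⟨R, hR⟩ := exists_nat_gt (B + l * B / x + 2)
  have hlB : 0 < l * B / x := by positivity
  have hR2 : (2 : ℝ) < R := by linarith
  refine ⟨R, by exact_mod_cast (by linarith : (0 : ℝ) < R), fun i j hij => ?_⟩
  set G : ℝ → ℝ → ℝ := fun s t => (R : ℝ) ^ 2 - (s - R) ^ 2 - (t - R) ^ 2 with hG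
  have hF : ∀ i j : ℤ, G i j ≤ discBump R i j := fun i j => le_max_left _ _
  have hFG : discBump R i j = G i j := by
    refine max_eq_left (le_of_lt ?_)
    by_contra! hle
    rw [discBump, max_eq_right hle] at hij
    exact lt_irrefl _ hij
  rw [hFG] at hij ⊢
  have hn := fun i j => discBump_nonneg R i j
  rcases le_or_gt B (G i j) with hbig | hsmall
  · have h1 : tiltedStep a x (fun i j => G i j) i j = v * G i j - K := by
      have h3 : x⁻¹ = x + a * x ^ 2 := by
        rw [inv_eq_one_div, div_eq_iff hx.ne']
        linarith
      have h3' : 2 / x = 2 * (x + a * x ^ 2) := by rw [← h3]; ring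
      simp only [tiltedStep, hG, hv, hK, h3, h3']
      push_cast
      ring
    have h2 := tiltedStep_mono ha hx hF i j
    rw [h1] at h2
    have h4 : K ≤ (v - l) * G i j := by
      rw [hB, div_le_iff₀ (by linarith)] at hbig
      linarith
    linarith
  -- In the thin ring 0 < G < B, a step towards the centre in the larger coordinate raises G by
  -- about R. That neighbour, with weight at least x, already outweighs lB.
  · have hbig : ((R : ℝ) - 1) ≤ G (i - 1) j ∨ ((R : ℝ) - 1) ≤ G (i + 1) j ∨
        ((R : ℝ) - 1) ≤ G i (j - 1) ∨ ((R : ℝ) - 1) ≤ G i (j + 1) := by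
      by_contra! hcon
      obtain ⟨c1, c2, c3, c4⟩ := hcon
      simp only [hG] at c1 c2 c3 c4 hij hsmall
      have hBR : B < R := by linarith
      nlinarith [sq_nonneg ((i : ℝ) - R), sq_nonneg ((j : ℝ) - R), abs_nonneg ((i : ℝ) - R),
        abs_nonneg ((j : ℝ) - R)]
    have hlow : l * G i j ≤ x * ((R : ℝ) - 1) := by
      have : l * B / x ≤ R - 1 := by linarith
      rw [div_le_iff₀ hx] at this
      nlinarith
    have hpos : 0 ≤ a * x ^ 2 * discBump R (i - 1) (j - 1) := by
      have := hn (i - 1) (j - 1)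
      positivity
    have k1 := mul_nonneg hx.le (hn (i - 1) j)
    have k2 := mul_nonneg (inv_pos.2 hx).le (hn (i + 1) j)
    have k3 := mul_nonneg hx.le (hn i (j - 1))
    have k4 := mul_nonneg (inv_pos.2 hx).le (hn i (j + 1))
    refine hlow.trans ?_
    rw [tiltedStep]
    have hR1 : (0 : ℝ) ≤ R - 1 := by linarith
    rcases hbig with h | h | h | h
    · have := hF (i - 1) j
      push_cast at this
      have := mul_le_mul_of_nonneg_left (h.trans this) hx.le
      linarith
    · have := hF (i + 1) j
      push_cast at this
      have := mul_le_mul hx1 (h.trans this) hR1 (inv_pos.2 hx).le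
      linarith
    · have := hF i (j - 1)
      push_cast at this
      have := mul_le_mul_of_nonneg_left (h.trans this) hx.le
      linarith
    · have := hF i (j + 1)
      push_cast at this
      have := mul_le_mul hx1 (h.trans this) hR1 (inv_pos.2 hx).le
      linarith

/-- The bump is supported in the open quadrant. -/
lemma discBump_support {R : ℕ} {i j : ℤ} (h : 0 < discBump R i j) :
    (0 ≤ i ∧ i ≤ 2 * R) ∧ (0 ≤ j ∧ j ≤ 2 * R) := by
  rw [discBump, lt_max_iff] at h
  have h := h.resolve_right (lt_irrefl _)
  have hR : (0 : ℝ) ≤ R := by positivity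
  have h1 := abs_lt_of_sq_lt_sq (by nlinarith [sq_nonneg ((j : ℝ) - R)] :
    ((i : ℝ) - R) ^ 2 < (R : ℝ) ^ 2) hR
  have h2 := abs_lt_of_sq_lt_sq (by nlinarith [sq_nonneg ((i : ℝ) - R)] :
    ((j : ℝ) - R) ^ 2 < (R : ℝ) ^ 2) hR
  rw [abs_lt] at h1 h2
  refine ⟨⟨?_, ?_⟩, ?_, ?_⟩
  · exact_mod_cast (by linarith : (0 : ℝ) ≤ i)
  · exact_mod_cast (by linarith : (i : ℝ) ≤ 2 * R)
  · exact_mod_cast (by linarith : (0 : ℝ) ≤ j)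
  · exact_mod_cast (by linarith : (j : ℝ) ≤ 2 * R)

/-- The exponential growth of the excursions is not smaller than the minimum of the step
polynomial on the diagonal. -/
theorem exists_le_sum_quadrantWalks {a x l : ℝ} (ha : 0 < a) (hx : 0 < x)
    (h0 : a * x ^ 3 + x ^ 2 = 1) (hl0 : 0 < l) (hl : l < 2 * x + 2 / x + a * x ^ 2) :
    ∃ δ > 0, ∃ M : ℕ, ∀ n : ℕ,
      δ * l ^ n ≤ ∑ k ∈ Finset.range M, quadrantWalks a (n + k) 0 0 := by
  obtain ⟨R, hR, hstep⟩ := exists_discBump_le ha hx h0 hl0 hl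
  have hR' : (0 : ℝ) < R := by exact_mod_cast hR
  have hx1 : x ≤ 1 := by nlinarith [pow_pos hx 3]
  -- A point (i, j) of the disc is surely reached at time i + j ≤ 4R, but not at a common time.
  -- Summing over a window of times makes the initial comparison hold on the whole disc.
  set U : ℕ → ℤ → ℤ → ℝ := fun n i j =>
    ∑ k ∈ Finset.range (4 * R + 1), tiltedWalks a x (n + k) i j with hU
  set ε : ℝ := x ^ (4 * R) / R ^ 2 with hε
  have hε0 : 0 < ε := by positivity
  have hU0 : ∀ n i j, 0 ≤ U n i j := fun n i j =>
    Finset.sum_nonneg fun k _ => tiltedWalks_nonneg ha hx _ i j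
  have hUs : ∀ n i j, 0 ≤ i → 0 ≤ j → U (n + 1) i j = tiltedStep a x (U n) i j := by
    intro n i j hi hj
    simp only [hU, tiltedStep, Finset.mul_sum, ← Finset.sum_add_distrib]
    refine Finset.sum_congr rfl fun k _ => ?_
    rw [show n + 1 + k = n + k + 1 by ring, tiltedWalks_succ hx _ hi hj, tiltedStep]
  have hmain : ∀ n i j, ε * l ^ n * discBump R i j ≤ U n i j := by
    intro n
    induction n with
    | zero =>
      intro i j
      rcases (discBump_nonneg R i j).eq_or_lt with h | h
      · rw [← h, mul_zero]
        exact hU0 _ _ _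
      · obtain ⟨⟨hi, hi'⟩, hj, hj'⟩ := discBump_support h
        lift i to ℕ using hi
        lift j to ℕ using hj
        have hij : i + j < 4 * R + 1 := by omega
        have h1 : tiltedWalks a x (0 + (i + j)) i j ≤ U 0 i j :=
          Finset.single_le_sum (f := fun k => tiltedWalks a x (0 + k) i j)
            (fun k _ => tiltedWalks_nonneg ha hx _ _ _) (Finset.mem_range.2 hij)
        have h2 : x ^ (i + j) ≤ tiltedWalks a x (0 + (i + j)) i j := by
          rw [tiltedWalks, zero_add]
          have := one_le_quadrantWalks ha i j
          have h3 : x ^ ((i : ℤ) + j) = x ^ (i + j) := by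
            rw [← zpow_natCast]
            push_cast
            rfl
          rw [h3]
          exact le_mul_of_one_le_left (by positivity) this
        have h3 : x ^ (4 * R) ≤ x ^ (i + j) := pow_le_pow_of_le_one hx.le hx1 (by omega)
        have h4 : discBump R i j ≤ R ^ 2 := by
          refine max_le ?_ (by positivity)
          nlinarith [sq_nonneg (((i : ℤ) : ℝ) - R), sq_nonneg (((j : ℤ) : ℝ) - R)]
        refine le_trans ?_ (h3.trans (h2.trans h1))
        rw [pow_zero, mul_one, hε, div_mul_eq_mul_div, div_le_iff₀ (by positivity)]
        gcongr
    | succ n ih =>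
      intro i j
      rcases (discBump_nonneg R i j).eq_or_lt with h | h
      · rw [← h, mul_zero]
        exact hU0 _ _ _
      · obtain ⟨⟨hi, hi'⟩, hj, hj'⟩ := discBump_support h
        rw [hUs n i j hi hj]
        refine le_trans ?_ (tiltedStep_mono ha hx ih i j)
        have e : tiltedStep a x (fun i j => ε * l ^ n * discBump R i j) i j
            = ε * l ^ n * tiltedStep a x (discBump R) i j := by
          simp only [tiltedStep]
          ring
        rw [e, pow_succ, ← mul_assoc ε, mul_assoc (ε * l ^ n)]
        exact mul_le_mul_of_nonneg_left (hstep i j h) (by positivity)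
  -- The additional 2R lets walks return from the centre (R, R) straight to the origin.
  refine ⟨ε * R ^ 2, by positivity, 4 * R + 1 + 2 * R, fun n => ?_⟩
  have h1 := hmain n R R
  have h2 : discBump R R R = R ^ 2 := by
    rw [discBump]
    simp only [Int.cast_natCast, sub_self]
    norm_num
  rw [h2] at h1
  have h3 : U n R R ≤ ∑ k ∈ Finset.range (4 * R + 1), quadrantWalks a (n + (k + 2 * R)) 0 0 := by
    refine Finset.sum_le_sum fun k _ => ?_
    have h4 := quadrantWalks_le_return ha (n + k) R R
    rw [show n + k + R + R = n + (k + 2 * R) by ring] at h4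
    refine le_trans ?_ h4
    rw [tiltedWalks]
    refine mul_le_of_le_one_right (quadrantWalks_nonneg ha _ _ _) ?_
    rw [← Nat.cast_add, zpow_natCast]
    exact pow_le_one₀ hx.le hx1
  have h4 : ∑ k ∈ Finset.range (4 * R + 1), quadrantWalks a (n + (k + 2 * R)) 0 0
      ≤ ∑ k ∈ Finset.range (4 * R + 1 + 2 * R), quadrantWalks a (n + k) 0 0 := by
    rw [Finset.range_eq_Ico, Finset.sum_Ico_add' (fun k => quadrantWalks a (n + k) 0 0)]
    refine Finset.sum_le_sum_of_subset_of_nonneg ?_ fun k _ _ => quadrantWalks_nonneg ha _ _ _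
    intro k hk
    simp only [Finset.mem_Ico, Finset.mem_range] at hk ⊢
    exact hk.2
  calc ε * R ^ 2 * l ^ n = ε * l ^ n * R ^ 2 := by ring
    _ ≤ _ := h1.trans (h3.trans h4)

/-! ### Pringsheim's theorem and the critical point -/

/-- Taylor expansion, at a point of the interval of convergence, of a power series with
nonnegative coefficients. -/
lemma hasSum_taylor_of_nonneg {c : ℕ → ℝ} (hc : ∀ n, 0 ≤ c n) {b y : ℝ} (hb : 0 ≤ b)
    (h : Summable fun n => c n * (b + |y|) ^ n) :
    (∀ k, y ≠ 0 → Summable fun n => c n * (b ^ (n - k) * n.choose k)) ∧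
    HasSum (fun k => y ^ k * ∑' n, c n * (b ^ (n - k) * n.choose k)) (∑' n, c n * (b + y) ^ n) := by
  have fib : ∀ (z : ℝ) n, HasSum (fun k => c n * (b ^ (n - k) * n.choose k) * z ^ k)
      (c n * (b + z) ^ n) := by
    intro z n
    have e : c n * (b + z) ^ n
        = ∑ k ∈ Finset.range (n + 1), c n * (b ^ (n - k) * n.choose k) * z ^ k := by
      rw [add_comm, add_pow, Finset.mul_sum]
      exact Finset.sum_congr rfl fun k _ => by ring
    rw [e]
    refine hasSum_sum_of_ne_finset_zero fun k hk => ?_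
    rw [Finset.mem_range, not_lt] at hk
    rw [Nat.choose_eq_zero_of_lt hk]
    simp
  have hs : Summable fun x : ℕ × ℕ => c x.1 * (b ^ (x.1 - x.2) * x.1.choose x.2) * |y| ^ x.2 := by
    rw [summable_prod_of_nonneg fun x => by have := hc x.1; positivity]
    refine ⟨fun n => (fib |y| n).summable, ?_⟩
    simpa only [(fib |y| _).tsum_eq] using h
  have hs' : Summable fun x : ℕ × ℕ => c x.1 * (b ^ (x.1 - x.2) * x.1.choose x.2) * y ^ x.2 := by
    refine Summable.of_norm (hs.congr fun x => ?_)
    have h1 : 0 ≤ c x.1 * (b ^ (x.1 - x.2) * x.1.choose x.2) := by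
      have := hc x.1
      positivity
    rw [norm_mul, norm_pow, Real.norm_eq_abs, Real.norm_eq_abs, abs_of_nonneg h1]
  have hsum := hs'.hasSum.prod_fiberwise fun n => fib y n
  have hswap := (Equiv.prodComm ℕ ℕ).hasSum_iff.2 hs'.hasSum
  have hsm := (Equiv.prodComm ℕ ℕ).summable_iff.2 hs'
  have hfin := hswap.prod_fiberwise fun k => (hsm.prod_factor k).hasSum
  refine ⟨fun k hy => ?_, ?_⟩
  · have := hsm.prod_factor k
    simp only [Function.comp, Equiv.prodComm_apply, Prod.swap_prod_mk] at this
    exact (summable_mul_right_iff (pow_ne_zero k hy)).1 this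
  · rw [hsum.tsum_eq]
    convert hfin using 2 with k
    rw [← tsum_mul_left]
    exact tsum_congr fun n => mul_comm _ _

/-- Pringsheim's theorem: a power series with nonnegative coefficients that continues analytically
along the real axis converges beyond. -/
theorem exists_sum_le_of_analyticAt {c : ℕ → ℝ} (hc : ∀ n, 0 ≤ c n) {r : ℝ} (hr : 0 < r)
    (hs : ∀ t ∈ Ico 0 r, Summable fun n => c n * t ^ n) {g : ℝ → ℝ} (hg : AnalyticAt ℝ g r)
    (hgf : ∀ t ∈ Ioo 0 r, g t = ∑' n, c n * t ^ n) :
    ∃ u > r, ∃ C, ∀ N, ∑ n ∈ Finset.range N, c n * u ^ n ≤ C := by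
  obtain ⟨p, ρ, hp⟩ := hg
  obtain ⟨ρ', hρ0, hρ⟩ : ∃ ρ' : NNReal, 0 < ρ' ∧ (ρ' : ENNReal) ≤ ρ := by
    obtain ⟨ρ', h1, h2⟩ := ENNReal.lt_iff_exists_nnreal_btwn.1 hp.r_pos
    exact ⟨ρ', by exact_mod_cast h1, h2.le⟩
  have hp := hp.mono (by exact_mod_cast hρ0) hρ
  -- The series at r is recentred at b = r - d. Its radius there is at least ρ' - d > 2d, so it
  -- still converges at b + 2d = r + d, beyond r.
  obtain ⟨d, hd0, hd1, hd2⟩ : ∃ d : ℝ, 0 < d ∧ 3 * d < ρ' ∧ d < r := by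
    have : (0 : ℝ) < ρ' := hρ0
    refine ⟨min (ρ' / 4) (r / 2), by positivity, ?_, ?_⟩
    · have := min_le_left ((ρ' : ℝ) / 4) (r / 2)
      linarith
    · have := min_le_right ((ρ' : ℝ) / 4) (r / 2)
      linarith
  set b := r - d with hb
  have hb0 : 0 < b := by linarith
  set e : ℕ → ℝ := fun k => ∑' n, c n * (b ^ (n - k) * n.choose k) with he
  have hnn : ‖-d‖₊ = d.toNNReal := by
    ext
    rw [coe_nnnorm, norm_neg, Real.norm_of_nonneg hd0.le, Real.coe_toNNReal _ hd0.le]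
  have hco := hp.changeOrigin (y := -d) (by
    rw [hnn]
    have : d.toNNReal < ρ' := by
      rw [Real.toNNReal_lt_iff_lt_coe hd0.le]
      linarith
    exact_mod_cast this)
  have hadd : r + -d = b := by rw [hb]; ring
  rw [hadd] at hco
  have hloc : HasFPowerSeriesAt g (FormalMultilinearSeries.ofScalars ℝ e) b := by
    rw [hasFPowerSeriesAt_iff]
    filter_upwards [Metric.ball_mem_nhds (0 : ℝ) (lt_min hd0 hb0)] with z hz
    rw [mem_ball_zero_iff, Real.norm_eq_abs, lt_min_iff] at hz
    have habs := abs_lt.1 hz.1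
    have habs' := abs_lt.1 hz.2
    rw [hgf (b + z) ⟨by linarith, by linarith⟩]
    simp only [FormalMultilinearSeries.coeff_ofScalars, smul_eq_mul]
    exact (hasSum_taylor_of_nonneg hc hb0.le
      (hs _ ⟨by positivity, by linarith⟩)).2
  rw [hco.hasFPowerSeriesAt.eq_formalMultilinearSeries hloc] at hco
  have hsum := hco.hasSum (y := 2 * d) (by
    rw [Metric.mem_eball, edist_zero_right, hnn, lt_tsub_iff_right, enorm_eq_nnnorm]
    have : ‖2 * d‖₊ + d.toNNReal < ρ' := by
      rw [← NNReal.coe_lt_coe, NNReal.coe_add, coe_nnnorm, Real.norm_of_nonneg (by positivity),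
        Real.coe_toNNReal _ hd0.le]
      linarith
    exact_mod_cast this)
  simp only [FormalMultilinearSeries.apply_eq_pow_smul_coeff,
    FormalMultilinearSeries.coeff_ofScalars, smul_eq_mul] at hsum
  have he0 : ∀ k, 0 ≤ e k := fun k => tsum_nonneg fun n => by have := hc n; positivity
  have hes : ∀ k, Summable fun n => c n * (b ^ (n - k) * n.choose k) := fun k =>
    (hasSum_taylor_of_nonneg hc (y := d / 2) hb0.le (hs _ ⟨by positivity, by
      rw [abs_of_pos (by positivity)]; linarith⟩)).1 k (by positivity)
  refine ⟨b + 2 * d, by linarith, g (b + 2 * d), fun N => ?_⟩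
  calc ∑ n ∈ Finset.range N, c n * (b + 2 * d) ^ n
      = ∑ n ∈ Finset.range N, ∑ k ∈ Finset.range N,
          (2 * d) ^ k * (c n * (b ^ (n - k) * n.choose k)) := by
        refine Finset.sum_congr rfl fun n hn => ?_
        rw [Finset.mem_range] at hn
        rw [add_comm, add_pow, Finset.mul_sum]
        rw [← Finset.sum_subset (Finset.range_subset_range.2 (Nat.succ_le_of_lt hn))]
        · exact Finset.sum_congr rfl fun k _ => by ring
        · intro k _ hk
          rw [Finset.mem_range, not_lt] at hk
          rw [Nat.choose_eq_zero_of_lt hk]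
          simp
    _ = ∑ k ∈ Finset.range N, (2 * d) ^ k *
          ∑ n ∈ Finset.range N, c n * (b ^ (n - k) * n.choose k) := by
        rw [Finset.sum_comm]
        simp only [Finset.mul_sum]
    _ ≤ ∑ k ∈ Finset.range N, (2 * d) ^ k * e k := by
        refine Finset.sum_le_sum fun k _ => mul_le_mul_of_nonneg_left ?_ (by positivity)
        exact (hes k).sum_le_tsum _ fun n _ => by have := hc n; positivity
    _ ≤ _ := sum_le_hasSum _ (fun k _ => mul_nonneg (by positivity) (he0 k)) hsum

lemma excursionSeries_summable {a v : ℝ} (ha : 0 < a) (hv : 0 < v)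
    (h : ∀ n, quadrantWalks a n 0 0 ≤ v ^ n) {t : ℝ} (ht : |t| < 1 / v) :
    Summable fun n => quadrantWalks a n 0 0 * t ^ n := by
  rw [lt_div_iff₀ hv] at ht
  refine Summable.of_norm_bounded (summable_geometric_of_lt_one (by positivity) ht) fun n => ?_
  rw [norm_mul, norm_pow, Real.norm_eq_abs, Real.norm_eq_abs,
    abs_of_nonneg (quadrantWalks_nonneg ha n 0 0), mul_pow, mul_comm]
  exact mul_le_mul_of_nonneg_left (h n) (by positivity)

lemma analyticOnNhd_excursionSeries {a v : ℝ} (ha : 0 < a) (hv : 0 < v)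
    (h : ∀ n, quadrantWalks a n 0 0 ≤ v ^ n) :
    AnalyticOnNhd ℝ (excursionSeries a) (Metric.ball 0 (1 / v)) := by
  have hs : HasFPowerSeriesOnBall (excursionSeries a)
      (FormalMultilinearSeries.ofScalars ℝ fun n => quadrantWalks a n 0 0) 0
      (ENNReal.ofReal (1 / v)) := by
    refine ⟨?_, by positivity, fun {y} hy => ?_⟩
    · rw [ENNReal.ofReal]
      refine FormalMultilinearSeries.le_radius_of_bound _ 1 fun n => ?_
      rw [FormalMultilinearSeries.ofScalars_norm, Real.coe_toNNReal _ (by positivity),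
        Real.norm_of_nonneg (quadrantWalks_nonneg ha n 0 0), one_div, inv_pow,
        mul_inv_le_iff₀ (by positivity), one_mul]
      exact h n
    · rw [Metric.mem_eball, edist_zero_right] at hy
      have hy' : |y| < 1 / v := by
        rw [← Real.norm_eq_abs, ← ENNReal.ofReal_lt_ofReal_iff (by positivity), ofReal_norm]
        exact hy
      simp only [FormalMultilinearSeries.apply_eq_pow_smul_coeff,
        FormalMultilinearSeries.coeff_ofScalars, smul_eq_mul, zero_add]
      have := (excursionSeries_summable ha hv h hy').hasSum
      simpa only [mul_comm, excursionSeries] using this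
  have := hs.analyticOnNhd
  rwa [Metric.eball_ofReal] at this

theorem criticalPoint_eq {a x : ℝ} (ha : 0 < a) (hx : 0 < x) (h0 : a * x ^ 3 + x ^ 2 = 1) :
    criticalPoint a = 1 / (2 * x + 2 / x + a * x ^ 2) := by
  set v := 2 * x + 2 / x + a * x ^ 2 with hv
  have hv0 : 0 < v := by positivity
  have hq := fun n => quadrantWalks_nonneg ha n 0 0
  have hle := fun n => quadrantWalks_zero_le ha hx n
  have han := analyticOnNhd_excursionSeries ha hv0 hle
  have hr : 0 < 1 / v := by positivity
  have hball : ∀ t, 0 ≤ t → t < 1 / v → t ∈ Metric.ball (0 : ℝ) (1 / v) := by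
    intro t h1 h2
    rwa [mem_ball_zero_iff, Real.norm_of_nonneg h1]
  have hmem : ∀ s > 1 / v, ¬ ∃ g : ℝ → ℝ, AnalyticOnNhd ℝ g (Icc 0 s) ∧
      g =ᶠ[𝓝 0] excursionSeries a := by
    rintro s hs ⟨g, hg, hgf⟩
    have heq : EqOn g (excursionSeries a) (Ico 0 (1 / v)) :=
      (hg.mono fun t ht => ⟨ht.1, ht.2.le.trans hs.le⟩).eqOn_of_preconnected_of_eventuallyEq
        (han.mono fun t ht => hball t ht.1 ht.2) isPreconnected_Ico ⟨le_rfl, hr⟩ hgf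
    obtain ⟨u, hu, C, hC⟩ := exists_sum_le_of_analyticAt hq hr
      (fun t ht => excursionSeries_summable ha hv0 hle (by rw [abs_of_nonneg ht.1]; exact ht.2))
      (hg _ ⟨hr.le, hs.le⟩) (fun t ht => heq ⟨ht.1.le, ht.2⟩)
    have hu0 : 0 < u := hr.trans hu
    have huv : 1 / u < v := by
      rw [gt_iff_lt, div_lt_iff₀ hv0] at hu
      rw [div_lt_iff₀ hu0]
      linarith
    -- Bounded partial sums at u > 1/v force q_n u^n to stay bounded, while the lower growth bound
    -- with l > 1/u makes (ul)^n unbounded.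
    obtain ⟨l, hl1, hl2⟩ := exists_between huv
    have hl0 : 0 < l := (one_div_pos.2 hu0).trans hl1
    obtain ⟨δ, hδ, M, hM⟩ := exists_le_sum_quadrantWalks ha hx h0 hl0 hl2
    have hlu : 1 < u * l := by
      rwa [div_lt_iff₀ hu0, mul_comm] at hl1
    set D := ∑ k ∈ Finset.range M, C / u ^ k with hD
    have hbound : ∀ n, (u * l) ^ n ≤ D / δ := by
      intro n
      rw [le_div_iff₀ hδ, mul_pow, mul_assoc, mul_comm _ δ]
      refine (mul_le_mul_of_nonneg_left (hM n) (by positivity)).trans ?_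
      rw [Finset.mul_sum]
      refine Finset.sum_le_sum fun k _ => ?_
      rw [le_div_iff₀ (by positivity)]
      have h1 := (Finset.single_le_sum
        (f := fun k => quadrantWalks a k 0 0 * u ^ k) (fun k _ => mul_nonneg (hq k) (by positivity))
        (Finset.mem_range.2 (Nat.lt_succ_self (n + k)))).trans (hC (n + k + 1))
      calc u ^ n * quadrantWalks a (n + k) 0 0 * u ^ k
          = quadrantWalks a (n + k) 0 0 * u ^ (n + k) := by ring
        _ ≤ C := h1
    obtain ⟨n, hn⟩ := pow_unbounded_of_one_lt (D / δ) hlu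
    exact absurd (hbound n) (not_le.2 hn)
  rw [criticalPoint]
  refine csInf_eq_of_forall_ge_of_forall_gt_exists_lt ⟨1 / v + 1, by positivity, hmem _ (by simp)⟩
    ?_ ?_
  · rintro s ⟨hs, hno⟩
    by_contra! hlt
    exact hno ⟨excursionSeries a, han.mono fun t ht => hball t ht.1 (ht.2.trans_lt hlt),
      EventuallyEq.rfl⟩
  · intro w hw
    obtain ⟨s, hs1, hs2⟩ := exists_between hw
    exact ⟨s, ⟨hr.trans hs1, hmem s hs1⟩, hs2⟩

/-! ### Theta parametrisations and the dual nome -/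

lemma jacobiTh_dual_ne_zero {τ : ℂ} (hτ : 0 < τ.im) {z : ℂ} (h : jacobiTh (z / τ) (-1 / τ) ≠ 0) :
    jacobiTh z τ ≠ 0 := by
  rw [jacobiTh_functional_equation z hτ]
  refine mul_ne_zero (mul_ne_zero (div_ne_zero Complex.I_ne_zero ?_) (Complex.exp_ne_zero _)) h
  have hτ0 : τ ≠ 0 := by
    rintro rfl
    simp at hτ
  rw [Complex.cpow_def_of_ne_zero (mul_ne_zero (neg_ne_zero.2 Complex.I_ne_zero) hτ0)]
  exact Complex.exp_ne_zero _

lemma neg_one_div_I_mul (s : ℝ) : -1 / (Complex.I * s) = Complex.I * ((1 / s : ℝ) : ℂ) := by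
  push_cast
  rw [neg_div, one_div, mul_inv, Complex.inv_I, neg_mul, neg_neg, one_div]

lemma I_mul_div_I_mul (g s : ℝ) : Complex.I * g / (Complex.I * s) = ((g / s : ℝ) : ℂ) := by
  rw [mul_div_mul_left _ _ Complex.I_ne_zero, Complex.ofReal_div]

/-- The dilation between the prefactors of the two dual theta parametrisations. -/
noncomputable def dualFactor (g s : ℝ) : ℂ :=
  Complex.exp (4 * (Complex.I * (Complex.I * g) ^ 2 / (Real.pi * (Complex.I * s))))

/-- The Gaussian factors at mγ and nγ differ by m² - n² units. The ratios 3:1 and 4:2 give k = 2 and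
k = 3, exactly the powers of c in the two equations, so rescaling c absorbs the factors. -/
lemma jacobiTh_ratio_dual {s : ℝ} (hs : 0 < s) (g : ℝ) (m n k : ℕ) (h : m ^ 2 = n ^ 2 + 4 * k) :
    jacobiTh (m * (Complex.I * g)) (Complex.I * s) / jacobiTh (n * (Complex.I * g)) (Complex.I * s)
        * dualFactor g s ^ k
      = ((th1 (Real.exp (-(Real.pi * (1 / s)))) (m * (g / s)) /
        th1 (Real.exp (-(Real.pi * (1 / s)))) (n * (g / s)) : ℝ) : ℂ) := by
  have hτ : 0 < (Complex.I * (s : ℂ)).im := by simpa using hs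
  have hτ0 : Complex.I * (s : ℂ) ≠ 0 := by
    intro h0
    rw [h0] at hτ
    simp at hτ
  have hK : Complex.I / (-Complex.I * (Complex.I * s)) ^ (1 / 2 : ℂ) ≠ 0 := by
    refine div_ne_zero Complex.I_ne_zero ?_
    rw [Complex.cpow_def_of_ne_zero (mul_ne_zero (neg_ne_zero.2 Complex.I_ne_zero) hτ0)]
    exact Complex.exp_ne_zero _
  have e : ∀ m : ℕ, (m : ℂ) * (Complex.I * g) / (Complex.I * s) = ((m * (g / s) : ℝ) : ℂ) := by
    intro m
    rw [mul_div_assoc, I_mul_div_I_mul]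
    push_cast
    rfl
  rw [jacobiTh_functional_equation (m * _) hτ, jacobiTh_functional_equation (n * _) hτ, e, e,
    neg_one_div_I_mul, jacobiTh_ofReal, jacobiTh_ofReal, mul_assoc, mul_assoc,
    mul_div_mul_left _ _ hK, mul_left_comm, mul_left_comm (Complex.exp _) Complex.I,
    mul_div_mul_left _ _ Complex.I_ne_zero, mul_div_mul_comm, ← Complex.ofReal_div,
    mul_div_mul_left _ _ (Real.exp_pos _).ne', mul_right_comm, ← Complex.exp_sub, dualFactor,
    ← Complex.exp_nat_mul, ← Complex.exp_add]
  have hm : (m : ℂ) ^ 2 = (n : ℂ) ^ 2 + 4 * k := by exact_mod_cast h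
  have : -(Complex.I * ((m : ℂ) * (Complex.I * g)) ^ 2 / (Real.pi * (Complex.I * s)))
      - -(Complex.I * ((n : ℂ) * (Complex.I * g)) ^ 2 / (Real.pi * (Complex.I * s)))
      + k * (4 * (Complex.I * (Complex.I * g) ^ 2 / (Real.pi * (Complex.I * s)))) = 0 := by
    rw [mul_pow (m : ℂ), hm]
    ring
  rw [this, Complex.exp_zero, one_mul]

/-- The parameters of a theta parametrisation, the dual ones and the value of the step polynomial
on the curve. -/
lemma exists_value_of_primal {a s g d : ℝ} (hs : 0 < s) (hg : 0 < g) (hgs : 2 * g < Real.pi * s)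
    {c : ℂ} (hc : c ≠ 0) (hd : c * dualFactor g s = d)
    (h3 : (a : ℂ) * c ^ 3 = -(jacobiTh (4 * (Complex.I * g)) (Complex.I * s) /
      jacobiTh (2 * (Complex.I * g)) (Complex.I * s)))
    (h2 : c ^ 2 = jacobiTh (3 * (Complex.I * g)) (Complex.I * s) /
      jacobiTh (Complex.I * g) (Complex.I * s)) :
    ∃ v : ℝ, (4 * (jacobiThDeriv (Complex.I * g) (Complex.I * s) *
        jacobiTh (2 * (Complex.I * g)) (Complex.I * s) / (jacobiThDeriv 0 (Complex.I * s) *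
        jacobiTh (Complex.I * g) (Complex.I * s)))
      - 2 * (jacobiThDeriv (2 * (Complex.I * g)) (Complex.I * s) /
        jacobiThDeriv 0 (Complex.I * s))) / c = v ∧
      d ^ 2 = th1 (Real.exp (-(Real.pi * (1 / s)))) (3 * (g / s)) /
        th1 (Real.exp (-(Real.pi * (1 / s)))) (g / s) ∧
      a * d ^ 3 = -(th1 (Real.exp (-(Real.pi * (1 / s)))) (4 * (g / s)) /
        th1 (Real.exp (-(Real.pi * (1 / s)))) (2 * (g / s))) ∧
      IsStepCurve (th1 (Real.exp (-(Real.pi * (1 / s))))) a d (g / s) v ∧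
      IsStepCurve (th4 (Real.exp (-(Real.pi * (1 / s))))) a d (g / s) v := by
  have hpi := Real.pi_pos
  have hτ : 0 < (Complex.I * (s : ℂ)).im := by simpa using hs
  have hτ0 : Complex.I * (s : ℂ) ≠ 0 := by
    intro h0
    rw [h0] at hτ
    simp at hτ
  have hE : dualFactor g s ≠ 0 := Complex.exp_ne_zero _
  have hp := exp_neg_pi_mul_mem (one_div_pos.2 hs)
  have hφ0 : 0 < g / s := div_pos hg hs
  have hφ1 : 2 * (g / s) < Real.pi := by
    rw [← mul_div_assoc, div_lt_iff₀ hs]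
    exact hgs
  have hd0 : d ≠ 0 := by
    have : (d : ℂ) ≠ 0 := hd ▸ mul_ne_zero hc hE
    exact_mod_cast this
  have r2 := jacobiTh_ratio_dual hs g 3 1 2 (by norm_num)
  have r3 := jacobiTh_ratio_dual hs g 4 2 3 (by norm_num)
  simp only [Nat.cast_ofNat, Nat.cast_one, one_mul] at r2 r3
  rw [← h2, ← mul_pow, hd] at r2
  have r3' : (a : ℂ) * (d : ℂ) ^ 3 = -((th1 (Real.exp (-(Real.pi * (1 / s)))) (4 * (g / s)) /
        th1 (Real.exp (-(Real.pi * (1 / s)))) (2 * (g / s)) : ℝ) : ℂ) := by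
    rw [← r3, ← hd, mul_pow, ← mul_assoc, h3]
    ring
  have d2 : d ^ 2 = th1 (Real.exp (-(Real.pi * (1 / s)))) (3 * (g / s)) /
        th1 (Real.exp (-(Real.pi * (1 / s)))) (g / s) := by exact_mod_cast r2
  have d3 : a * d ^ 3 = -(th1 (Real.exp (-(Real.pi * (1 / s)))) (4 * (g / s)) /
        th1 (Real.exp (-(Real.pi * (1 / s)))) (2 * (g / s))) := by exact_mod_cast r3'
  have t1 := th1_pos hp (x := g / s) ⟨hφ0, by linarith⟩
  have t2 := th1_pos hp (x := 2 * (g / s)) ⟨by linarith, hφ1⟩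
  have j1 : jacobiTh (Complex.I * g) (Complex.I * s) ≠ 0 := by
    refine jacobiTh_dual_ne_zero hτ ?_
    rw [I_mul_div_I_mul, neg_one_div_I_mul]
    exact jacobiTh_ofReal_ne_zero t1.ne'
  have j2 : jacobiTh (2 * (Complex.I * g)) (Complex.I * s) ≠ 0 := by
    refine jacobiTh_dual_ne_zero hτ ?_
    rw [mul_div_assoc, I_mul_div_I_mul, neg_one_div_I_mul]
    have := jacobiTh_ofReal_ne_zero t2.ne'
    push_cast at this ⊢
    exact this
  -- The constancy of S is proved at τ and pulled back through z = wτ, so that the dual curve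
  -- carries the same constant as the third theta equation.
  obtain ⟨v, hv, k1, k4⟩ := isStepCurve_of_complex (one_div_pos.2 hs) hd0 t1.ne' t2.ne' d2 d3
    (V := (4 * (jacobiThDeriv (Complex.I * g) (Complex.I * s) *
        jacobiTh (2 * (Complex.I * g)) (Complex.I * s) / (jacobiThDeriv 0 (Complex.I * s) *
        jacobiTh (Complex.I * g) (Complex.I * s)))
      - 2 * (jacobiThDeriv (2 * (Complex.I * g)) (Complex.I * s) /
        jacobiThDeriv 0 (Complex.I * s))) / c) (by
      intro w w0 w1 w2 w3 w4
      have key : ∀ x y : ℂ, x / (Complex.I * s) = y →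
          jacobiTh y (Complex.I * ((1 / s : ℝ) : ℂ)) ≠ 0 → jacobiTh x (Complex.I * s) ≠ 0 := by
        intro x y hxy hy
        refine jacobiTh_dual_ne_zero hτ ?_
        rw [hxy, neg_one_div_I_mul]
        exact hy
      have ew : w * (Complex.I * s) / (Complex.I * s) = w := mul_div_cancel_right₀ _ hτ0
      have hX := thetaX_scale hτ c (Complex.I * g) (w * (Complex.I * s))
      have hY := thetaX_scale hτ c (Complex.I * g) (-(w * (Complex.I * s)))
      rw [← thetaY_eq_thetaX_neg,
        show -(w * (Complex.I * s)) / (Complex.I * s) = -w by rw [neg_div, ew], ← thetaY_eq_thetaX_neg, ← dualFactor, hd,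
        I_mul_div_I_mul, neg_one_div_I_mul] at hY
      rw [ew, ← dualFactor, hd, I_mul_div_I_mul, neg_one_div_I_mul] at hX
      rw [← hX, ← hY]
      have e2 : 2 * (Complex.I * g) / (Complex.I * s) = 2 * ((g / s : ℝ) : ℂ) := by
        rw [mul_div_assoc, I_mul_div_I_mul]
      exact step_thetaX_thetaY hτ hc j1 j2 h3 h2
        (key _ _ ew w0) (key _ _ (by rw [add_div, ew, I_mul_div_I_mul]) w1)
        (key _ _ (by rw [sub_div, ew, I_mul_div_I_mul]) w2)
        (key _ _ (by rw [add_div, ew, e2]) w3) (key _ _ (by rw [sub_div, ew, e2]) w4))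
  exact ⟨v, hv, d2, d3, k1, k4⟩

/-- The two signs in the theta equations locate the dual angle. -/
lemma angle_mem_of_pos {p a d φ : ℝ} (ha : 0 < a) (hp : p ∈ Ico (0 : ℝ) 1) (hd : 0 < d)
    (h0 : 0 < φ) (h1 : 2 * φ < Real.pi) (h2 : d ^ 2 = th1 p (3 * φ) / th1 p φ)
    (h3 : a * d ^ 3 = -(th1 p (4 * φ) / th1 p (2 * φ))) :
    φ ∈ Ioo (Real.pi / 4) (Real.pi / 3) := by
  have t1 := th1_pos hp (x := φ) ⟨h0, by linarith⟩
  have t2 := th1_pos hp (x := 2 * φ) ⟨by linarith, h1⟩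
  have hnn : ∀ y, 0 ≤ y → y < Real.pi → 0 ≤ th1 p y := by
    intro y hy hy'
    rcases hy.eq_or_lt with rfl | h
    · have := th1_neg p 0
      rw [neg_zero] at this
      linarith
    · exact (th1_pos hp ⟨h, hy'⟩).le
  constructor
  · by_contra! hle
    have hnn4 : 0 ≤ th1 p (4 * φ) := by
      rcases hle.eq_or_lt with h | h
      · have := hnn (4 * φ - Real.pi) (by linarith) (by linarith)
        have e : 4 * φ - Real.pi = 0 := by linarith
        rw [th1_sub_pi] at this
        have h0' := th1_sub_pi p (4 * φ)
        rw [e] at h0'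
        have := th1_neg p 0
        rw [neg_zero] at this
        linarith
      · exact hnn _ (by linarith) (by linarith)
    have : 0 < a * d ^ 3 := by positivity
    have := div_nonneg hnn4 t2.le
    linarith
  · by_contra! hle
    have h := hnn (3 * φ - Real.pi) (by linarith) (by linarith)
    rw [th1_sub_pi] at h
    have : 0 < d ^ 2 := by positivity
    have := div_nonpos_of_nonpos_of_nonneg (by linarith : th1 p (3 * φ) ≤ 0) t1.le
    linarith

/-- For c = 0 both ϑ₁(3φ) and ϑ₁(4φ) would vanish. With 0 < φ < π/2 the first forces φ = π/3, where
the second does not vanish. -/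
lemma IsThetaParametrisation.scale_ne_zero {a t s g : ℝ} {c : ℂ} (hs : 0 < s) (hg : 0 < g)
    (hgs : 2 * g < Real.pi * s)
    (h : IsThetaParametrisation a t c (Complex.I * g) (Complex.I * s)) : c ≠ 0 := by
  rintro rfl
  have hpi := Real.pi_pos
  have hp := exp_neg_pi_mul_mem (one_div_pos.2 hs)
  have hφ0 : 0 < g / s := div_pos hg hs
  have hφ1 : 2 * (g / s) < Real.pi := by
    rw [← mul_div_assoc, div_lt_iff₀ hs]
    exact hgs
  have r2 := jacobiTh_ratio_dual hs g 3 1 2 (by norm_num)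
  have r3 := jacobiTh_ratio_dual hs g 4 2 3 (by norm_num)
  simp only [Nat.cast_ofNat, Nat.cast_one, one_mul] at r2 r3
  have h3 := h.eq_c3
  rw [← h.eq_c2] at r2
  rw [eq_comm, neg_eq_iff_eq_neg] at h3
  rw [h3] at r3
  have t1 := th1_pos hp (x := g / s) ⟨hφ0, by linarith⟩
  have t2 := th1_pos hp (x := 2 * (g / s)) ⟨by linarith, hφ1⟩
  have z3 : th1 (Real.exp (-(Real.pi * (1 / s)))) (3 * (g / s)) = 0 := by
    have : th1 (Real.exp (-(Real.pi * (1 / s)))) (3 * (g / s)) /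
        th1 (Real.exp (-(Real.pi * (1 / s)))) (g / s) = 0 := by
      rw [← Complex.ofReal_eq_zero, ← r2]
      simp
    exact (div_eq_zero_iff.1 this).resolve_right t1.ne'
  have z4 : th1 (Real.exp (-(Real.pi * (1 / s)))) (4 * (g / s)) = 0 := by
    have : th1 (Real.exp (-(Real.pi * (1 / s)))) (4 * (g / s)) /
        th1 (Real.exp (-(Real.pi * (1 / s)))) (2 * (g / s)) = 0 := by
      rw [← Complex.ofReal_eq_zero, ← r3]
      simp
    exact (div_eq_zero_iff.1 this).resolve_right t2.ne'
  rcases lt_trichotomy (3 * (g / s)) Real.pi with hlt | heq | hgt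
  · exact (th1_pos hp ⟨by positivity, hlt⟩).ne' z3
  · have := th1_pos hp (x := 4 * (g / s) - Real.pi) ⟨by linarith, by linarith⟩
    rw [th1_sub_pi, z4] at this
    linarith
  · have := th1_pos hp (x := 3 * (g / s) - Real.pi) ⟨by linarith, by linarith⟩
    rw [th1_sub_pi, z3] at this
    linarith

/-- The dual nome of a theta parametrisation solves `stepValue a p = 1 / t`. -/
theorem IsThetaParametrisation.stepValue_eq {a t : ℝ} (ha : 0 < a) (ht : 0 < t) {c γ τ : ℂ}
    (h : IsThetaParametrisation a t c γ τ) :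
    0 < τ.im ∧ τ = Complex.I * τ.im ∧
      stepValue a (Real.exp (-(Real.pi * (1 / τ.im)))) = 1 / t := by
  obtain ⟨g, rfl⟩ : ∃ g : ℝ, γ = Complex.I * g :=
    ⟨γ.im, by apply Complex.ext <;> simp [h.gamma_re]⟩
  obtain ⟨s, rfl⟩ : ∃ s : ℝ, τ = Complex.I * s :=
    ⟨τ.im, by apply Complex.ext <;> simp [h.tau_re]⟩
  have hg : 0 < g := by
    have := h.gamma_pos
    simp at this
    exact this
  have hgs : 2 * g < Real.pi * s := by
    have := h.gamma_lt
    simp at this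
    exact this
  have hs : 0 < s := by
    by_contra! hle
    have := mul_nonpos_of_nonneg_of_nonpos Real.pi_pos.le hle
    linarith
  have e : (Complex.I * (s : ℂ)).im = s := by simp
  rw [e]
  refine ⟨hs, rfl, ?_⟩
  have hc := h.scale_ne_zero hs hg hgs
  have hE : dualFactor g s ≠ 0 := Complex.exp_ne_zero _
  have hp := exp_neg_pi_mul_mem (one_div_pos.2 hs)
  -- The rescaled prefactor D is real because D² and aD³ are real and nonzero: divide the cube by
  -- the square.
  obtain ⟨d, hd⟩ : ∃ d : ℝ, c * dualFactor g s = d := by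
    have r2 := jacobiTh_ratio_dual hs g 3 1 2 (by norm_num)
    have r3 := jacobiTh_ratio_dual hs g 4 2 3 (by norm_num)
    simp only [Nat.cast_ofNat, Nat.cast_one, one_mul] at r2 r3
    rw [← h.eq_c2, ← mul_pow] at r2
    have h3 := h.eq_c3
    rw [eq_comm, neg_eq_iff_eq_neg] at h3
    rw [h3, neg_mul, mul_assoc, ← mul_pow] at r3
    have hne : c * dualFactor g s ≠ 0 := mul_ne_zero hc hE
    have haC : (a : ℂ) ≠ 0 := by exact_mod_cast ha.ne'
    generalize c * dualFactor g s = D at *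
    generalize th1 (Real.exp (-(Real.pi * (1 / s)))) (3 * (g / s)) /
      th1 (Real.exp (-(Real.pi * (1 / s)))) (g / s) = A at *
    generalize th1 (Real.exp (-(Real.pi * (1 / s)))) (4 * (g / s)) /
      th1 (Real.exp (-(Real.pi * (1 / s)))) (2 * (g / s)) = B at *
    refine ⟨-B / (a * A), ?_⟩
    push_cast
    rw [← r2, ← r3]
    field_simp
  obtain ⟨v, hv, d2, d3, k1, k4⟩ :=
    exists_value_of_primal hs hg hgs hc hd h.eq_c3 h.eq_c2
  rw [← h.eq_t, div_div_cancel_left' hc] at hv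
  have hvt : v = 1 / t := by
    have : (v : ℂ) = ((1 / t : ℝ) : ℂ) := by
      rw [← hv]
      push_cast
      rw [one_div]
    exact_mod_cast this
  have hd0 : d ≠ 0 := by
    have : (d : ℂ) ≠ 0 := hd ▸ mul_ne_zero hc hE
    exact_mod_cast this
  have hdpos := scale_pos_of_value_pos hp k4 hd0 (hvt ▸ one_div_pos.2 ht)
  have hφ1 : 2 * (g / s) < Real.pi := by
    rw [← mul_div_assoc, div_lt_iff₀ hs]
    exact hgs
  have hmem := angle_mem_of_pos ha hp hdpos (div_pos hg hs) hφ1 d2 d3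
  obtain ⟨i1, i2⟩ := eq_thetaScale ha hp hmem hdpos d2 d3
  rw [i1, i2] at k4
  rw [← hvt, step_value_eq hp k4, stepValue, symmPoint]

/-- Every dual nome occurs in a theta parametrisation. -/
theorem exists_isThetaParametrisation {a s : ℝ} (ha : 0 < a) (hs : 0 < s) :
    (∃ c γ, IsThetaParametrisation a (1 / stepValue a (Real.exp (-(Real.pi * (1 / s))))) c γ
      (Complex.I * s)) ∧
    ∀ p, p = Real.exp (-(Real.pi * (1 / s))) →
      IsStepCurve (th1 p) a (thetaScale a p) (thetaAngle a p) (stepValue a p) ∧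
      IsStepCurve (th4 p) a (thetaScale a p) (thetaAngle a p) (stepValue a p) := by
  have hpi := Real.pi_pos
  have hp := exp_neg_pi_mul_mem (one_div_pos.2 hs)
  have hτ : 0 < (Complex.I * (s : ℂ)).im := by simpa using hs
  obtain ⟨⟨g1, g2⟩, -⟩ := thetaAngle_spec ha hp
  have s2 := thetaScale_sq ha hp
  have s3 := thetaScale_cube ha hp
  have hd := thetaScale_pos ha hp
  have hv0 := stepValue_pos ha hp
  set φ := thetaAngle a (Real.exp (-(Real.pi * (1 / s)))) with hφ
  set d := thetaScale a (Real.exp (-(Real.pi * (1 / s)))) with hdd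
  set g := φ * s with hg
  have hgφ : g / s = φ := mul_div_cancel_right₀ _ hs.ne'
  have hg0 : 0 < g := mul_pos (by linarith) hs
  have hgs : 2 * g < Real.pi * s := by
    rw [hg, ← mul_assoc]
    exact mul_lt_mul_of_pos_right (by linarith) hs
  have hE : dualFactor g s ≠ 0 := Complex.exp_ne_zero _
  have hdC : (d : ℂ) ≠ 0 := by exact_mod_cast hd.ne'
  set c : ℂ := d / dualFactor g s with hc
  have hc0 : c ≠ 0 := div_ne_zero hdC hE
  have hcd : c * dualFactor g s = d := div_mul_cancel₀ _ hE
  have r2 := jacobiTh_ratio_dual hs g 3 1 2 (by norm_num)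
  have r3 := jacobiTh_ratio_dual hs g 4 2 3 (by norm_num)
  simp only [Nat.cast_ofNat, Nat.cast_one, one_mul, hgφ] at r2 r3
  rw [← s2] at r2
  have c2 : c ^ 2 = jacobiTh (3 * (Complex.I * g)) (Complex.I * s) /
      jacobiTh (Complex.I * g) (Complex.I * s) := by
    rw [hc, div_pow, div_eq_iff (pow_ne_zero _ hE), r2]
    push_cast
    rfl
  have c3 : (a : ℂ) * c ^ 3 = -(jacobiTh (4 * (Complex.I * g)) (Complex.I * s) /
      jacobiTh (2 * (Complex.I * g)) (Complex.I * s)) := by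
    rw [hc, div_pow, ← mul_div_assoc, div_eq_iff (pow_ne_zero _ hE), neg_mul, r3,
      ← Complex.ofReal_neg, ← s3]
    push_cast
    rfl
  obtain ⟨v, hv, -, -, k1, k4⟩ := exists_value_of_primal hs hg0 hgs hc0 hcd c3 c2
  rw [hgφ] at k1 k4
  have hvs : v = stepValue a (Real.exp (-(Real.pi * (1 / s)))) := by
    rw [step_value_eq hp k4, stepValue, symmPoint]
  rw [← hvs] at hv0 ⊢
  have j1 : jacobiTh (Complex.I * g) (Complex.I * s) ≠ 0 := by
    intro h0
    rw [h0, div_zero] at c2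
    exact pow_ne_zero 2 hc0 c2
  have j2 : jacobiTh (2 * (Complex.I * g)) (Complex.I * s) ≠ 0 := by
    intro h0
    rw [h0, div_zero, neg_zero] at c3
    exact mul_ne_zero (by exact_mod_cast ha.ne') (pow_ne_zero 3 hc0) c3
  have hvC : (v : ℂ) ≠ 0 := by exact_mod_cast hv0.ne'
  refine ⟨⟨c, Complex.I * g, by simp, by simp, by simpa using hg0, by simpa using hgs, c3, c2, ?_,
    ?_⟩, ?_⟩
  · rw [div_eq_iff hc0] at hv
    rw [hv]
    push_cast
    rw [one_div, div_inv_eq_mul, mul_comm]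
  · intro z h1 h2
    obtain ⟨hm, hpp⟩ := mul_ne_zero_iff.1 h1
    obtain ⟨hpl, hmm⟩ := mul_ne_zero_iff.1 h2
    -- Here X = Y = 0 and S is undefined, but the kernel, being a polynomial without constant term,
    -- vanishes.
    by_cases hz : jacobiTh z (Complex.I * s) = 0
    · simp [walkKernel, thetaX, thetaY, hz]
    · have hstep := step_thetaX_thetaY hτ hc0 j1 j2 c3 c2 hz hpl hm hpp hmm
      rw [hv] at hstep
      have hX : thetaX c (Complex.I * g) (Complex.I * s) z ≠ 0 :=
        div_ne_zero (mul_ne_zero hc0 (mul_ne_zero hz hpl)) h1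
      have hY : thetaY c (Complex.I * g) (Complex.I * s) z ≠ 0 :=
        div_ne_zero (mul_ne_zero hc0 (mul_ne_zero hz hm)) h2
      generalize thetaX c (Complex.I * g) (Complex.I * s) z = X at *
      generalize thetaY c (Complex.I * g) (Complex.I * s) z = Y at *
      have e : X ^ 2 * Y + X * Y ^ 2 + Y + X + a * X ^ 2 * Y ^ 2 = X * Y * v := by
        rw [← hstep]
        field_simp
      rw [walkKernel, e]
      push_cast
      field_simp
      ring
  · rintro p rfl
    rw [← hvs]
    exact ⟨k1, k4⟩

/-! ### Bijectivity of the step value -/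

lemma stepValue_injOn {a : ℝ} (ha : 0 < a) : InjOn (stepValue a) (Ioo 0 1) := by
  have key : ∀ p ∈ Ioo (0 : ℝ) 1,
      IsStepCurve (th1 p) a (thetaScale a p) (thetaAngle a p) (stepValue a p) ∧
      IsStepCurve (th4 p) a (thetaScale a p) (thetaAngle a p) (stepValue a p) := by
    intro p hp
    obtain ⟨σ, hσ, h⟩ := exists_eq_exp_neg_pi_mul hp
    refine (exists_isThetaParametrisation ha (one_div_pos.2 hσ)).2 p ?_
    rw [one_div_one_div, h]
  intro p hp r hr h
  obtain ⟨g1, g4⟩ := key r hr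
  rw [← h] at g1 g4
  exact nome_unique ha hp hr (key p hp).1 (key p hp).2 g1 g4

/-- Continuity and injectivity leave two monotonicity types; divergence to +∞ at 1 excludes the
decreasing one. -/
lemma stepValue_strictMonoOn {a : ℝ} (ha : 0 < a) : StrictMonoOn (stepValue a) (Ioo 0 1) := by
  have hc := (continuousOn_stepValue ha).mono (Ioo_subset_Ico_self)
  rcases hc.strictMonoOn_of_injOn_Ioo one_pos (stepValue_injOn ha) with h | h
  · exact h
  · exfalso
    have hev := (tendsto_stepValue ha).eventually_gt_atTop (stepValue a (1 / 2))
    obtain ⟨p, hp, hp1, hp2⟩ :=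
      (hev.and (Ioo_mem_nhdsLT (by norm_num : (1 / 2 : ℝ) < 1))).exists
    have := h (a := 1 / 2) (b := p) ⟨by norm_num, by norm_num⟩ ⟨by linarith, hp2⟩ hp1
    linarith

lemma stepValue_image {a : ℝ} (ha : 0 < a) :
    stepValue a '' Ioo 0 1 = Ioi (stepValue a 0) := by
  have hcont := continuousOn_stepValue ha
  have h0 : Tendsto (stepValue a) (𝓝[>] 0) (𝓝 (stepValue a 0)) := by
    have := (hcont 0 ⟨le_rfl, one_pos⟩).tendsto
    refine this.mono_left (nhdsWithin_le_iff.2 ?_)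
    filter_upwards [Ioo_mem_nhdsGT (zero_lt_one : (0 : ℝ) < 1)] with p hp
    exact ⟨hp.1.le, hp.2⟩
  have hmono := stepValue_strictMonoOn ha
  apply Subset.antisymm
  · rintro _ ⟨p, hp, rfl⟩
    have hp2 : p / 2 ∈ Ioo (0 : ℝ) 1 := ⟨by linarith [hp.1], by linarith [hp.1, hp.2]⟩
    refine lt_of_le_of_lt ?_ (hmono hp2 hp (by linarith [hp.1]))
    refine le_of_tendsto h0 ?_
    filter_upwards [Ioo_mem_nhdsGT hp2.1] with r hr
    exact (hmono ⟨hr.1, hr.2.trans hp2.2⟩ hp2 hr.2).le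
  · intro y hy
    obtain ⟨p, hp, hp0, hp1⟩ := ((h0.eventually_lt_const hy).and
      (Ioo_mem_nhdsGT (zero_lt_one : (0 : ℝ) < 1))).exists
    obtain ⟨r, hr, hr0, hr1⟩ := (((tendsto_stepValue ha).eventually_gt_atTop y).and
      (Ioo_mem_nhdsLT hp1)).exists
    have := intermediate_value_Icc hr0.le (hcont.mono fun x hx =>
      ⟨hp0.le.trans hx.1, hx.2.trans_lt hr1⟩) ⟨hp.le, hr.le⟩
    obtain ⟨x, hx, rfl⟩ := this
    exact ⟨x, ⟨hp0.trans_le hx.1, hx.2.trans_lt hr1⟩, rfl⟩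

/-! ### From the dual nome back to q -/

/-- The involution of the unit interval that exchanges a nome and its dual. -/
noncomputable def dualNome (q : ℝ) : ℝ := Real.exp (Real.pi ^ 2 / Real.log q)

lemma dualNome_mem {q : ℝ} (hq : q ∈ Ioo (0 : ℝ) 1) : dualNome q ∈ Ioo (0 : ℝ) 1 := by
  refine ⟨Real.exp_pos _, ?_⟩
  rw [dualNome, Real.exp_lt_one_iff]
  exact div_neg_of_pos_of_neg (by positivity) (Real.log_neg hq.1 hq.2)

lemma dualNome_dualNome {q : ℝ} (hq : q ∈ Ioo (0 : ℝ) 1) : dualNome (dualNome q) = q := by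
  have := (Real.log_neg hq.1 hq.2).ne
  rw [dualNome, dualNome, Real.log_exp, div_div_cancel₀ (by positivity), Real.exp_log hq.1]

lemma dualNome_exp {s : ℝ} (hs : 0 < s) :
    dualNome (Real.exp (-(Real.pi * (1 / s)))) = Real.exp (-(Real.pi * s)) := by
  rw [dualNome, Real.log_exp]
  congr 1
  field_simp

lemma dualNome_lt {q r : ℝ} (hq : q ∈ Ioo (0 : ℝ) 1) (hr : r ∈ Ioo (0 : ℝ) 1) (h : q < r) :
    dualNome r < dualNome q := by
  have h1 := Real.log_neg hq.1 hq.2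
  have h2 := Real.log_neg hr.1 hr.2
  have h3 := Real.log_lt_log hq.1 h
  rw [dualNome, dualNome, Real.exp_lt_exp, div_eq_mul_inv, div_eq_mul_inv]
  exact mul_lt_mul_of_pos_left ((inv_lt_inv_of_neg h2 h1).2 h3) (by positivity)

/-- A strictly increasing bijection of intervals has a continuous inverse. -/
lemma exists_continuous_inverse {T : ℝ → ℝ} {b : ℝ} (hb : 0 < b) (hT : StrictMonoOn T (Ioo 0 1))
    (him : T '' Ioo 0 1 = Ioo 0 b) :
    ∃ q : ℝ → ℝ, (∀ t ∈ Ioo 0 b, q t ∈ Ioo 0 1 ∧ T (q t) = t) ∧ ContinuousOn q (Ioo 0 b) ∧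
      Tendsto q (𝓝[>] 0) (𝓝 0) ∧ Tendsto q (𝓝[<] b) (𝓝 1) := by
  have hex : ∀ t, t ∈ Ioo 0 b → ∃ x ∈ Ioo (0 : ℝ) 1, T x = t := by
    intro t ht
    rw [← him] at ht
    exact ht
  choose! q hq hTq using hex
  have hTm : ∀ x ∈ Ioo (0 : ℝ) 1, T x ∈ Ioo 0 b := fun x hx => him ▸ mem_image_of_mem T hx
  have hqT : ∀ x ∈ Ioo (0 : ℝ) 1, q (T x) = x := fun x hx =>
    hT.injOn (hq _ (hTm x hx)) hx (hTq _ (hTm x hx))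
  have hlt : ∀ t ∈ Ioo 0 b, ∀ x ∈ Ioo (0 : ℝ) 1, t < T x → q t < x := by
    intro t ht x hx h
    rw [← hTq t ht] at h
    exact (hT.lt_iff_lt (hq t ht) hx).1 h
  have hgt : ∀ t ∈ Ioo 0 b, ∀ x ∈ Ioo (0 : ℝ) 1, T x < t → x < q t := by
    intro t ht x hx h
    rw [← hTq t ht] at h
    exact (hT.lt_iff_lt hx (hq t ht)).1 h
  refine ⟨q, fun t ht => ⟨hq t ht, hTq t ht⟩, fun t ht => ?_, ?_, ?_⟩
  · refine ContinuousAt.continuousWithinAt ?_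
    have hmono : MonotoneOn q (Ioo 0 b) := by
      intro t ht u hu htu
      rw [← hTq t ht, ← hTq u hu] at htu
      exact (hT.le_iff_le (hq t ht) (hq u hu)).1 htu
    refine continuousAt_of_monotoneOn_of_image_mem_nhds hmono (Ioo_mem_nhds ht.1 ht.2) ?_
    refine mem_of_superset (Ioo_mem_nhds (hq t ht).1 (hq t ht).2) fun x hx => ?_
    exact ⟨T x, hTm x hx, hqT x hx⟩
  · refine tendsto_order.2 ⟨fun l hl => ?_, fun u hu => ?_⟩
    · filter_upwards [Ioo_mem_nhdsGT hb] with t ht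
      exact hl.trans (hq t ht).1
    · obtain ⟨x, hx0, hx1⟩ := exists_between (lt_min hu one_pos)
      have hx : x ∈ Ioo (0 : ℝ) 1 := ⟨hx0, hx1.trans_le (min_le_right _ _)⟩
      filter_upwards [Ioo_mem_nhdsGT (hTm x hx).1] with t ht
      exact (hlt t ⟨ht.1, ht.2.trans (hTm x hx).2⟩ x hx ht.2).trans
        (hx1.trans_le (min_le_left _ _))
  · refine tendsto_order.2 ⟨fun l hl => ?_, fun u hu => ?_⟩
    · obtain ⟨x, hx0, hx1⟩ := exists_between (max_lt hl one_pos)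
      have hx : x ∈ Ioo (0 : ℝ) 1 := ⟨(le_max_right _ _).trans_lt hx0, hx1⟩
      filter_upwards [Ioo_mem_nhdsLT (hTm x hx).2] with t ht
      exact (le_max_left _ _).trans_lt (hx0.trans
        (hgt t ⟨(hTm x hx).1.trans ht.1, ht.2⟩ x hx ht.1))
    · filter_upwards [Ioo_mem_nhdsLT hb] with t ht
      exact (hq t ht).2.trans hu

theorem mainTheorem7 (a : ℝ) (ha : 0 < a) :
    0 < criticalPoint a ∧
    ∃ q : ℝ → ℝ,
      (∀ t ∈ Ioo 0 (criticalPoint a),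
        (∃ c γ τ : ℂ, IsThetaParametrisation a t c γ τ) ∧
        ∀ c γ τ : ℂ, IsThetaParametrisation a t c γ τ →
          Complex.exp (Complex.I * Real.pi * τ) = (q t : ℂ)) ∧
      (∀ t ∈ Ioo 0 (criticalPoint a), 0 < q t ∧ q t < 1) ∧
      ContinuousOn q (Ioo 0 (criticalPoint a)) ∧
      Tendsto q (𝓝[>] 0) (𝓝 0) ∧
      Tendsto q (𝓝[<] (criticalPoint a)) (𝓝 1) := by
  have h01 : (0 : ℝ) ∈ Ico (0 : ℝ) 1 := ⟨le_rfl, one_pos⟩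
  have hv0 := stepValue_pos ha h01
  have hcrit : criticalPoint a = 1 / stepValue a 0 :=
    criticalPoint_eq ha (symmPoint_pos ha h01) (symmPoint_zero ha)
  have hpos : 0 < criticalPoint a := hcrit ▸ one_div_pos.2 hv0
  refine ⟨hpos, ?_⟩
  have hmono := stepValue_strictMonoOn ha
  have himage := stepValue_image ha
  -- This map is t as a function of q. Duality and inversion each reverse order, so t increases with
  -- q and the required q(t) is its inverse.
  have hT : StrictMonoOn (fun q => 1 / stepValue a (dualNome q)) (Ioo 0 1) := by
    intro q hq r hr h
    have hr' := dualNome_mem hr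
    exact one_div_lt_one_div_of_lt (stepValue_pos ha ⟨hr'.1.le, hr'.2⟩)
      (hmono hr' (dualNome_mem hq) (dualNome_lt hq hr h))
  have hTim : (fun q => 1 / stepValue a (dualNome q)) '' Ioo 0 1 = Ioo 0 (criticalPoint a) := by
    rw [hcrit]
    apply Subset.antisymm
    · rintro _ ⟨q, hq, rfl⟩
      have := mem_image_of_mem (stepValue a) (dualNome_mem hq)
      rw [himage] at this
      exact ⟨one_div_pos.2 (hv0.trans this), one_div_lt_one_div_of_lt hv0 this⟩
    · rintro t ⟨ht0, ht1⟩
      have : 1 / t ∈ Ioi (stepValue a 0) := by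
        rw [mem_Ioi, lt_one_div hv0 ht0]
        exact ht1
      rw [← himage] at this
      obtain ⟨p, hp, hpt⟩ := this
      refine ⟨dualNome p, dualNome_mem hp, ?_⟩
      simp only [dualNome_dualNome hp, hpt, one_div_one_div]
  obtain ⟨q, hq, hqc, hq0, hq1⟩ := exists_continuous_inverse hpos hT hTim
  refine ⟨q, fun t ht => ⟨?_, fun c γ τ h => ?_⟩, fun t ht => (hq t ht).1, hqc, hq0, hq1⟩
  · obtain ⟨hqt, hTq⟩ := hq t ht
    obtain ⟨σ, hσ, h⟩ := exists_eq_exp_neg_pi_mul (dualNome_mem hqt)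
    obtain ⟨c, γ, hpar⟩ := (exists_isThetaParametrisation ha (one_div_pos.2 hσ)).1
    rw [one_div_one_div, h, hTq] at hpar
    exact ⟨c, γ, _, hpar⟩
  · obtain ⟨hqt, hTq⟩ := hq t ht
    obtain ⟨hs, hτ, hval⟩ := h.stepValue_eq ha ht.1
    have hmem := exp_neg_pi_mul_mem (one_div_pos.2 hs)
    have hTq' : stepValue a (dualNome (q t)) = 1 / t :=
      (one_div_one_div _).symm.trans (congrArg (fun x => 1 / x) hTq)
    have heq := stepValue_injOn ha (dualNome_mem hqt) ⟨Real.exp_pos _, hmem.2⟩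
      (hTq'.trans hval.symm)
    have hqe : q t = Real.exp (-(Real.pi * τ.im)) := by
      rw [← dualNome_dualNome hqt, heq, dualNome_exp hs]
    rw [hqe, Complex.ofReal_exp, hτ]
    congr 1
    simp only [Complex.mul_im, Complex.I_re, Complex.I_im, Complex.ofReal_re, Complex.ofReal_im]
    push_cast
    linear_combination (Real.pi * (τ.im : ℂ)) * Complex.I_sq
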